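/- Let $G=\mathbb Z/4$ with generator $a$, and consider the following integral representations of $G$ on $\mathbb Z^n$ (with $n=1,1,2,2,3,4$ respectively; matrices act on column vectors): $$\rho_1:a\mapsto (1),\quad \rho_2:a\mapsto(-1),\quad \rho_3:a\mapsto\begin{pmatrix}0&1\\1&0\end{pmatrix},\quad \rho_4:a\mapsto\begin{pmatrix}0&1\\-1&0\end{pmatrix},$$ $$\rho_5:a\mapsto\begin{pmatrix}0&0&-1\\1&0&-1\\0&1&-1\end{pmatrix},\quad \rho_7:a\mapsto\begin{pmatrix}0&1&0&0\\0&0&1&0\\0&0&0&1\\1&0&0&0\end{pmatrix}.$$ Let $L$ be a $\mathbb ZG$-lattice isomorphic, as a $\mathbb ZG$-module, to a finite direct sum of modules each of which is one of $\rho_1,\rho_2,\rho_3,\rho_4,\rho_5,\rho_7$. For a commutative ring $R$ and a $\mathbb Z$-basis $x_1,\dots,x_n$ of $L$, let $K_*=K(x_1-1,\dots,x_n-1)$ be the Koszul complex over the group ring $R[L]$: $K_*$ is the exterior algebra over $R[L]$ on generators $a_1,\dots,a_n$ of degree one, with differential $$d(a_{i_1}\cdots a_{i_p})=\sum_{j=1}^p(-1)^{j-1}(x_{i_j}-1)\,a_{i_1}\cdots\widehat{a_{i_j}}\cdots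 a_{i_p},$$ augmented by $K_0=R[L]\to R$, $x\mapsto 1$ for $x\in L$. For $g\in G$, let $x\mapsto x^g$ denote the $R$-linear extension to $R[L]$ of the action of $g$ on $L$. Then: 1. For every commutative ring $R$ and every $\mathbb Z$-basis of $L$, the complex $K_*$ is a free resolution of the trivial module $R$ over $R[L]$, and it admits a compatible action of $G$; that is, there are augmentation-preserving chain maps $\tau(g):K_*\to K_*$ $(g\in G)$ such that $\tau(g)(xf)=x^g\,\tau(g)(f)$ for all $x\in R[L]$ and $f\in K_*$, $\tau(g)\tau(g')=\tau(gg')$ for all $g,g'\in G$, and $\tau(1)=1$. 2. For every $k\ge 0$ there is an isomorphism of abelian groups $$H^k(L\rtimes G,\mathbb Z)\cong\bigoplus_{i+j=k}H^i\bigl(G,H^j(L,\mathbb Z)\bigr),$$ where $\mathbb Z$ is the trivial module and $G$ acts on $H^j(L,\mathbb Z)$ through its action on $L$. -/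

import Mathlib

open CategoryTheory

namespace LatticeExt

/-! ### Group rings of lattices -/

/-- The augmentation `R[L] → R`, sending every `l ∈ L` to `1`. -/
noncomputable def aug (R : Type*) [CommRing R] (L : Type*) [AddCommGroup L] :
    AddMonoidAlgebra R L →+* R :=
  (AddMonoidAlgebra.lift R R L (1 : Multiplicative L →* R)).toRingHom

/-- The `R`-linear extension `x ↦ x ^ g` to `R[L]` of the action of `g` on the lattice `L`. -/
noncomputable def groupRingAct (R : Type*) [CommRing R] {G L : Type*} [Group G] [AddCommGroup L]
    (ρ : Representation ℤ G L) (g : G) : AddMonoidAlgebra R L →+* AddMonoidAlgebra R L :=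
  AddMonoidAlgebra.mapDomainRingHom R (ρ g).toAddMonoidHom

theorem aug_single (R : Type*) [CommRing R] {L : Type*} [AddCommGroup L] (l : L) (r : R) :
    aug R L (AddMonoidAlgebra.single l r) = r := by
  simp [aug]

theorem groupRingAct_single (R : Type*) [CommRing R] {G L : Type*} [Group G] [AddCommGroup L]
    (ρ : Representation ℤ G L) (g : G) (l : L) (r : R) :
    groupRingAct R ρ g (AddMonoidAlgebra.single l r) = AddMonoidAlgebra.single (ρ g l) r := by
  simp [groupRingAct]

/-! ### Free resolutions and compatible actions -/

/-- `ε : F → R` is a free resolution of the trivial module `R` over `R[L]`. That `ε` is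
`R[L]`-linear for the trivial action on `R` is expressed as semilinearity along the
augmentation. -/
structure IsFreeResolution {R L : Type*} [CommRing R] [AddCommGroup L]
    (F : ChainComplex (ModuleCat (AddMonoidAlgebra R L)) ℕ)
    (ε : F.X 0 →ₛₗ[aug R L] R) : Prop where
  free : ∀ n, Module.Free (AddMonoidAlgebra R L) (F.X n)
  exact : ∀ n, Function.Exact (F.d (n + 2) (n + 1)).hom (F.d (n + 1) n).hom
  exact_zero : Function.Exact (F.d 1 0).hom ε
  surjective : Function.Surjective ε

/-- An action of `G` on the augmented complex `ε : F → R` of `R[L]`-modules that is compatible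
with `ρ`. -/
structure CompatibleAction {R G L : Type*} [CommRing R] [Group G] [AddCommGroup L]
    (ρ : Representation ℤ G L)
    (F : ChainComplex (ModuleCat (AddMonoidAlgebra R L)) ℕ)
    (ε : F.X 0 →ₛₗ[aug R L] R) where
  /-- The maps `τ(g)`, semilinear in the sense `τ(g)(x f) = x ^ g τ(g)(f)` for `x ∈ R[L]`. -/
  τ : ∀ (g : G) (n : ℕ), F.X n →ₛₗ[groupRingAct R ρ g] F.X n
  /-- `τ(g)` is a chain map. -/
  comm : ∀ (g : G) (n : ℕ) (f : F.X (n + 1)),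
    τ g n ((F.d (n + 1) n).hom f) = (F.d (n + 1) n).hom (τ g (n + 1) f)
  /-- `τ(g)` preserves the augmentation. -/
  aug_comm : ∀ (g : G) (f : F.X 0), ε (τ g 0 f) = ε f
  mul : ∀ (g h : G) (n : ℕ) (f : F.X n), τ g n (τ h n f) = τ (g * h) n f
  one : ∀ (n : ℕ) (f : F.X n), τ 1 n f = f

/-! ### Koszul complexes -/

section Koszul

variable {A : Type*} [CommRing A] {M : Type*} [AddCommGroup M] [Module A M]

/-- The Koszul differential on the exterior algebra of `M` attached to `φ : M → A`: the left
contraction, that is the antiderivation that extends `φ`. -/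
noncomputable def koszulDiff (φ : Module.Dual A M) :
    ExteriorAlgebra A M →ₗ[A] ExteriorAlgebra A M :=
  CliffordAlgebra.contractLeft (Q := (0 : QuadraticForm A M)) φ

/-- The usual formula for the Koszul differential:
`d (v₀ ∧ ⋯ ∧ vₚ) = ∑ⱼ (-1) ^ j φ(vⱼ) v₀ ∧ ⋯ v̂ⱼ ⋯ ∧ vₚ`. -/
theorem koszulDiff_ιMulti (φ : Module.Dual A M) (p : ℕ) (v : Fin (p + 1) → M) :
    koszulDiff φ (ExteriorAlgebra.ιMulti A (p + 1) v) =
      ∑ j : Fin (p + 1), ((-1) ^ (j : ℕ) * φ (v j)) •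
        ExteriorAlgebra.ιMulti A p (fun i => v (j.succAbove i)) := by
  induction p with
  | zero =>
    rw [ExteriorAlgebra.ιMulti_succ_apply]
    simp [koszulDiff, ExteriorAlgebra.ι, CliffordAlgebra.contractLeft_ι,
      Algebra.algebraMap_eq_smul_one]
  | succ p ih =>
    rw [ExteriorAlgebra.ιMulti_succ_apply]
    have h := CliffordAlgebra.contractLeft_ι_mul (Q := (0 : QuadraticForm A M)) (d := φ) (v 0)
      (ExteriorAlgebra.ιMulti A (p + 1) (Matrix.vecTail v))
    change koszulDiff φ (ExteriorAlgebra.ι A (v 0) * _) =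
      φ (v 0) • _ - ExteriorAlgebra.ι A (v 0) * koszulDiff φ _ at h
    rw [h, ih, Fin.sum_univ_succ (n := p + 1), Finset.mul_sum, sub_eq_add_neg, ← Finset.sum_neg_distrib]
    congr 1
    · simp [Matrix.vecTail, Function.comp_def]
    · refine Finset.sum_congr rfl fun j _ => ?_
      rw [ExteriorAlgebra.ιMulti_succ_apply (v := fun i => v (j.succ.succAbove i)),
        Algebra.mul_smul_comm, ← neg_smul]
      simp [Matrix.vecTail, Function.comp_def, pow_succ]

theorem koszulDiff_mem (φ : Module.Dual A M) (p : ℕ) :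
    ∀ x ∈ ⋀[A]^(p + 1) M, koszulDiff φ x ∈ ⋀[A]^p M := by
  intro x hx
  rw [← exteriorPower.ιMulti_span_fixedDegree] at hx
  induction hx using Submodule.span_induction with
  | mem x h =>
    obtain ⟨v, rfl⟩ := h
    rw [koszulDiff_ιMulti]
    refine Submodule.sum_mem _ fun j _ => Submodule.smul_mem _ _ ?_
    exact (exteriorPower.ιMulti A p fun i => v (j.succAbove i)).2
  | zero => simp
  | add x y _ _ hx hy => rw [map_add]; exact Submodule.add_mem _ hx hy
  | smul a x _ hx => rw [map_smul]; exact Submodule.smul_mem _ _ hx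

/-- The Koszul differential `⋀ᵖ⁺¹ M → ⋀ᵖ M`. -/
noncomputable def koszulD (φ : Module.Dual A M) (p : ℕ) : ⋀[A]^(p + 1) M →ₗ[A] ⋀[A]^p M :=
  (koszulDiff φ).restrict (koszulDiff_mem φ p)

theorem koszulD_koszulD (φ : Module.Dual A M) (p : ℕ) :
    koszulD φ p ∘ₗ koszulD φ (p + 1) = 0 := by
  ext x
  simp [koszulD, koszulDiff, CliffordAlgebra.contractLeft_contractLeft]

end Koszul

/-- The Koszul complex `K(x₁, …, xₙ)` over `A`: in degree `p` it is `⋀ᵖ(Aⁿ)`, with differential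
determined by `d(aᵢ) = xᵢ` on the standard basis `a₁, …, aₙ` of `Aⁿ`. -/
noncomputable def koszulComplex {A : Type*} [CommRing A] {n : ℕ} (x : Fin n → A) :
    ChainComplex (ModuleCat A) ℕ :=
  ChainComplex.of (fun p => ModuleCat.of A (⋀[A]^p (Fin n → A)))
    (fun p => ModuleCat.ofHom (koszulD (Fintype.linearCombination A x) p))
    (fun p => by rw [← ModuleCat.ofHom_comp, koszulD_koszulD]; rfl)

/-- The Koszul complex `K(x₁ - 1, …, xₙ - 1)` over `R[L]`, where `x₁, …, xₙ` are the elements of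
the group ring given by a basis of the lattice `L`. -/
noncomputable def latticeKoszul (R : Type*) [CommRing R] {L : Type*} [AddCommGroup L] {n : ℕ}
    (b : Module.Basis (Fin n) ℤ L) : ChainComplex (ModuleCat (AddMonoidAlgebra R L)) ℕ :=
  koszulComplex fun i => AddMonoidAlgebra.single (b i) (1 : R) - 1

/-- The augmentation `K₀ = R[L] → R` of the Koszul complex. -/
noncomputable def latticeKoszulAug (R : Type*) [CommRing R] {L : Type*} [AddCommGroup L] {n : ℕ}
    (b : Module.Basis (Fin n) ℤ L) : (latticeKoszul R b).X 0 →ₛₗ[aug R L] R :=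
  (aug R L).toSemilinearMap.comp
    (exteriorPower.zeroEquiv (R := AddMonoidAlgebra R L)
      (M := Fin n → AddMonoidAlgebra R L)).toLinearMap

/-! ### Cohomology of semidirect products -/

/-- The action of `G` on the lattice `L`, written as an action on the multiplicative group `L`. -/
noncomputable def latticeAut {G L : Type*} [Group G] [AddCommGroup L] (ρ : Representation ℤ G L) :
    G →* MulAut (Multiplicative L) where
  toFun g := AddEquiv.toMultiplicative
    { toFun := ρ g
      invFun := ρ g⁻¹
      left_inv := fun x => by simp
      right_inv := fun x => by simp
      map_add' := map_add (ρ g) }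
  map_one' := by ext x; simp
  map_mul' g h := by ext x; simp

/-- The semidirect product `L ⋊ G`. -/
abbrev SemiProd {G L : Type*} [Group G] [AddCommGroup L] (ρ : Representation ℤ G L) : Type _ :=
  SemidirectProduct (Multiplicative L) G (latticeAut ρ)

/-- `Hᵏ(Γ, ℤ)` for the trivial `Γ`-module `ℤ`. -/
noncomputable abbrev intCohomology (Γ : Type) [Group Γ] (k : ℕ) : ModuleCat ℤ :=
  groupCohomology (Rep.trivial ℤ Γ ℤ) k

/-- The homomorphism `Hʲ(Γ', ℤ) → Hʲ(Γ, ℤ)` induced by `f : Γ → Γ'`. -/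
noncomputable def intCohomologyMap {Γ Γ' : Type} [Group Γ] [Group Γ'] (f : Γ →* Γ') (j : ℕ) :
    intCohomology Γ' j →ₗ[ℤ] intCohomology Γ j :=
  (groupCohomology.map (A := Rep.trivial ℤ Γ' ℤ) (B := Rep.trivial ℤ Γ ℤ) f
    (Rep.ofHom ⟨LinearMap.id, fun _ => rfl⟩) j).hom

theorem intCohomologyMap_id (Γ : Type) [Group Γ] (j : ℕ) :
    intCohomologyMap (MonoidHom.id Γ) j = LinearMap.id := by
  have h := groupCohomology.map_id (B := Rep.trivial ℤ Γ ℤ) (n := j)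
  exact congrArg ModuleCat.Hom.hom h

theorem intCohomologyMap_comp {Γ Γ' Γ'' : Type} [Group Γ] [Group Γ'] [Group Γ'']
    (f : Γ' →* Γ'') (g : Γ →* Γ') (j : ℕ) :
    intCohomologyMap (f.comp g) j = intCohomologyMap g j ∘ₗ intCohomologyMap f j := by
  have h := groupCohomology.map_comp (A := Rep.trivial ℤ Γ'' ℤ) (B := Rep.trivial ℤ Γ' ℤ)
    (C := Rep.trivial ℤ Γ ℤ) f g (Rep.ofHom ⟨LinearMap.id, fun _ => rfl⟩)
    (Rep.ofHom ⟨LinearMap.id, fun _ => rfl⟩) j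
  exact congrArg ModuleCat.Hom.hom h

/-- The `G`-module `Hʲ(L, ℤ)`: the element `g` acts by the map induced on cohomology by the
automorphism `g⁻¹` of `L`. -/
noncomputable def latticeCohomology {G L : Type} [Group G] [AddCommGroup L]
    (ρ : Representation ℤ G L) (j : ℕ) : Rep ℤ G :=
  Rep.of (X := intCohomology (Multiplicative L) j)
    { toFun := fun g => intCohomologyMap (latticeAut ρ g⁻¹).toMonoidHom j
      map_one' := by
        rw [inv_one, map_one]
        exact intCohomologyMap_id _ _
      map_mul' := fun g h => by
        rw [mul_inv_rev, map_mul]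
        exact intCohomologyMap_comp (latticeAut ρ h⁻¹).toMonoidHom
          (latticeAut ρ g⁻¹).toMonoidHom j }

/-! ### The representations of `ℤ/4` -/

/-- The cyclic group of order four, written multiplicatively. -/
abbrev C4 : Type := Multiplicative (ZMod 4)

/-- Labels for the indecomposables `ρ₁, ρ₂, ρ₃, ρ₄, ρ₅, ρ₇`. -/
inductive RhoIndex
  | r1 | r2 | r3 | r4 | r5 | r7

/-- The rank of `ρᵢ`. -/
def RhoIndex.rank : RhoIndex → ℕ
  | .r1 => 1
  | .r2 => 1
  | .r3 => 2
  | .r4 => 2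
  | .r5 => 3
  | .r7 => 4

/-- The matrix by which the generator `a` of `ℤ/4` acts in `ρᵢ`. -/
def RhoIndex.matrix : (i : RhoIndex) → Matrix (Fin i.rank) (Fin i.rank) ℤ
  | .r1 => (!![1] : Matrix (Fin 1) (Fin 1) ℤ)
  | .r2 => (!![-1] : Matrix (Fin 1) (Fin 1) ℤ)
  | .r3 => (!![0, 1; 1, 0] : Matrix (Fin 2) (Fin 2) ℤ)
  | .r4 => (!![0, 1; -1, 0] : Matrix (Fin 2) (Fin 2) ℤ)
  | .r5 => (!![0, 0, -1; 1, 0, -1; 0, 1, -1] : Matrix (Fin 3) (Fin 3) ℤ)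
  | .r7 => (!![0, 1, 0, 0; 0, 0, 1, 0; 0, 0, 0, 1; 1, 0, 0, 0] : Matrix (Fin 4) (Fin 4) ℤ)

theorem RhoIndex.matrix_pow_four (i : RhoIndex) : i.matrix ^ 4 = 1 := by
  cases i
  · exact (by decide : (!![1] : Matrix (Fin 1) (Fin 1) ℤ) ^ 4 = 1)
  · exact (by decide : (!![-1] : Matrix (Fin 1) (Fin 1) ℤ) ^ 4 = 1)
  · exact (by decide : (!![0, 1; 1, 0] : Matrix (Fin 2) (Fin 2) ℤ) ^ 4 = 1)
  · exact (by decide : (!![0, 1; -1, 0] : Matrix (Fin 2) (Fin 2) ℤ) ^ 4 = 1)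
  · exact (by decide : (!![0, 0, -1; 1, 0, -1; 0, 1, -1] : Matrix (Fin 3) (Fin 3) ℤ) ^ 4 = 1)
  · exact (by decide : (!![0, 1, 0, 0; 0, 0, 1, 0; 0, 0, 0, 1; 1, 0, 0, 0] :
      Matrix (Fin 4) (Fin 4) ℤ) ^ 4 = 1)

/-- The integral representation `ρᵢ` of `ℤ/4` on the column vectors `ℤ^(rank i)`: the generator
`a`, the class of `1`, acts by the matrix of `ρᵢ`. -/
noncomputable def RhoIndex.rep (i : RhoIndex) : Representation ℤ C4 (Fin i.rank → ℤ) where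
  toFun g := Matrix.toLin' (i.matrix ^ (Multiplicative.toAdd g).val)
  map_one' := by simp [Module.End.one_eq_id]
  map_mul' g h := by
    rw [toAdd_mul, ZMod.val_add, ← pow_eq_pow_mod _ i.matrix_pow_four, pow_add, Matrix.toLin'_mul]
    rfl

theorem RhoIndex.rep_generator (i : RhoIndex) (v : Fin i.rank → ℤ) :
    i.rep (Multiplicative.ofAdd (1 : ZMod 4)) v = i.matrix.mulVec v := by
  have h : (1 : ZMod 4).val = 1 := rfl
  simp [RhoIndex.rep, h]

/-- The `ℤ[ℤ/4]`-module `L` is isomorphic to a finite direct sum of copies of the modules `ρᵢ`. -/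
def IsSumOfRho {L : Type*} [AddCommGroup L] (ρ : Representation ℤ C4 L) : Prop :=
  ∃ (m : ℕ) (c : Fin m → RhoIndex),
    Nonempty (ρ.Equiv (Representation.directSum fun s => (c s).rep))

end LatticeExt

namespace LatticeExt

/-! ### Semilinear functoriality of the exterior algebra -/

section SemilinearMap

variable {A B : Type*} [CommRing A] [CommRing B] {M N : Type*} [AddCommGroup M] [Module A M]
  [AddCommGroup N] [Module B N]

/-! Write `A = R[L]`.

Exactness. Modulo the elements `x_i - 1` with `i` in a set `S`, the group ring becomes the group
ring of the lattice with these basis vectors killed, where every remaining `x_j - 1` is still a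
non-zero-divisor because `x_j` has infinite order (`isIndependentlyRegular_basis`). Exactness
follows by adding one generator of the Koszul complex at a time
(`IsIndependentlyRegular.exists_koszulDiff_eq`).

Action. The Koszul complex is the exterior algebra of `A^n` with the contraction by a linear form
`φ`. A map `T` of `A^n`, semilinear along the action `σ` of the generator `a`, with `φ ∘ T = σ ∘ φ`
and `T^4 = 1`, therefore induces the whole action (`nonempty_compatibleAction`). Such a `T` is
written down for each `ρ_i` in its given basis (`hasPeriodicLift_rho`); the sum of these handles a
direct sum. Another basis of `L` changes the pair `(A^n, φ)` only by an isomorphism: two bases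
differ by sign changes, transvections and permutations, and each of these lifts to a change of
generators of `A^n` (`koszulReduces_basis`).

Cohomology. For `R = ℤ` the action makes the Koszul complex `K` a complex of modules over `L ⋊ G`.
Let `P` be the standard resolution of `G`. Then `Tot (P ⊗ K)` is a projective resolution over `L ⋊
G`: it is exact because `P` is linearly contractible, and projective because `Hom(P_i ⊗ K_j, X) =
Hom_G(P_i, Hom_L(K_j, X))` (`projective_inflTensor`). An `L`-invariant functional on `K` does not
see the Koszul differential, whose coefficients `x_i - 1` have augmentation zero
(`isMinimal_latticeKoszul`). So `Hom(Tot (P ⊗ K), ℤ)` keeps only the differential of `P` and splits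
as a product over `j` of shifted complexes `Hom_G(P, Hom_L(K_j, ℤ))`. This gives the sum of the
groups `H^i(G, Hom_L(K_j, ℤ))`.

For the same reason `Hom_L(K_j, ℤ)` is already `H^j(L, ℤ)`. The identification respects `G`:
conjugating a comparison map from `K` to the bar resolution by `g` gives a homotopic map, and
homotopic maps agree on cohomology classes, which here are actual functionals
(`IsMinimal.functionalOfCochain_twist`). -/

/-- The ring homomorphism of exterior algebras induced by a semilinear map. -/
noncomputable def extMap {σ : A →+* B} (T : M →ₛₗ[σ] N) :
    ExteriorAlgebra A M →+* ExteriorAlgebra B N :=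
  -- Restricting scalars along `σ` makes the semilinear map linear, so that the universal property
  -- of the exterior algebra applies.
  letI : Algebra A (ExteriorAlgebra B N) := Algebra.compHom _ σ
  (ExteriorAlgebra.lift A (A := ExteriorAlgebra B N)
    ⟨{ toFun := fun m => ExteriorAlgebra.ι B (T m)
       map_add' := fun x y => by rw [map_add, map_add]
       map_smul' := fun a x => by
        rw [map_smulₛₗ, map_smul, RingHom.id_apply]
        rfl },
      fun m => ExteriorAlgebra.ι_sq_zero (T m)⟩).toRingHom

variable {σ : A →+* B} (T : M →ₛₗ[σ] N)

@[simp]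
theorem extMap_ι (m : M) : extMap T (ExteriorAlgebra.ι A m) = ExteriorAlgebra.ι B (T m) := by
  let : Algebra A (ExteriorAlgebra B N) := Algebra.compHom _ σ
  exact ExteriorAlgebra.lift_ι_apply (A := ExteriorAlgebra B N) A _ _ m

@[simp]
theorem extMap_algebraMap (a : A) :
    extMap T (algebraMap A _ a) = algebraMap B (ExteriorAlgebra B N) (σ a) := by
  let : Algebra A (ExteriorAlgebra B N) := Algebra.compHom _ σ
  exact AlgHom.commutes (ExteriorAlgebra.lift A (A := ExteriorAlgebra B N) _) a

theorem extMap_smul (a : A) (x : ExteriorAlgebra A M) :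
    extMap T (a • x) = σ a • extMap T x := by
  rw [Algebra.smul_def, map_mul, extMap_algebraMap, ← Algebra.smul_def]

theorem extMap_ιMulti (p : ℕ) (v : Fin p → M) :
    extMap T (ExteriorAlgebra.ιMulti A p v) = ExteriorAlgebra.ιMulti B p fun i => T (v i) := by
  rw [ExteriorAlgebra.ιMulti_apply, ExteriorAlgebra.ιMulti_apply, map_list_prod, List.map_ofFn]
  simp [Function.comp_def]

theorem extMap_mem (p : ℕ) : ∀ x ∈ ⋀[A]^p M, extMap T x ∈ ⋀[B]^p N := by
  intro x hx
  rw [← exteriorPower.ιMulti_span_fixedDegree] at hx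
  induction hx using Submodule.span_induction with
  | mem x h =>
    obtain ⟨v, rfl⟩ := h
    rw [extMap_ιMulti]
    exact (exteriorPower.ιMulti B p _).2
  | zero => simp
  | add x y _ _ hx hy => rw [map_add]; exact Submodule.add_mem _ hx hy
  | smul a x _ hx => rw [extMap_smul]; exact Submodule.smul_mem _ _ hx

/-- The semilinear map of exterior powers induced by a semilinear map. -/
noncomputable def extPowMap (p : ℕ) : ⋀[A]^p M →ₛₗ[σ] ⋀[B]^p N where
  toFun x := ⟨extMap T x, extMap_mem T p x x.2⟩
  map_add' x y := Subtype.ext (map_add (extMap T) x.1 y.1)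
  map_smul' a x := Subtype.ext (extMap_smul T a x.1)

end SemilinearMap

/-! ### The Koszul differential as an antiderivation, and its naturality. -/

section Differential

variable {A : Type*} [CommRing A] {M : Type*} [AddCommGroup M] [Module A M]

theorem koszulDiff_ι_mul (φ : Module.Dual A M) (m : M) (x : ExteriorAlgebra A M) :
    koszulDiff φ (ExteriorAlgebra.ι A m * x) =
      φ m • x - ExteriorAlgebra.ι A m * koszulDiff φ x :=
  CliffordAlgebra.contractLeft_ι_mul (Q := (0 : QuadraticForm A M)) (d := φ) m x

@[simp]
theorem koszulDiff_algebraMap (φ : Module.Dual A M) (a : A) :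
    koszulDiff φ (algebraMap A _ a) = 0 :=
  CliffordAlgebra.contractLeft_algebraMap (Q := (0 : QuadraticForm A M)) φ a

@[simp]
theorem koszulDiff_ι (φ : Module.Dual A M) (m : M) :
    koszulDiff φ (ExteriorAlgebra.ι A m) = algebraMap A _ (φ m) :=
  CliffordAlgebra.contractLeft_ι (Q := (0 : QuadraticForm A M)) φ m

@[simp]
theorem koszulDiff_koszulDiff (φ : Module.Dual A M) (x : ExteriorAlgebra A M) :
    koszulDiff φ (koszulDiff φ x) = 0 :=
  CliffordAlgebra.contractLeft_contractLeft (Q := (0 : QuadraticForm A M)) φ x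

theorem koszulDiff_comm (φ ψ : Module.Dual A M) (x : ExteriorAlgebra A M) :
    koszulDiff φ (koszulDiff ψ x) = -koszulDiff ψ (koszulDiff φ x) :=
  CliffordAlgebra.contractLeft_comm (Q := (0 : QuadraticForm A M)) φ ψ x

/-- Induction on the exterior algebra by multiplication with vectors from the left. -/
theorem ext_left_induction {P : ExteriorAlgebra A M → Prop}
    (algebraMap : ∀ r, P (algebraMap A _ r)) (add : ∀ x y, P x → P y → P (x + y))
    (ι_mul : ∀ x m, P x → P (ExteriorAlgebra.ι A m * x)) (x : ExteriorAlgebra A M) : P x :=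
  CliffordAlgebra.left_induction (Q := (0 : QuadraticForm A M)) algebraMap add ι_mul x

/-- Both sides obey the same twisted Leibniz rule for multiplication by a vector, so the identity is
forced by its degree-one case, which is the hypothesis `h`. -/
theorem extMap_koszulDiff {B : Type*} [CommRing B] {N : Type*} [AddCommGroup N] [Module B N]
    {σ : A →+* B} (T : M →ₛₗ[σ] N) {φ : Module.Dual A M} {ψ : Module.Dual B N}
    (h : ∀ m, ψ (T m) = σ (φ m)) (x : ExteriorAlgebra A M) :
    extMap T (koszulDiff φ x) = koszulDiff ψ (extMap T x) := by
  induction x using ext_left_induction with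
  | algebraMap r => simp
  | add x y hx hy => simp only [map_add, hx, hy]
  | ι_mul x m hx =>
    rw [koszulDiff_ι_mul, map_sub, extMap_smul, map_mul, map_mul, extMap_ι, koszulDiff_ι_mul, h, hx]

/-- The map induced by the projection `m ↦ m - φ(m) e` is `z ↦ z - e ∧ ι_φ z`. -/
theorem extMap_sub_smulRight (φ : Module.Dual A M) (e : M) (z : ExteriorAlgebra A M) :
    extMap (LinearMap.id - φ.smulRight e) z = z - ExteriorAlgebra.ι A e * koszulDiff φ z := by
  induction z using ext_left_induction with
  | algebraMap r => simp
  | add x y hx hy => simp only [map_add, hx, hy, mul_add]; abel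
  | ι_mul x m hx =>
    rw [map_mul, hx, extMap_ι, koszulDiff_ι_mul]
    have h1 : ExteriorAlgebra.ι A m * ExteriorAlgebra.ι A e =
        -(ExteriorAlgebra.ι A e * ExteriorAlgebra.ι A m) :=
      eq_neg_of_add_eq_zero_left (ExteriorAlgebra.ι_add_mul_swap m e)
    have h2 := ExteriorAlgebra.ι_sq_zero (R := A) e
    simp only [LinearMap.sub_apply, LinearMap.id_apply, LinearMap.smulRight_apply, map_sub,
      map_smul, sub_mul, mul_sub, smul_mul_assoc, mul_smul_comm, ← mul_assoc, h1, h2]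
    simp
    abel

theorem extMap_comp {N P : Type*} [AddCommGroup N] [Module A N] [AddCommGroup P] [Module A P]
    (f : M →ₗ[A] N) (g : N →ₗ[A] P) (z : ExteriorAlgebra A M) :
    extMap (g ∘ₗ f) z = extMap g (extMap f z) := by
  induction z using ext_left_induction with
  | algebraMap r => simp
  | add x y hx hy => simp only [map_add, hx, hy]
  | ι_mul x m hx => simp only [map_mul, hx, extMap_ι, LinearMap.comp_apply]

/-- Positive degree is essential: on scalars the zero map induces the identity. -/
theorem extMap_zero_of_mem {p : ℕ} {z : ExteriorAlgebra A M} (hz : z ∈ ⋀[A]^(p + 1) M) :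
    extMap (0 : M →ₗ[A] M) z = 0 := by
  rw [← exteriorPower.ιMulti_span_fixedDegree] at hz
  induction hz using Submodule.span_induction with
  | mem x h =>
    obtain ⟨v, rfl⟩ := h
    rw [extMap_ιMulti]
    exact AlternatingMap.map_coord_zero _ 0 rfl
  | zero => simp
  | add x y _ _ hx hy => rw [map_add, hx, hy, add_zero]
  | smul a x _ hx => rw [extMap_smul, hx, smul_zero]

theorem ι_mul_mem {p : ℕ} (m : M) {z : ExteriorAlgebra A M} (hz : z ∈ ⋀[A]^p M) :
    ExteriorAlgebra.ι A m * z ∈ ⋀[A]^(p + 1) M := by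
  rw [ExteriorAlgebra.exteriorPower, pow_succ']
  exact Submodule.mul_mem_mul ⟨m, rfl⟩ hz

theorem mem_exteriorPower_zero {z : ExteriorAlgebra A M} (hz : z ∈ ⋀[A]^0 M) :
    ∃ a, algebraMap A _ a = z := by
  rw [ExteriorAlgebra.exteriorPower, pow_zero] at hz
  exact Submodule.mem_one.mp hz

theorem mem_exteriorPower_one {z : ExteriorAlgebra A M} (hz : z ∈ ⋀[A]^1 M) :
    ∃ m, ExteriorAlgebra.ι A m = z := by
  rw [ExteriorAlgebra.exteriorPower, pow_one] at hz
  exact hz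

end Differential

/-! ### Exactness of Koszul complexes -/

section Exactness

variable {A : Type*} [CommRing A] {ι : Type*} [Fintype ι] [DecidableEq ι]

/-- If the `j`-th coordinate contraction kills `z`, then the projection that deletes the `j`-th
coordinate fixes `z`, by `extMap_sub_smulRight`. The composite of all these projections is the zero
map, which kills everything of positive degree. -/
theorem eq_zero_of_forall_koszulDiff_proj {p : ℕ} {z : ExteriorAlgebra A (ι → A)}
    (hz : z ∈ ⋀[A]^(p + 1) (ι → A))
    (h : ∀ i, koszulDiff (LinearMap.proj i : (ι → A) →ₗ[A] A) z = 0) : z = 0 := by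
  have key : ∀ S : Finset ι, ∃ f : (ι → A) →ₗ[A] (ι → A),
      (∀ m i, f m i = if i ∈ S then 0 else m i) ∧ extMap f z = z := by
    intro S
    induction S using Finset.induction_on with
    | empty =>
      refine ⟨LinearMap.id, by simp, ?_⟩
      -- With form and vector zero, the projection formula says that the identity induces the
      -- identity.
      have := extMap_sub_smulRight (A := A) (0 : Module.Dual A (ι → A)) 0 z
      simpa using this
    | insert j S hj ih =>
      obtain ⟨f, hf, hz⟩ := ih
      refine ⟨(LinearMap.id - (LinearMap.proj j).smulRight (Pi.single j 1)) ∘ₗ f, ?_, ?_⟩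
      · intro m i
        by_cases hij : i = j
        · subst hij; simp
        · have : (Pi.single j (1 : A) : ι → A) i = 0 := Pi.single_eq_of_ne hij 1
          change f m i - f m j * (Pi.single j (1 : A) : ι → A) i = _
          rw [this, mul_zero, sub_zero, hf]
          simp [hij]
      · rw [extMap_comp, hz, extMap_sub_smulRight, h, mul_zero, sub_zero]
  obtain ⟨f, hf, hfz⟩ := key Finset.univ
  have : f = 0 := by ext; simp [hf]
  rw [← hfz, this, extMap_zero_of_mem hz]

/-- A family of ring elements each of which is a non-zero-divisor modulo any set of others. -/
def IsIndependentlyRegular (y : ι → A) : Prop :=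
  ∀ (S : Finset ι) (i : ι), i ∉ S → ∀ a : A,
    y i * a ∈ Ideal.span (y '' S) → a ∈ Ideal.span (y '' S)

variable (y : ι → A)

/-- Vanishing of the coordinate contractions outside `S` describes the Koszul subcomplex on the
generators in `S`. This lemma and `mem_span_of_koszulDiff_eq` identify its degree-zero boundaries
with the ideal generated by the `y i`, `i ∈ S`. -/
theorem exists_koszulDiff_eq_algebraMap (S : Finset ι) {a : A} (ha : a ∈ Ideal.span (y '' S)) :
    ∃ w ∈ ⋀[A]^1 (ι → A),
      (∀ i ∉ S, koszulDiff (LinearMap.proj i : (ι → A) →ₗ[A] A) w = 0) ∧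
        koszulDiff (Fintype.linearCombination A y) w = algebraMap A _ a := by
  induction ha using Submodule.span_induction with
  | mem x h =>
    obtain ⟨s, hs, rfl⟩ := h
    refine ⟨ExteriorAlgebra.ι A (Pi.single s 1), ?_, fun i hi => ?_, ?_⟩
    · rw [ExteriorAlgebra.exteriorPower, pow_one]; exact ⟨_, rfl⟩
    · have : i ≠ s := fun h => hi (h ▸ hs)
      simp [this]
    · simp
  | zero => exact ⟨0, Submodule.zero_mem _, by simp, by simp⟩
  | add a b _ _ ha hb =>
    obtain ⟨w, hw, h1, h2⟩ := ha
    obtain ⟨w', hw', h1', h2'⟩ := hb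
    exact ⟨w + w', Submodule.add_mem _ hw hw', fun i hi =>
       by rw [map_add, h1 i hi, h1' i hi, add_zero],
      by rw [map_add, map_add, h2, h2']⟩
  | smul r a _ ha =>
    obtain ⟨w, hw, h1, h2⟩ := ha
    exact ⟨r • w, Submodule.smul_mem _ _ hw, fun i hi => by rw [map_smul, h1 i hi, smul_zero],
      by rw [map_smul, h2, smul_eq_mul, map_mul, Algebra.smul_def]⟩

theorem mem_span_of_koszulDiff_eq (S : Finset ι) {w : ExteriorAlgebra A (ι → A)}
    (hw : w ∈ ⋀[A]^1 (ι → A))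
    (h : ∀ i ∉ S, koszulDiff (LinearMap.proj i : (ι → A) →ₗ[A] A) w = 0) {a : A}
    (ha : koszulDiff (Fintype.linearCombination A y) w = algebraMap A _ a) :
    a ∈ Ideal.span (y '' S) := by
  obtain ⟨m, rfl⟩ := mem_exteriorPower_one hw
  rw [koszulDiff_ι, ExteriorAlgebra.algebraMap_inj] at ha
  rw [← ha, Fintype.linearCombination_apply]
  refine Submodule.sum_mem _ fun i _ => ?_
  by_cases hi : i ∈ S
  · exact Submodule.smul_mem _ _ (Ideal.subset_span ⟨i, hi, rfl⟩)
  · have := h i hi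
    rw [koszulDiff_ι, ExteriorAlgebra.algebraMap_eq_zero_iff] at this
    rw [show m i = 0 from this, zero_smul]
    exact Submodule.zero_mem _

variable {y}

/-- Induction on the set of generators, a hands-on form of the mapping cone argument. For a new
generator `e` with `d e = y k`, write `z = u + e ∧ v` with `u` and `v` free of `e`. Then `d z = 0`
says `d v = 0` and `d u = -(y k • v)`. If `v = d w` with `w` free of `e`, then `z + d (e ∧ w) = u +
y k • w` is a cycle free of `e`, hence some `d w'`, and `z = d (w' - e ∧ w)`. -/
theorem IsIndependentlyRegular.exists_koszulDiff_eq (hy : IsIndependentlyRegular y)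
    (S : Finset ι) : ∀ (p : ℕ) (z : ExteriorAlgebra A (ι → A)), z ∈ ⋀[A]^(p + 1) (ι → A) →
      (∀ i ∉ S, koszulDiff (LinearMap.proj i : (ι → A) →ₗ[A] A) z = 0) →
      koszulDiff (Fintype.linearCombination A y) z = 0 →
      ∃ w ∈ ⋀[A]^(p + 2) (ι → A),
        (∀ i ∉ S, koszulDiff (LinearMap.proj i : (ι → A) →ₗ[A] A) w = 0) ∧
          koszulDiff (Fintype.linearCombination A y) w = z := by
  induction S using Finset.induction_on with
  | empty =>
    intro p z hz h _
    refine ⟨0, Submodule.zero_mem _, by simp, ?_⟩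
    rw [map_zero, eq_zero_of_forall_koszulDiff_proj hz fun i => h i (Finset.notMem_empty i)]
  | insert k S hk ih =>
    intro p z hz h hd
    set e : ExteriorAlgebra A (ι → A) := ExteriorAlgebra.ι A (Pi.single k 1) with he
    set δ : ι → ExteriorAlgebra A (ι → A) →ₗ[A] ExteriorAlgebra A (ι → A) :=
      fun i => koszulDiff (LinearMap.proj i : (ι → A) →ₗ[A] A) with hδ
    set d := koszulDiff (Fintype.linearCombination A y) with hd'
    have hδe : ∀ i x, δ i (e * x) = (if i = k then x else 0) - e * δ i x := by
      intro i x
      rw [hδ, he, koszulDiff_ι_mul]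
      by_cases hik : i = k
      · subst hik; simp
      · simp [hik]
    have hde : ∀ x, d (e * x) = y k • x - e * d x := by
      intro x
      rw [hd', he, koszulDiff_ι_mul]
      simp
    have hδd : ∀ i x, δ i (d x) = -d (δ i x) := fun i x => koszulDiff_comm _ _ _
    -- Contraction in the direction `k` extracts the coefficient of `e`; the part of `z` free of `e`
    -- is `z - e * v`.
    set v := δ k z with hv
    have hvmem : v ∈ ⋀[A]^p (ι → A) := koszulDiff_mem _ _ _ hz
    have hvS : ∀ i ∉ S, δ i v = 0 := by
      intro i hi
      by_cases hik : i = k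
      · subst hik; exact koszulDiff_koszulDiff _ _
      · have h0 : δ i z = 0 := h i (by simp [hik, hi])
        have h1 : δ i (δ k z) = -δ k (δ i z) := koszulDiff_comm _ _ _
        rw [hv, h1, h0, map_zero, neg_zero]
    have hdv : d v = 0 := by
      have := hδd k z
      rw [hd, map_zero] at this
      exact neg_eq_zero.mp this.symm
    have hu : ∀ i ∉ S, δ i (z - e * v) = 0 := by
      intro i hi
      rw [map_sub, hδe, hvS i hi]
      by_cases hik : i = k
      · subst hik; simp [hv]
      · have h0 : δ i z = 0 := h i (by simp [hik, hi])
        simp [hik, h0]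
    have hdu : d (z - e * v) = -(y k • v) := by
      rw [map_sub, hd, hde, hdv]; simp
    obtain ⟨w, hw, hwS, hdw⟩ : ∃ w ∈ ⋀[A]^(p + 1) (ι → A), (∀ i ∉ S, δ i w = 0) ∧ d w = v := by
      -- In degree zero `v` is a scalar `a`, and exactness is not available. Instead `y k * a` is a
      -- boundary of the smaller complex, so regularity puts `a` in the ideal of `S`, which makes it
      -- a boundary as well.
      cases p with
      | zero =>
        obtain ⟨a, ha⟩ := mem_exteriorPower_zero hvmem
        rw [← ha]
        refine exists_koszulDiff_eq_algebraMap y S (hy S k hk a ?_)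
        rw [← neg_mem_iff]
        refine mem_span_of_koszulDiff_eq y S (Submodule.sub_mem _ hz (ι_mul_mem _ hvmem)) hu ?_
        rw [map_neg, map_mul, ha, ← Algebra.smul_def]
        exact hdu
      | succ p => exact ih p v hvmem hvS hdv
    have hewd : d (e * w) = y k • w - e * v := by rw [hde, hdw]
    obtain ⟨w', hw', hwS', hdw'⟩ := ih p (z + d (e * w))
      (Submodule.add_mem _ hz (koszulDiff_mem _ _ _ (ι_mul_mem _ hw)))
      (fun i hi => by
        have h1 := hu i hi
        have h2 : δ i w = 0 := hwS i hi
        rw [map_sub] at h1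
        change δ i _ = 0
        rw [map_add, hewd, map_sub, map_smul, h2, smul_zero, zero_sub, ← sub_eq_add_neg, h1])
      (by rw [map_add, hd, zero_add]; exact koszulDiff_koszulDiff _ _)
    refine ⟨w' - e * w, Submodule.sub_mem _ hw' (ι_mul_mem _ hw), fun i hi => ?_, ?_⟩
    · have hik : i ≠ k := fun h => hi (by simp [h])
      have hiS : i ∉ S := fun h => hi (by simp [h])
      have h2 : δ i w = 0 := hwS i hiS
      have h3 : δ i w' = 0 := hwS' i hiS
      change δ i _ = 0
      rw [map_sub, hδe, h3, h2]
      simp [hik]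
    · rw [map_sub, hdw', add_sub_cancel_right]

theorem koszulComplex_d {n : ℕ} (y : Fin n → A) (p : ℕ) :
    (koszulComplex y).d (p + 1) p =
      ModuleCat.ofHom (koszulD (Fintype.linearCombination A y) p) :=
  ChainComplex.of_d (fun p => ModuleCat.of A (⋀[A]^p (Fin n → A)))
    (fun p => ModuleCat.ofHom (koszulD (Fintype.linearCombination A y) p)) p

theorem IsIndependentlyRegular.exact {n : ℕ} {y : Fin n → A} (hy : IsIndependentlyRegular y)
    (p : ℕ) : Function.Exact (koszulD (Fintype.linearCombination A y) (p + 1))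
      (koszulD (Fintype.linearCombination A y) p) := by
  intro z
  constructor
  · intro hz
    -- For `S` the set of all indices the support conditions are vacuous.
    obtain ⟨w, hw, -, h⟩ := hy.exists_koszulDiff_eq Finset.univ p z.1 z.2 (by simp)
      (congrArg Subtype.val hz)
    exact ⟨⟨w, hw⟩, Subtype.ext h⟩
  · rintro ⟨w, rfl⟩
    exact LinearMap.congr_fun (koszulD_koszulD (Fintype.linearCombination A y) p) w

theorem koszulD_zero_range {n : ℕ} (y : Fin n → A) (z : ⋀[A]^0 (Fin n → A)) :
    z ∈ Set.range (koszulD (Fintype.linearCombination A y) 0) ↔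
      exteriorPower.zeroEquiv A _ z ∈ Ideal.span (Set.range y) := by
  have hz : algebraMap A _ (exteriorPower.zeroEquiv A _ z) = z.1 := by
    obtain ⟨a, ha⟩ := mem_exteriorPower_zero z.2
    have : z = a • exteriorPower.ιMulti A 0 (fun i => i.elim0) := by
      refine Subtype.ext ?_
      rw [← ha, Algebra.algebraMap_eq_smul_one]
      simp
    rw [this]
    simp [Algebra.algebraMap_eq_smul_one]
  constructor
  · rintro ⟨w, rfl⟩
    have := mem_span_of_koszulDiff_eq y Finset.univ w.2 (by simp) hz.symm
    simpa using this
  · intro h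
    obtain ⟨w, hw, -, h'⟩ := exists_koszulDiff_eq_algebraMap y Finset.univ
      (a := exteriorPower.zeroEquiv A _ z)
      (by simpa using h)
    exact ⟨⟨w, hw⟩, Subtype.ext (h'.trans hz)⟩

end Exactness


/-! ### Ideals of group rings and the Koszul resolution of a lattice -/

section GroupRing

variable {R : Type*} [CommRing R] {L : Type*} [AddCommGroup L]

/-- The elements of `L` which become trivial modulo an ideal of the group ring. -/
def kernelModIdeal (I : Ideal (AddMonoidAlgebra R L)) : AddSubgroup L where
  carrier := {l | AddMonoidAlgebra.single l (1 : R) - 1 ∈ I}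
  zero_mem' := by
    change AddMonoidAlgebra.single 0 1 - 1 ∈ I
    rw [← AddMonoidAlgebra.one_def, sub_self]
    exact I.zero_mem
  add_mem' {l m} hl hm := by
    have : AddMonoidAlgebra.single (l + m) (1 : R) - 1 =
        AddMonoidAlgebra.single l 1 * (AddMonoidAlgebra.single m 1 - 1) +
          (AddMonoidAlgebra.single l 1 - 1) := by
      rw [mul_sub, AddMonoidAlgebra.single_mul_single, mul_one, mul_one]
      abel
    change AddMonoidAlgebra.single (l + m) (1 : R) - 1 ∈ I
    rw [this]
    exact I.add_mem (I.mul_mem_left _ hm) hl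
  neg_mem' {l} hl := by
    have : AddMonoidAlgebra.single (-l) (1 : R) - 1 =
        -AddMonoidAlgebra.single (-l) 1 * (AddMonoidAlgebra.single l 1 - 1) := by
      rw [mul_sub, neg_mul, AddMonoidAlgebra.single_mul_single, neg_add_cancel, mul_one, mul_one,
        ← AddMonoidAlgebra.one_def]
      abel
    change AddMonoidAlgebra.single (-l) (1 : R) - 1 ∈ I
    rw [this]
    exact I.mul_mem_left _ hl

theorem mem_kernelModIdeal {I : Ideal (AddMonoidAlgebra R L)} {l : L} :
    l ∈ kernelModIdeal I ↔ AddMonoidAlgebra.single l (1 : R) - 1 ∈ I := Iff.rfl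

/-- On a monomial, `x^l - x^(f l) = x^(f l) (x^(l - f l) - 1)`: an endomorphism that moves elements
of `L` only by elements trivial modulo `I` acts as the identity modulo `I`. -/
theorem sub_mapDomain_mem {I : Ideal (AddMonoidAlgebra R L)} {f : L →+ L}
    (h : ∀ l, l - f l ∈ kernelModIdeal I) (a : AddMonoidAlgebra R L) :
    a - AddMonoidAlgebra.mapDomainRingHom R f a ∈ I := by
  induction a using AddMonoidAlgebra.induction_linear with
  | zero => simp
  | add a b ha hb =>
    rw [map_add, add_sub_add_comm]
    exact I.add_mem ha hb
  | single l r =>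
    have : AddMonoidAlgebra.single l r - AddMonoidAlgebra.single (f l) r =
        AddMonoidAlgebra.single (f l) r * (AddMonoidAlgebra.single (l - f l) 1 - 1) := by
      rw [mul_sub, AddMonoidAlgebra.single_mul_single, mul_one, mul_one, add_sub_cancel]
    rw [show AddMonoidAlgebra.mapDomainRingHom R f (AddMonoidAlgebra.single l r) =
      AddMonoidAlgebra.single (f l) r by simp, this]
    exact I.mul_mem_left _ (mem_kernelModIdeal.mp (h l))

/-- The coefficients of `a` are invariant under translation by `l`. Since `l` has infinite order,
one nonzero coefficient would give infinitely many. -/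
theorem eq_zero_of_single_sub_one_mul_eq_zero {l : L} (hl : ∀ k : ℕ, k • l = 0 → k = 0)
    {a : AddMonoidAlgebra R L} (ha : (AddMonoidAlgebra.single l (1 : R) - 1) * a = 0) : a = 0 := by
  have hshift : ∀ m, a.coeff (l + m) = a.coeff m := by
    intro m
    rw [sub_mul, one_mul, sub_eq_zero] at ha
    conv_lhs => rw [← ha]
    rw [AddMonoidAlgebra.coeff_single_mul_add, one_mul]
  by_contra hne
  obtain ⟨m, hm⟩ : ∃ m, a.coeff m ≠ 0 := by
    by_contra! h
    exact hne (AddMonoidAlgebra.ext (by ext m; simp [h m]))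
  have hk : ∀ k : ℕ, a.coeff (k • l + m) = a.coeff m := by
    intro k
    induction k with
    | zero => simp
    | succ k ih => rw [succ_nsmul', add_assoc, hshift, ih]
  have hinj : Function.Injective fun k : ℕ => k • l + m := by
    intro i j hij
    have hij' : i • l = j • l := add_right_cancel hij
    rcases le_total i j with h | h
    · obtain ⟨c, rfl⟩ := Nat.exists_eq_add_of_le h
      rw [add_nsmul, left_eq_add] at hij'
      rw [hl c hij', add_zero]
    · obtain ⟨c, rfl⟩ := Nat.exists_eq_add_of_le h
      rw [add_nsmul, add_eq_left] at hij'
      rw [hl c hij', add_zero]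
  refine Set.infinite_range_of_injective hinj (Set.Finite.subset a.coeff.support.finite_toSet ?_)
  rintro _ ⟨k, rfl⟩
  simpa [hk k] using hm

variable {ι : Type*} [DecidableEq ι] (b : Module.Basis ι ℤ L)

/-- The endomorphism of `L` that kills the basis vectors in `S` and fixes the others. -/
noncomputable def killBasis (S : Finset ι) : L →+ L :=
  (b.constr ℤ fun i => if i ∈ S then 0 else b i).toAddMonoidHom

theorem killBasis_basis (S : Finset ι) (i : ι) :
    killBasis b S (b i) = if i ∈ S then 0 else b i :=
  b.constr_basis ℤ _ i

variable (R) in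
theorem sub_killBasis_mem (S : Finset ι) (l : L) : l - killBasis b S l ∈
    kernelModIdeal (Ideal.span ((fun i => AddMonoidAlgebra.single (b i) (1 : R) - 1) '' S)) := by
  have h : (⊤ : Submodule ℤ L) ≤ ((kernelModIdeal (Ideal.span
      ((fun i => AddMonoidAlgebra.single (b i) (1 : R) - 1) '' S))).comap
        (AddMonoidHom.id L - killBasis b S)).toIntSubmodule := by
    rw [← b.span_eq, Submodule.span_le]
    rintro _ ⟨i, rfl⟩
    refine AddSubgroup.mem_comap.mpr ?_
    rw [AddMonoidHom.sub_apply, AddMonoidHom.id_apply, killBasis_basis]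
    split_ifs with hi
    · rw [sub_zero]
      exact Ideal.subset_span ⟨i, hi, rfl⟩
    · rw [sub_self]
      exact AddSubgroup.zero_mem _
  exact h (Submodule.mem_top (x := l))

/-- The endomorphism of the group ring that sets the `x_i` with `i ∈ S` to `1` kills the generators
of the ideal. Conversely every element is congruent modulo the ideal to its image. Membership thus
becomes a vanishing statement inside `R[L]` itself, with no quotient ring. -/
theorem mem_span_iff_mapDomain_killBasis (S : Finset ι) (a : AddMonoidAlgebra R L) :
    a ∈ Ideal.span ((fun i => AddMonoidAlgebra.single (b i) (1 : R) - 1) '' S) ↔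
      AddMonoidAlgebra.mapDomainRingHom R (killBasis b S) a = 0 := by
  constructor
  · intro h
    rw [← RingHom.mem_ker]
    refine Ideal.span_le.mpr ?_ h
    rintro _ ⟨i, hi, rfl⟩
    have hi' : i ∈ S := hi
    have h0 : killBasis b S (b i) = 0 := by rw [killBasis_basis, if_pos hi']
    rw [SetLike.mem_coe, RingHom.mem_ker, map_sub, map_one]
    simp [h0, AddMonoidAlgebra.one_def]
  · intro h
    have := sub_mapDomain_mem (sub_killBasis_mem R b S) a
    rwa [h, sub_zero] at this

variable (R) in
-- Killing the basis vectors in `S` fixes `b i`. So the question becomes whether `x_i - 1` is a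
-- non-zero-divisor in `R[L]`, which holds because `b i` has infinite order.
theorem isIndependentlyRegular_basis :
    IsIndependentlyRegular fun i => AddMonoidAlgebra.single (b i) (1 : R) - 1 := by
  intro S i hi a ha
  rw [mem_span_iff_mapDomain_killBasis] at ha ⊢
  have h0 : killBasis b S (b i) = b i := by rw [killBasis_basis, if_neg hi]
  rw [map_mul, map_sub, map_one] at ha
  refine eq_zero_of_single_sub_one_mul_eq_zero (l := b i) (fun k hk => ?_) (by simpa [h0] using ha)
  have := congrArg (fun l => b.repr l i) hk
  simpa using this

theorem aug_mapDomain (f : L →+ L) (a : AddMonoidAlgebra R L) :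
    aug R L (AddMonoidAlgebra.mapDomainRingHom R f a) = aug R L a := by
  induction a using AddMonoidAlgebra.induction_linear with
  | zero => simp
  | add a b ha hb => simp only [map_add, ha, hb]
  | single l r => simp [aug_single]

/-- When all basis vectors are killed, the induced endomorphism of `R[L]` is the augmentation
followed by the inclusion of the scalars. -/
theorem aug_eq_zero_iff [Fintype ι] (a : AddMonoidAlgebra R L) : aug R L a = 0 ↔
    a ∈ Ideal.span (Set.range fun i => AddMonoidAlgebra.single (b i) (1 : R) - 1) := by
  have hS : (Set.range fun i => AddMonoidAlgebra.single (b i) (1 : R) - 1) =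
      (fun i => AddMonoidAlgebra.single (b i) (1 : R) - 1) '' (Finset.univ : Finset ι) := by simp
  have hk : killBasis b Finset.univ = 0 := by
    exact AddMonoidHom.toIntLinearMap_injective (b.ext fun i => by simp [killBasis_basis])
  have hf : ∀ a : AddMonoidAlgebra R L, AddMonoidAlgebra.mapDomainRingHom R (0 : L →+ L) a =
      AddMonoidAlgebra.single 0 (aug R L a) := by
    intro a
    induction a using AddMonoidAlgebra.induction_linear with
    | zero => simp
    | add a b ha hb => simp only [map_add, ha, hb, AddMonoidAlgebra.single_add]
    | single l r => simp [aug_single]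
  rw [hS, mem_span_iff_mapDomain_killBasis, hk, hf, AddMonoidAlgebra.single_eq_zero]

end GroupRing

theorem isFreeResolution_latticeKoszul (R : Type*) [CommRing R] {L : Type*} [AddCommGroup L]
    {n : ℕ} (b : Module.Basis (Fin n) ℤ L) :
    IsFreeResolution (latticeKoszul R b) (latticeKoszulAug R b) where
  free p := Module.Free.of_basis
    ((Pi.basisFun (AddMonoidAlgebra R L) (Fin n)).exteriorPower p)
  exact p := by
    unfold latticeKoszul
    rw [koszulComplex_d, koszulComplex_d]
    exact (isIndependentlyRegular_basis R b).exact p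
  exact_zero := by
    unfold latticeKoszul
    rw [koszulComplex_d]
    intro z
    refine Iff.trans ?_ (koszulD_zero_range _ z).symm
    exact aug_eq_zero_iff b _
  surjective r := by
    refine ⟨(exteriorPower.zeroEquiv (AddMonoidAlgebra R L) (Fin n → AddMonoidAlgebra R L)).symm
      (AddMonoidAlgebra.single 0 r), ?_⟩
    change aug R L (exteriorPower.zeroEquiv _ _ ((exteriorPower.zeroEquiv _ _).symm _)) = r
    rw [LinearEquiv.apply_symm_apply, aug_single]


/-! ### Change of basis in Koszul complexes -/

section ChangeOfBasis

variable (R : Type*) [CommRing R] {L : Type*} [AddCommGroup L]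
  {ι κ μ : Type*} [Fintype ι] [Fintype κ] [Fintype μ]

/-- The linear form on `R[L]^ι` that defines the Koszul complex on the elements `v i - 1`. -/
noncomputable def koszulForm (v : ι → L) :
    (ι → AddMonoidAlgebra R L) →ₗ[AddMonoidAlgebra R L] AddMonoidAlgebra R L :=
  Fintype.linearCombination (AddMonoidAlgebra R L) fun i =>
    AddMonoidAlgebra.single (v i) (1 : R) - 1

theorem koszulForm_apply (v : ι → L) (m : ι → AddMonoidAlgebra R L) :
    koszulForm R v m = ∑ i, m i * (AddMonoidAlgebra.single (v i) (1 : R) - 1) := by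
  simp [koszulForm, Fintype.linearCombination_apply]

/-- The Koszul complexes of two families are isomorphic by a change of generators, and the second
family spans at least as much as the first. -/
def KoszulReduces (v : ι → L) (w : κ → L) : Prop :=
  (∃ θ : (ι → AddMonoidAlgebra R L) ≃ₗ[AddMonoidAlgebra R L] (κ → AddMonoidAlgebra R L),
    ∀ m, koszulForm R w (θ m) = koszulForm R v m) ∧
  Submodule.span ℤ (Set.range v) ≤ Submodule.span ℤ (Set.range w)

variable {R}

theorem KoszulReduces.refl (v : ι → L) : KoszulReduces R v v :=
  ⟨⟨LinearEquiv.refl _ _, fun _ => rfl⟩, le_rfl⟩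

theorem KoszulReduces.trans {u : ι → L} {v : κ → L} {w : μ → L} (h : KoszulReduces R u v)
    (h' : KoszulReduces R v w) : KoszulReduces R u w := by
  obtain ⟨⟨θ, hθ⟩, h1⟩ := h
  obtain ⟨⟨θ', hθ'⟩, h1'⟩ := h'
  exact ⟨⟨θ.trans θ', fun m => by rw [LinearEquiv.trans_apply, hθ', hθ]⟩, h1.trans h1'⟩

theorem koszulReduces_reindex (e : ι ≃ κ) (v : ι → L) : KoszulReduces R v (v ∘ e.symm) := by
  refine ⟨⟨LinearEquiv.funCongrLeft _ _ e.symm, fun m => ?_⟩, ?_⟩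
  · rw [koszulForm_apply, koszulForm_apply]
    exact e.symm.sum_comp fun i => m i * (AddMonoidAlgebra.single (v i) (1 : R) - 1)
  · rw [e.symm.surjective.range_comp]

variable [DecidableEq ι]

/-- Since `x⁻¹ - 1 = -x⁻¹ (x - 1)`, inverting `x_i` only rescales the `i`-th generator by a unit. -/
theorem koszulReduces_neg (v : ι → L) (i : ι) :
    KoszulReduces R v (Function.update v i (-v i)) := by
  have hu : ∀ l : L,
      (-AddMonoidAlgebra.single l (1 : R)) * (-AddMonoidAlgebra.single (-l) 1) = 1 := by
    intro l
    rw [neg_mul_neg, AddMonoidAlgebra.single_mul_single, add_neg_cancel, mul_one,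
      AddMonoidAlgebra.one_def]
  have hu' : ∀ l : L,
      (-AddMonoidAlgebra.single (-l) (1 : R)) * (-AddMonoidAlgebra.single l 1) = 1 :=
    fun l => by rw [mul_comm, hu]
  refine ⟨⟨LinearEquiv.piCongrRight fun j => if j = i then LinearEquiv.smulOfUnit
    ⟨-AddMonoidAlgebra.single (v i) (1 : R), -AddMonoidAlgebra.single (-v i) 1, hu _, hu' _⟩
      else LinearEquiv.refl _ _, fun m => ?_⟩, ?_⟩
  · rw [koszulForm_apply, koszulForm_apply]
    refine Finset.sum_congr rfl fun j _ => ?_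
    by_cases hj : j = i
    · subst hj
      simp only [LinearEquiv.piCongrRight_apply, if_true, Function.update_self]
      change (-AddMonoidAlgebra.single (v j) (1 : R) * m j) * _ = _
      have := hu (v j)
      rw [neg_mul_neg] at this
      linear_combination (-m j) * this
    · simp [hj]
  · rw [Submodule.span_le]
    rintro _ ⟨j, rfl⟩
    by_cases hj : j = i
    · subst hj
      rw [SetLike.mem_coe, ← neg_mem_iff]
      exact Submodule.subset_span ⟨j, by simp⟩
    · exact Submodule.subset_span ⟨j, by simp [hj]⟩

/-- Use `x_i x_u - 1 = (x_i - 1) + x_i (x_u - 1)`. As `u` is a combination of the other vectors,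
`x_u - 1` is the value of the form at some `q` with `q i = 0`. The change of generators is then the
transvection `m ↦ m - m i • x_i • q`. -/
theorem koszulReduces_add (v : ι → L) (i : ι) {u : L}
    (hu : u ∈ AddSubgroup.closure (v '' {i}ᶜ)) :
    KoszulReduces R v (Function.update v i (v i + u)) := by
  constructor
  -- The values of the form on vectors with vanishing `i`-th coordinate make up an ideal, so the
  -- elements `u` with `x_u - 1` among these values form a subgroup. It suffices that this subgroup
  -- contains the `v j` with `j ≠ i`.
  · have hmem : u ∈ kernelModIdeal ((LinearMap.ker
        (LinearMap.proj i : (ι → AddMonoidAlgebra R L) →ₗ[AddMonoidAlgebra R L] _)).map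
          (koszulForm R v)) := by
      refine (AddSubgroup.closure_le _).mpr ?_ hu
      rintro _ ⟨j, hj, rfl⟩
      have hj' : i ≠ j := fun h => hj h.symm
      refine ⟨Pi.single j 1, ?_, ?_⟩
      · rw [SetLike.mem_coe, LinearMap.mem_ker, LinearMap.proj_apply]
        exact Pi.single_eq_of_ne hj' 1
      · rw [koszulForm_apply, Finset.sum_eq_single j]
        · simp
        · intro k _ hk
          simp [hk]
        · simp
    obtain ⟨q, hq, hqu⟩ := hmem
    have hqi : q i = 0 := hq
    set x := AddMonoidAlgebra.single (v i) (1 : R)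
    let f : (ι → AddMonoidAlgebra R L) →ₗ[AddMonoidAlgebra R L] (ι → AddMonoidAlgebra R L) :=
      (LinearMap.proj i).smulRight (x • q)
    have hf : ∀ m, f m = m i • x • q := fun m => rfl
    -- Square zero because `q i = 0`; hence `id - f` and `id + f` are inverse to each other.
    have hff : ∀ m, f (f m) = 0 := by
      intro m
      rw [hf (f m), hf m]
      simp [hqi]
    let θ : (ι → AddMonoidAlgebra R L) ≃ₗ[AddMonoidAlgebra R L] (ι → AddMonoidAlgebra R L) :=
      LinearEquiv.ofLinearMap (LinearMap.id - f) (LinearMap.id + f)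
        (LinearMap.ext fun m => by simp [hff]) (LinearMap.ext fun m => by simp [hff])
    refine ⟨θ, fun m => ?_⟩
    have key : ∀ m, koszulForm R (Function.update v i (v i + u)) m =
        koszulForm R v (m + f m) := by
      intro m
      rw [map_add, hf, map_smul, map_smul, hqu, koszulForm_apply, koszulForm_apply,
        ← Finset.add_sum_erase _ _ (Finset.mem_univ i),
        ← Finset.add_sum_erase _ _ (Finset.mem_univ i)]
      have h1 : ∀ j ∈ Finset.univ.erase i,
          m j * (AddMonoidAlgebra.single (Function.update v i (v i + u) j) (1 : R) - 1) =
            m j * (AddMonoidAlgebra.single (v j) 1 - 1) := by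
        intro j hj
        rw [Function.update_of_ne (Finset.ne_of_mem_erase hj)]
      rw [Finset.sum_congr rfl h1, Function.update_self]
      have h2 : AddMonoidAlgebra.single (v i + u) (1 : R) = x * AddMonoidAlgebra.single u 1 := by
        rw [AddMonoidAlgebra.single_mul_single, mul_one]
      rw [h2, smul_eq_mul, smul_eq_mul]
      ring
    rw [key]
    congr 1
    change (m - f m) + f (m - f m) = m
    rw [map_sub, hff]
    abel
  · rw [Submodule.span_le]
    have hw : ∀ j ≠ i, v j ∈ Submodule.span ℤ (Set.range (Function.update v i (v i + u))) :=
      fun j hj => Submodule.subset_span ⟨j, by simp [hj]⟩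
    rintro _ ⟨j, rfl⟩
    by_cases hj : j = i
    · subst hj
      have hu' : u ∈
          (Submodule.span ℤ (Set.range (Function.update v j (v j + u)))).toAddSubgroup := by
        refine (AddSubgroup.closure_le _).mpr ?_ hu
        rintro _ ⟨k, hk, rfl⟩
        exact hw k hk
      have : v j + u ∈ Submodule.span ℤ (Set.range (Function.update v j (v j + u))) :=
        Submodule.subset_span ⟨j, by simp⟩
      simpa using Submodule.sub_mem _ this hu'
    · exact hw j hj

/-- This is the Euclidean algorithm on the coefficients of `b i` outside `S`, with the sum of their
absolute values as the measure `N`. If two of them are nonzero, subtract the smaller from the larger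
up to sign, and compensate by adding the vector of the larger to that of the smaller. Once a single
one is left it must be `1` or `-1`, and a sign change followed by a transvection along `S` produces
`b i`. -/
theorem exists_koszulReduces_insert (b : Module.Basis ι ℤ L) (S : Finset ι) (i : ι) (hi : i ∉ S)
    (N : ℕ) : ∀ (w : ι → L) (c : ι → ℤ), ∑ j ∈ Sᶜ, (c j).natAbs = N → (∀ s ∈ S, w s = b s) →
      ∑ j, c j • w j = b i → ∃ w' : ι → L, KoszulReduces R w w' ∧ ∀ s ∈ insert i S, w' s = b s := by
  induction N using Nat.strong_induction_on with
  | _ N ih =>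
  intro w c hN hw hc
  by_cases hcase : ∃ j ∉ S, ∃ k ∉ S, j ≠ k ∧ c k ≠ 0 ∧ (c k).natAbs ≤ (c j).natAbs
  · obtain ⟨j, hj, k, hk, hjk, hk0, hle⟩ := hcase
    -- `ε` is the sign of `c j * c k`.
    obtain ⟨ε, hε⟩ : ∃ ε : ℤ, (c j - ε * c k).natAbs < (c j).natAbs := by
      rcases le_or_gt 0 (c j * c k) with h | h
      · refine ⟨1, ?_⟩
        have hj0 : c j ≠ 0 := fun h0 => hk0 (by simpa [h0] using hle)
        have h' : 0 < c j * c k := lt_of_le_of_ne h (mul_ne_zero hj0 hk0).symm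
        rcases mul_pos_iff.mp h' with ⟨h1, h2⟩ | ⟨h1, h2⟩ <;> omega
      · refine ⟨-1, ?_⟩
        rcases mul_neg_iff.mp h with ⟨h1, h2⟩ | ⟨h1, h2⟩ <;> omega
    have hred : KoszulReduces R w (Function.update w k (w k + ε • w j)) :=
      koszulReduces_add w k
        (zsmul_mem (AddSubgroup.subset_closure (Set.mem_image_of_mem w hjk)) ε)
    have hlt : ∑ l ∈ Sᶜ, (Function.update c j (c j - ε * c k) l).natAbs < N := by
      rw [← hN]
      refine Finset.sum_lt_sum (fun l _ => ?_) ⟨j, by simpa using hj, by simpa using hε⟩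
      by_cases hl : l = j
      · subst hl; simpa using hε.le
      · simp [hl]
    have hagr : ∀ s ∈ S, Function.update w k (w k + ε • w j) s = b s := by
      intro s hs
      have : s ≠ k := fun h => hk (h ▸ hs)
      rw [Function.update_of_ne this, hw s hs]
    -- The combination is unchanged: `(c j - ε c k) w j + c k (w k + ε w j) = c j w j + c k w k`.
    have hsum : ∑ l, Function.update c j (c j - ε * c k) l •
        Function.update w k (w k + ε • w j) l = b i := by
      rw [← hc]
      have h1 : Function.update w k (w k + ε • w j) = w + Pi.single k (ε • w j) := by
        ext l
        by_cases hl : l = k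
        · subst hl; simp
        · simp [hl]
      have h2 : Function.update c j (c j - ε * c k) = c - Pi.single j (ε * c k) := by
        ext l
        by_cases hl : l = j
        · subst hl; simp
        · simp [hl]
      have h3 : ∑ l, c l • (Pi.single k (ε • w j) : ι → L) l = (ε * c k) • w j := by
        rw [Finset.sum_eq_single k]
        · rw [Pi.single_eq_same, smul_smul, mul_comm]
        · intro l _ hl
          rw [Pi.single_eq_of_ne hl, smul_zero]
        · simp
      have h4 : ∑ l, (Pi.single j (ε * c k) : ι → ℤ) l • (w l + (Pi.single k (ε • w j) : ι → L) l) =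
          (ε * c k) • w j := by
        rw [Finset.sum_eq_single j]
        · rw [Pi.single_eq_same, Pi.single_eq_of_ne hjk, add_zero]
        · intro l _ hl
          rw [Pi.single_eq_of_ne hl, zero_smul]
        · simp
      simp only [h1, h2, Pi.add_apply, Pi.sub_apply, sub_smul, Finset.sum_sub_distrib, h4]
      simp only [smul_add, Finset.sum_add_distrib, h3, add_sub_cancel_right]
    obtain ⟨w', hw', hagree⟩ := ih _ hlt _ _ rfl hagr hsum
    exact ⟨w', hred.trans hw', hagree⟩
  · push Not at hcase
    have hrepr : ∑ j, c j * (b.repr (w j)) i = 1 := by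
      have := congrArg (fun l => b.repr l i) hc
      simpa using this
    have hS0 : ∀ s ∈ S, (b.repr (w s)) i = 0 := by
      intro s hs
      have : s ≠ i := fun h => hi (h ▸ hs)
      rw [hw s hs]
      simp [this]
    obtain ⟨j, hj, hj0⟩ : ∃ j ∉ S, c j ≠ 0 := by
      by_contra! h
      rw [Finset.sum_eq_zero] at hrepr
      · exact zero_ne_one hrepr
      · intro j _
        by_cases hj : j ∈ S
        · rw [hS0 j hj, mul_zero]
        · rw [h j hj, zero_mul]
    have hother : ∀ k ∉ S, k ≠ j → c k = 0 := by
      intro k hk hkj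
      by_contra hk0
      have h1 := hcase j hj k hk hkj.symm hk0
      have h2 := hcase k hk j hj hkj hj0
      omega
    -- Compare `i`-th coordinates in the basis `b`: the vectors in `S` contribute nothing, so `c j`
    -- times an integer equals `1`.
    have hunit : c j = 1 ∨ c j = -1 := by
      rw [Finset.sum_eq_single j] at hrepr
      · exact Int.isUnit_iff.mp (IsUnit.of_mul_eq_one _ hrepr)
      · intro k _ hkj
        by_cases hk : k ∈ S
        · rw [hS0 k hk, mul_zero]
        · rw [hother k hk hkj, zero_mul]
      · simp
    have hbi : c j • w j + ∑ s ∈ S, c s • b s = b i := by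
      rw [← hc, ← Finset.add_sum_erase _ _ (Finset.mem_univ j)]
      congr 1
      rw [Finset.sum_congr rfl fun s hs => by rw [← hw s hs]]
      refine Finset.sum_subset (fun s hs => Finset.mem_erase.mpr ⟨fun h => hj (h ▸ hs),
        Finset.mem_univ s⟩) fun k hk hkS => ?_
      rw [hother k hkS (Finset.ne_of_mem_erase hk), zero_smul]
    have h1 : KoszulReduces R w (Function.update w j (c j • w j)) := by
      rcases hunit with h | h
      · rw [h, one_smul, Function.update_eq_self]
        exact KoszulReduces.refl w
      · rw [h, neg_one_smul]
        exact koszulReduces_neg w j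
    have h2 := koszulReduces_add (R := R) (Function.update w j (c j • w j)) j
      (u := ∑ s ∈ S, c s • b s) (by
        refine sum_mem fun s hs => zsmul_mem (AddSubgroup.subset_closure ?_) _
        have hsj : s ≠ j := fun h => hj (h ▸ hs)
        exact ⟨s, hsj, by rw [Function.update_of_ne hsj, hw s hs]⟩)
    rw [Function.update_self, Function.update_idem, hbi] at h2
    -- The vector `b i` now sits at position `j`. Swapping `i` and `j`, both outside `S`, moves it
    -- into place without touching the vectors already matched.
    refine ⟨_, (h1.trans h2).trans (koszulReduces_reindex (Equiv.swap i j) _), fun s hs => ?_⟩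
    rw [Function.comp_apply, Equiv.symm_swap]
    rcases Finset.mem_insert.mp hs with rfl | hs
    · rw [Equiv.swap_apply_left, Function.update_self]
    · have hsi : s ≠ i := fun h => hi (h ▸ hs)
      have hsj : s ≠ j := fun h => hj (h ▸ hs)
      rw [Equiv.swap_apply_of_ne_of_ne hsi hsj, Function.update_of_ne hsj, hw s hs]

/-- The vectors are matched with `b` one at a time. The span clause of `KoszulReduces` guarantees
that every intermediate family still spans, so that the next basis vector has integer coefficients
in it. -/
theorem koszulReduces_basis (b : Module.Basis ι ℤ L) (v : ι → L)
    (hv : Submodule.span ℤ (Set.range v) = ⊤) : KoszulReduces R v b := by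
  have key : ∀ S : Finset ι, ∃ w : ι → L, KoszulReduces R v w ∧ ∀ s ∈ S, w s = b s := by
    intro S
    induction S using Finset.induction_on with
    | empty => exact ⟨v, KoszulReduces.refl v, by simp⟩
    | insert i S hi ih =>
      obtain ⟨w, hw, hagree⟩ := ih
      have hmem : b i ∈ Submodule.span ℤ (Set.range w) := hw.2 (hv ▸ Submodule.mem_top)
      obtain ⟨c, hc⟩ := (Submodule.mem_span_range_iff_exists_fun ℤ).mp hmem
      obtain ⟨w', hw', h⟩ := exists_koszulReduces_insert (R := R) b S i hi _ w c rfl hagree hc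
      exact ⟨w', hw.trans hw', h⟩
  obtain ⟨w, hw, h⟩ := key Finset.univ
  rwa [show w = b from funext fun i => h i (Finset.mem_univ i)] at hw

end ChangeOfBasis


/-! ### Actions of `ℤ/4` on Koszul complexes -/

section PeriodicLift

variable {A : Type*} [CommRing A] {M N : Type*} [AddCommGroup M] [Module A M] [AddCommGroup N]
  [Module A N]

/-- A ring endomorphism `σ` lifts along the linear form `φ` to a semilinear map of period four. -/
def HasPeriodicLift (σ : A →+* A) (φ : Module.Dual A M) : Prop :=
  ∃ T : M →ₛₗ[σ] M, (∀ m, φ (T m) = σ (φ m)) ∧ ∀ m, T (T (T (T m))) = m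

theorem HasPeriodicLift.congr {σ : A →+* A} {φ : Module.Dual A M} {ψ : Module.Dual A N}
    (h : HasPeriodicLift σ φ) (θ : M ≃ₗ[A] N) (hθ : ∀ m, ψ (θ m) = φ m) : HasPeriodicLift σ ψ := by
  obtain ⟨T, hT, h4⟩ := h
  refine ⟨{ toFun := fun n => θ (T (θ.symm n))
            map_add' := fun x y => by simp
            map_smul' := fun a x => by
              rw [map_smul, map_smulₛₗ, map_smul] }, fun m => ?_, fun m => ?_⟩
  · change ψ (θ (T (θ.symm m))) = _
    rw [hθ, hT, ← hθ, LinearEquiv.apply_symm_apply]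
  · change θ (T (θ.symm (θ (T (θ.symm (θ (T (θ.symm (θ (T (θ.symm m))))))))))) = m
    simp [h4]

theorem HasPeriodicLift.pi {ι : Type*} [Fintype ι] {M : ι → Type*} [∀ i, AddCommGroup (M i)]
    [∀ i, Module A (M i)] {σ : A →+* A} {φ : ∀ i, Module.Dual A (M i)}
    (h : ∀ i, HasPeriodicLift σ (φ i)) {ψ : Module.Dual A (∀ i, M i)}
    (hψ : ∀ m, ψ m = ∑ i, φ i (m i)) : HasPeriodicLift σ ψ := by
  choose T hT h4 using h
  refine ⟨{ toFun := fun m i => T i (m i)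
            map_add' := fun x y => by ext i; simp
            map_smul' := fun a x => by ext i; simp }, fun m => ?_, fun m => ?_⟩
  · simp only [hψ, map_sum, LinearMap.coe_mk, AddHom.coe_mk, hT]
  · ext i
    exact h4 i (m i)

/-- The semilinear map with prescribed values on the standard basis. -/
def semilinearOfImages {ι : Type*} [Fintype ι] (σ : A →+* A) (t : ι → M) : (ι → A) →ₛₗ[σ] M where
  toFun m := ∑ j, σ (m j) • t j
  map_add' x y := by simp [add_smul, Finset.sum_add_distrib]
  map_smul' a x := by simp [mul_smul, Finset.smul_sum]

theorem semilinearOfImages_single {ι : Type*} [Fintype ι] [DecidableEq ι] (σ : A →+* A) (t : ι → M)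
    (i : ι) (a : A) : semilinearOfImages σ t (Pi.single i a) = σ a • t i := by
  change ∑ j, σ ((Pi.single i a : ι → A) j) • t j = _
  rw [Finset.sum_eq_single i]
  · simp
  · intro j _ hj
    simp [hj]
  · simp

/-- Because `σ` has period four, the fourth iterate of a `σ`-semilinear map is linear, so
periodicity too need only be tested on the standard basis. There one application already yields `t
j`, so `h4` has only three more. -/
theorem hasPeriodicLift_of_images {ι : Type*} [Fintype ι] [DecidableEq ι] {σ : A →+* A}
    (hσ : ∀ a, σ (σ (σ (σ a))) = a) {φ : Module.Dual A (ι → A)} (t : ι → ι → A)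
    (h1 : ∀ j, φ (t j) = σ (φ (Pi.single j 1)))
    (h4 : ∀ j, semilinearOfImages σ t (semilinearOfImages σ t (semilinearOfImages σ t (t j))) =
      Pi.single j 1) : HasPeriodicLift σ φ := by
  have hm : ∀ m : ι → A, m = ∑ j, m j • (Pi.single j 1 : ι → A) := fun m => by
    conv_lhs => rw [← Finset.univ_sum_single m]
    refine Finset.sum_congr rfl fun j _ => ?_
    ext i
    by_cases h : i = j
    · subst h; simp
    · simp [h]
  refine ⟨semilinearOfImages σ t, fun m => ?_, fun m => ?_⟩
  · conv_rhs => rw [hm m]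
    simp [semilinearOfImages, h1]
  · conv_lhs => rw [hm m]
    simp only [map_sum, map_smulₛₗ, hσ, semilinearOfImages_single, map_one, one_smul, h4]
    exact (hm m).symm

end PeriodicLift

/-! ### Explicit periodic lifts for the six representations. -/

section Rho

variable {R : Type*} [CommRing R] {L : Type*} [AddCommGroup L]

theorem groupRingAct_mul {G : Type*} [Group G] (ρ : Representation ℤ G L) (g h : G)
    (x : AddMonoidAlgebra R L) :
    groupRingAct R ρ g (groupRingAct R ρ h x) = groupRingAct R ρ (g * h) x := by
  induction x using AddMonoidAlgebra.induction_linear with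
  | zero => simp
  | add x y hx hy => simp only [map_add, hx, hy]
  | single l r => simp [groupRingAct_single]

theorem groupRingAct_one {G : Type*} [Group G] (ρ : Representation ℤ G L)
    (x : AddMonoidAlgebra R L) : groupRingAct R ρ 1 x = x := by
  induction x using AddMonoidAlgebra.induction_linear with
  | zero => simp
  | add x y hx hy => simp only [map_add, hx, hy]
  | single l r => simp [groupRingAct_single]

/-- The generator of the cyclic group of order four. -/
abbrev c4Gen : C4 := Multiplicative.ofAdd (1 : ZMod 4)

theorem groupRingAct_c4Gen_iterate (ρ : Representation ℤ C4 L) (x : AddMonoidAlgebra R L) :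
    groupRingAct R ρ c4Gen (groupRingAct R ρ c4Gen (groupRingAct R ρ c4Gen
      (groupRingAct R ρ c4Gen x))) = x := by
  rw [groupRingAct_mul, groupRingAct_mul, groupRingAct_mul,
    show c4Gen * c4Gen * c4Gen * c4Gen = 1 from by decide, groupRingAct_one]

theorem koszulForm_single {ι : Type*} [Fintype ι] [DecidableEq ι] (v : ι → L) (i : ι)
    (a : AddMonoidAlgebra R L) :
    koszulForm R v (Pi.single i a) = a * (AddMonoidAlgebra.single (v i) 1 - 1) := by
  simp [koszulForm]

theorem single_mul_neg (l : L) :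
    AddMonoidAlgebra.single l (1 : R) * AddMonoidAlgebra.single (-l) 1 = 1 := by
  rw [AddMonoidAlgebra.single_mul_single, add_neg_cancel, mul_one, AddMonoidAlgebra.one_def]

theorem smul_pi_single {A ι : Type*} [CommRing A] [DecidableEq ι] (i : ι) (a c : A) :
    c • (Pi.single i a : ι → A) = Pi.single i (c * a) := by
  ext j
  by_cases h : j = i
  · subst h; simp
  · simp [h]

variable (R)

theorem hasPeriodicLift_perm {ι : Type*} [Fintype ι] [DecidableEq ι] (ρ : Representation ℤ C4 L)
    (v : ι → L) (π : ι → ι) (hv : ∀ i, ρ c4Gen (v i) = v (π i)) (hπ : ∀ i, π (π (π (π i))) = i) :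
    HasPeriodicLift (groupRingAct R ρ c4Gen) (koszulForm R v) := by
  refine hasPeriodicLift_of_images (groupRingAct_c4Gen_iterate ρ) (fun j => Pi.single (π j) 1)
    (fun j => ?_) fun j => ?_
  · rw [koszulForm_single, koszulForm_single, one_mul, one_mul, map_sub, map_one,
      groupRingAct_single, hv]
  · simp only [semilinearOfImages_single, map_one, one_smul, hπ]

/-- The generator is sent to `-x⁻¹` times itself, since `x⁻¹ - 1 = -x⁻¹ (x - 1)`. Applying this
twice gives the coefficient `(-x)(-x⁻¹) = 1`. -/
theorem hasPeriodicLift_sign (ρ : Representation ℤ C4 L) (v : Fin 1 → L)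
    (hv : ρ c4Gen (v 0) = -v 0) :
    HasPeriodicLift (groupRingAct R ρ c4Gen) (koszulForm R v) := by
  have h0 := single_mul_neg (R := R) (v 0)
  refine hasPeriodicLift_of_images (groupRingAct_c4Gen_iterate ρ)
    (fun _ => Pi.single 0 (-AddMonoidAlgebra.single (-v 0) 1)) (fun j => ?_) fun j => ?_
  · obtain rfl := Subsingleton.elim j 0
    rw [koszulForm_single, koszulForm_single, one_mul, map_sub, map_one, groupRingAct_single, hv]
    linear_combination -h0
  · obtain rfl := Subsingleton.elim j 0
    simp only [semilinearOfImages_single, map_neg, groupRingAct_single, hv, smul_pi_single, map_mul,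
      neg_neg]
    congr 1
    linear_combination (AddMonoidAlgebra.single (v 0) 1 *
      AddMonoidAlgebra.single (-v 0) (1 : R) + 1) * h0

/-- Take `a₀ ↦ -x₁⁻¹ a₁` and `a₁ ↦ a₀`. The square multiplies `a₁` by `-x₁⁻¹`; as `σ²` inverts `x₁`,
the fourth power multiplies it by `(-x₁)(-x₁⁻¹) = 1`, and similarly for `a₀`. -/
theorem hasPeriodicLift_rotation (ρ : Representation ℤ C4 L) (v : Fin 2 → L)
    (hv0 : ρ c4Gen (v 0) = -v 1) (hv1 : ρ c4Gen (v 1) = v 0) :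
    HasPeriodicLift (groupRingAct R ρ c4Gen) (koszulForm R v) := by
  have h0 := single_mul_neg (R := R) (v 0)
  have h1 := single_mul_neg (R := R) (v 1)
  refine hasPeriodicLift_of_images (groupRingAct_c4Gen_iterate ρ)
    ![Pi.single 1 (-AddMonoidAlgebra.single (-v 1) 1), Pi.single 0 1] (fun j => ?_) fun j => ?_
  · fin_cases j
    · change koszulForm R v (Pi.single 1 _) =
        groupRingAct R ρ c4Gen (koszulForm R v (Pi.single 0 1))
      rw [koszulForm_single, koszulForm_single, one_mul, map_sub, map_one, groupRingAct_single, hv0]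
      linear_combination -h1
    · change koszulForm R v (Pi.single 0 _) =
        groupRingAct R ρ c4Gen (koszulForm R v (Pi.single 1 1))
      rw [koszulForm_single, koszulForm_single, one_mul, one_mul, map_sub, map_one,
        groupRingAct_single, hv1]
  · fin_cases j <;>
    simp only [semilinearOfImages_single, map_neg, groupRingAct_single, hv0, hv1, smul_pi_single,
      map_mul, neg_neg, map_one, mul_one, Matrix.cons_val_zero, Matrix.cons_val_one, Fin.zero_eta,
      Fin.mk_one, Fin.isValue] <;> congr 1
    · linear_combination h0
    · linear_combination h1

/-- With `x₃ = (x₀ x₁ x₂)⁻¹`, the map `σ` permutes `x₀, x₁, x₂, x₃` cyclically and their product is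
`1`. The vector `c` plays the part of a fourth generator lying over `x₃ - 1`, and the lift runs
through the cycle `a₀ ↦ a₁ ↦ a₂ ↦ c ↦ a₀`. -/
theorem hasPeriodicLift_quotient (ρ : Representation ℤ C4 L) (v : Fin 3 → L)
    (hv0 : ρ c4Gen (v 0) = v 1) (hv1 : ρ c4Gen (v 1) = v 2)
    (hv2 : ρ c4Gen (v 2) = -v 0 - v 1 - v 2) :
    HasPeriodicLift (groupRingAct R ρ c4Gen) (koszulForm R v) := by
  set σ := groupRingAct R ρ c4Gen with hσ
  set x0 := AddMonoidAlgebra.single (v 0) (1 : R) with hx0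
  set x1 := AddMonoidAlgebra.single (v 1) (1 : R) with hx1
  set x2 := AddMonoidAlgebra.single (v 2) (1 : R) with hx2
  set x3 := AddMonoidAlgebra.single (-v 0 - v 1 - v 2) (1 : R) with hx3
  have hs0 : σ x0 = x1 := by rw [hσ, hx0, groupRingAct_single, hv0]
  have hs1 : σ x1 = x2 := by rw [hσ, hx1, groupRingAct_single, hv1]
  have hs2 : σ x2 = x3 := by rw [hσ, hx2, groupRingAct_single, hv2]
  have hs3 : σ x3 = x0 := by
    rw [hσ, hx3, groupRingAct_single, map_sub, map_sub, map_neg, hv0, hv1, hv2, hx0]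
    congr 1
    abel
  have hrel : x0 * x1 * x2 * x3 = 1 := by
    simp only [hx0, hx1, hx2, hx3, AddMonoidAlgebra.single_mul_single, mul_one]
    rw [AddMonoidAlgebra.one_def]
    congr 1
    abel
  -- Chosen so that the form telescopes on it: `-x₃(x₀ - 1) - x₃x₀(x₁ - 1) - x₃x₀x₁(x₂ - 1) = x₃ -
  -- x₀x₁x₂x₃ = x₃ - 1`.
  set c : Fin 3 → AddMonoidAlgebra R L := Pi.single 0 (-x3) + Pi.single 1 (-(x3 * x0)) +
    Pi.single 2 (-(x3 * x0 * x1)) with hc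
  set t : Fin 3 → Fin 3 → AddMonoidAlgebra R L := ![Pi.single 1 1, Pi.single 2 1, c] with ht
  have ht0 : t 0 = Pi.single 1 1 := rfl
  have ht1 : t 1 = Pi.single 2 1 := rfl
  have ht2 : t 2 = c := rfl
  -- The last term of `c` maps to `-x₀x₁x₂ • c = a₀ + x₀ a₁ + x₀x₁ a₂`, and the images of the other
  -- two cancel all but `a₀`.
  have hTc : semilinearOfImages σ t c = Pi.single 0 1 := by
    rw [hc]
    simp only [map_add, semilinearOfImages_single, map_neg, map_mul, hs0, hs1, hs3, ht0, ht1, ht2]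
    rw [hc]
    ext i : 1
    fin_cases i <;> simp
    · linear_combination hrel
    · linear_combination x0 * hrel
    · linear_combination (x0 * x1) * hrel
  have hT0 : semilinearOfImages σ t (Pi.single 0 1) = Pi.single 1 1 := by
    rw [semilinearOfImages_single, map_one, one_smul, ht0]
  have hT1 : semilinearOfImages σ t (Pi.single 1 1) = Pi.single 2 1 := by
    rw [semilinearOfImages_single, map_one, one_smul, ht1]
  have hT2 : semilinearOfImages σ t (Pi.single 2 1) = c := by
    rw [semilinearOfImages_single, map_one, one_smul, ht2]
  refine hasPeriodicLift_of_images (groupRingAct_c4Gen_iterate ρ) t (fun j => ?_) fun j => ?_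
  · fin_cases j
    · change koszulForm R v (Pi.single 1 1) = σ (koszulForm R v (Pi.single 0 1))
      rw [koszulForm_single, koszulForm_single, one_mul, one_mul, map_sub, map_one, hs0]
    · change koszulForm R v (Pi.single 2 1) = σ (koszulForm R v (Pi.single 1 1))
      rw [koszulForm_single, koszulForm_single, one_mul, one_mul, map_sub, map_one, hs1]
    · change koszulForm R v c = σ (koszulForm R v (Pi.single 2 1))
      rw [hc, map_add, map_add, koszulForm_single, koszulForm_single, koszulForm_single,
        koszulForm_single, one_mul, map_sub, map_one, hs2]
      linear_combination -hrel
  · fin_cases j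
    · change semilinearOfImages σ t (semilinearOfImages σ t (semilinearOfImages σ t (t 0))) =
        Pi.single 0 1
      rw [ht0, hT1, hT2, hTc]
    · change semilinearOfImages σ t (semilinearOfImages σ t (semilinearOfImages σ t (t 1))) =
        Pi.single 1 1
      rw [ht1, hT2, hTc, hT0]
    · change semilinearOfImages σ t (semilinearOfImages σ t (semilinearOfImages σ t (t 2))) =
        Pi.single 2 1
      rw [ht2, hTc, hT0, hT1]

theorem hasPeriodicLift_rho (ρ : Representation ℤ C4 L) (r : RhoIndex) (v : Fin r.rank → L)
    (hv : ∀ j, ρ c4Gen (v j) = ∑ i, r.matrix i j • v i) :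
    HasPeriodicLift (groupRingAct R ρ c4Gen) (koszulForm R v) := by
  cases r
  · refine hasPeriodicLift_perm R ρ v id (fun i => ?_) fun _ => rfl
    refine (hv i).trans ?_
    obtain rfl : i = (0 : Fin 1) := Subsingleton.elim (α := Fin 1) _ _
    change ∑ k : Fin 1, (!![1] : Matrix (Fin 1) (Fin 1) ℤ) k 0 • v k = v (0 : Fin 1)
    rw [Fin.sum_univ_one]
    exact one_smul ℤ _
  · refine hasPeriodicLift_sign R ρ v ((hv (0 : Fin 1)).trans ?_)
    change ∑ k : Fin 1, (!![-1] : Matrix (Fin 1) (Fin 1) ℤ) k 0 • v k = -v (0 : Fin 1)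
    simp
  · refine hasPeriodicLift_perm R ρ v (![1, 0] : Fin 2 → Fin 2) (fun i => (hv i).trans ?_)
      (by decide : ∀ i : Fin 2, (![1, 0] : Fin 2 → Fin 2)
        ((![1, 0] : Fin 2 → Fin 2) ((![1, 0] : Fin 2 → Fin 2) ((![1, 0] : Fin 2 → Fin 2) i))) = i)
    change ∑ k : Fin 2, (!![0, 1; 1, 0] : Matrix (Fin 2) (Fin 2) ℤ) k i • v k = _
    change Fin 2 at i
    fin_cases i <;> simp [Fin.sum_univ_succ]
  · refine hasPeriodicLift_rotation R ρ v ((hv (0 : Fin 2)).trans ?_) ((hv (1 : Fin 2)).trans ?_)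
    · change ∑ k : Fin 2, (!![0, 1; -1, 0] : Matrix (Fin 2) (Fin 2) ℤ) k 0 • v k = -v (1 : Fin 2)
      simp [Fin.sum_univ_succ]
    · change ∑ k : Fin 2, (!![0, 1; -1, 0] : Matrix (Fin 2) (Fin 2) ℤ) k 1 • v k = v (0 : Fin 2)
      simp [Fin.sum_univ_succ]
  · have hM : ∀ j : Fin 3, ρ c4Gen (v j) = ∑ k : Fin 3,
        (!![0, 0, -1; 1, 0, -1; 0, 1, -1] : Matrix (Fin 3) (Fin 3) ℤ) k j • v k := hv
    refine hasPeriodicLift_quotient R ρ v ((hM 0).trans ?_) ((hM 1).trans ?_) ((hM 2).trans ?_) <;>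
      (simp [Fin.sum_univ_succ]; try abel)
  -- Images of basis vectors are columns of the matrix, so the permutation is `j ↦ j - 1` modulo
  -- four.
  · refine hasPeriodicLift_perm R ρ v (![3, 0, 1, 2] : Fin 4 → Fin 4) (fun i => (hv i).trans ?_)
      (by decide : ∀ i : Fin 4, (![3, 0, 1, 2] : Fin 4 → Fin 4)
        ((![3, 0, 1, 2] : Fin 4 → Fin 4) ((![3, 0, 1, 2] : Fin 4 → Fin 4)
          ((![3, 0, 1, 2] : Fin 4 → Fin 4) i))) = i)
    change ∑ k : Fin 4, (!![0, 1, 0, 0; 0, 0, 1, 0; 0, 0, 0, 1; 1, 0, 0, 0] :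
      Matrix (Fin 4) (Fin 4) ℤ) k i • v k = _
    change Fin 4 at i
    fin_cases i <;> simp [Fin.sum_univ_succ]

end Rho


/-! ### Periodic lifts for direct sums, in an arbitrary basis. -/

section SumOfRho

variable (R : Type*) [CommRing R] {L : Type*} [AddCommGroup L]

theorem hasPeriodicLift_sigma {m : ℕ} {ι : Fin m → Type*} [∀ s, Fintype (ι s)] {σ :
    AddMonoidAlgebra R L →+* AddMonoidAlgebra R L} (v : (Σ s, ι s) → L)
    (h : ∀ s, HasPeriodicLift σ (koszulForm R fun i => v ⟨s, i⟩)) :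
    HasPeriodicLift σ (koszulForm R v) := by
  have h' := HasPeriodicLift.pi h
    (ψ := ∑ s, koszulForm R (fun i => v ⟨s, i⟩) ∘ₗ LinearMap.proj s) (by simp)
  refine h'.congr (LinearEquiv.piCurry (AddMonoidAlgebra R L)
    (fun s (_ : ι s) => AddMonoidAlgebra R L)).symm fun m => ?_
  simp [koszulForm_apply, Fintype.sum_sigma, Sigma.uncurry]

theorem rep_single (r : RhoIndex) (j : Fin r.rank) :
    r.rep c4Gen (Pi.single j 1) = ∑ i, r.matrix i j • (Pi.single i 1 : Fin r.rank → ℤ) := by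
  rw [RhoIndex.rep_generator]
  ext k
  simp [Pi.single_apply]

/-- In the basis `b'` transported from the direct sum the form is a sum of forms of the single
`ρ_i`, and the lifts add up. The lift is then carried to the given basis `b` by the change of
generators. -/
theorem hasPeriodicLift_of_isSumOfRho {ρ : Representation ℤ C4 L} (hρ : IsSumOfRho ρ) {n : ℕ}
    (b : Module.Basis (Fin n) ℤ L) :
    HasPeriodicLift (groupRingAct R ρ c4Gen) (koszulForm R b) := by
  obtain ⟨m, c, ⟨e⟩⟩ := hρ
  let b₀ : Module.Basis (Σ s, Fin (c s).rank) ℤ (DirectSum (Fin m) fun s => Fin (c s).rank → ℤ) :=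
    DFinsupp.basis fun s => Pi.basisFun ℤ (Fin (c s).rank)
  have hb₀ : ∀ s i, b₀ ⟨s, i⟩ =
      DirectSum.lof ℤ (Fin m) (fun s => Fin (c s).rank → ℤ) s (Pi.single i 1) := by
    intro s i
    apply b₀.repr.injective
    rw [b₀.repr_self]
    ext ⟨t, k⟩
    change _ = (Pi.basisFun ℤ (Fin (c t).rank)).repr
      ((DFinsupp.single s (Pi.single i 1) : Π₀ s, Fin (c s).rank → ℤ) t) k
    by_cases hst : s = t
    · subst hst
      by_cases hik : i = k
      · subst hik
        simp
      · simp [Ne.symm hik]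
    · rw [DFinsupp.single_eq_of_ne (Ne.symm hst)]
      simp [hst]
  let b' : Module.Basis (Σ s, Fin (c s).rank) ℤ L := b₀.map e.symm.toLinearEquiv
  have hb' : ∀ x, b' x = e.symm (b₀ x) := fun x => b₀.map_apply _ _
  have hact : ∀ y, ρ c4Gen (e.symm y) =
      e.symm (Representation.directSum (fun s => (c s).rep) c4Gen y) := by
    intro y
    exact (LinearMap.congr_fun (e.symm.toIntertwiningMap.isIntertwining' c4Gen) y).symm
  have h1 : HasPeriodicLift (groupRingAct R ρ c4Gen) (koszulForm R b') := by
    refine hasPeriodicLift_sigma R b' fun s => hasPeriodicLift_rho R ρ (c s) _ fun j => ?_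
    rw [hb', hact, hb₀]
    have : Representation.directSum (fun s => (c s).rep) c4Gen
        (DirectSum.lof ℤ (Fin m) (fun s => Fin (c s).rank → ℤ) s (Pi.single j 1)) =
        DirectSum.lof ℤ (Fin m) (fun s => Fin (c s).rank → ℤ) s
          ((c s).rep c4Gen (Pi.single j 1)) := by
      rw [Representation.directSum_apply, DirectSum.lmap_lof]
    rw [this, rep_single]
    simp only [map_sum, map_smul, hb', hb₀]
  -- Two bases of `L` are indexed by types in bijection, so after reindexing `koszulReduces_basis`
  -- applies.
  obtain ⟨⟨θ, hθ⟩, -⟩ := (koszulReduces_reindex (R := R) (b'.indexEquiv b) b').trans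
    (koszulReduces_basis b (b' ∘ (b'.indexEquiv b).symm) (by
      rw [(b'.indexEquiv b).symm.surjective.range_comp, b'.span_eq]))
  exact h1.congr θ hθ

end SumOfRho

/-! ### The compatible action on the Koszul complex -/

section CompatibleAction

variable {R : Type*} [CommRing R] {L : Type*} [AddCommGroup L]

theorem iterate_semilinear_smul (ρ : Representation ℤ C4 L) {N : Type*} [AddCommGroup N]
    [Module (AddMonoidAlgebra R L) N] (T : N →ₛₗ[groupRingAct R ρ c4Gen] N) (k : ℕ)
    (x : AddMonoidAlgebra R L) (f : N) :
    T^[k] (x • f) = groupRingAct R ρ (c4Gen ^ k) x • T^[k] f := by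
  induction k with
  | zero => simp [groupRingAct_one]
  | succ k ih => rw [Function.iterate_succ_apply', ih, map_smulₛₗ, groupRingAct_mul, ← pow_succ',
      Function.iterate_succ_apply']

theorem c4Gen_pow_val (g : C4) : c4Gen ^ (Multiplicative.toAdd g).val = g := by
  revert g
  decide

/-- The action of `ℤ/4` generated by a semilinear map of period four. -/
noncomputable def powSemilinear (ρ : Representation ℤ C4 L) {N : Type*} [AddCommGroup N]
    [Module (AddMonoidAlgebra R L) N] (T : N →ₛₗ[groupRingAct R ρ c4Gen] N) (g : C4) :
    N →ₛₗ[groupRingAct R ρ g] N where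
  toFun := T^[(Multiplicative.toAdd g).val]
  map_add' x y := iterate_map_add T _ x y
  map_smul' x f := by
    rw [iterate_semilinear_smul, c4Gen_pow_val]

theorem powSemilinear_mul (ρ : Representation ℤ C4 L) {N : Type*} [AddCommGroup N]
    [Module (AddMonoidAlgebra R L) N] (T : N →ₛₗ[groupRingAct R ρ c4Gen] N) {f : N}
    (hf : Function.IsPeriodicPt T 4 f) (g h : C4) :
    powSemilinear ρ T g (powSemilinear ρ T h f) = powSemilinear ρ T (g * h) f := by
  change T^[(Multiplicative.toAdd g).val] (T^[(Multiplicative.toAdd h).val] f) =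
    T^[(Multiplicative.toAdd (g * h)).val] f
  rw [← Function.iterate_add_apply, toAdd_mul, ZMod.val_add]
  exact (hf.iterate_mod_apply _).symm

theorem powSemilinear_semiconj (ρ : Representation ℤ C4 L) {N N' : Type*} [AddCommGroup N]
    [Module (AddMonoidAlgebra R L) N] [AddCommGroup N'] [Module (AddMonoidAlgebra R L) N']
    {T : N →ₛₗ[groupRingAct R ρ c4Gen] N} {T' : N' →ₛₗ[groupRingAct R ρ c4Gen] N'} {d : N → N'}
    (hd : Function.Semiconj d T T') (g : C4) (f : N) :
    powSemilinear ρ T' g (d f) = d (powSemilinear ρ T g f) :=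
  (hd.iterate_right _ f).symm

theorem iterate_four_extMap {A M : Type*} [CommRing A] [AddCommGroup M] [Module A M]
    {σ : A →+* A} (hσ : ∀ a, σ (σ (σ (σ a))) = a) {T : M →ₛₗ[σ] M}
    (hT : ∀ m, T (T (T (T m))) = m) (z : ExteriorAlgebra A M) :
    extMap T (extMap T (extMap T (extMap T z))) = z := by
  induction z using ext_left_induction with
  | algebraMap r => simp [hσ]
  | add x y hx hy => simp only [map_add, hx, hy]
  | ι_mul x m hx => simp only [map_mul, hx, extMap_ι, hT]

theorem aug_groupRingAct {G : Type*} [Group G] (ρ : Representation ℤ G L) (g : G)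
    (a : AddMonoidAlgebra R L) : aug R L (groupRingAct R ρ g a) = aug R L a :=
  aug_mapDomain _ a

theorem zeroEquiv_extPowMap {A M : Type*} [CommRing A] [AddCommGroup M] [Module A M]
    {σ : A →+* A} (T : M →ₛₗ[σ] M) (z : ⋀[A]^0 M) :
    exteriorPower.zeroEquiv A M (extPowMap T 0 z) = σ (exteriorPower.zeroEquiv A M z) := by
  obtain ⟨a, rfl⟩ := (exteriorPower.zeroEquiv A M).symm.surjective z
  rw [LinearEquiv.apply_symm_apply, exteriorPower.zeroEquiv_symm_apply, map_smulₛₗ, map_smul]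
  have : extPowMap T 0 (exteriorPower.ιMulti A 0 (by rintro ⟨i, hi⟩; simp at hi)) =
      exteriorPower.ιMulti A 0 (by rintro ⟨i, hi⟩; simp at hi) := by
    refine Subtype.ext ?_
    change extMap T _ = _
    rw [exteriorPower.ιMulti_apply_coe, extMap_ιMulti]
    simp
  rw [this, exteriorPower.zeroEquiv_ιMulti, smul_eq_mul, mul_one]

/-- The exterior powers of `T` commute with the differential because `T` is compatible with the
form. They have period four, so letting `g` act by the iterate with exponent its representative in
`{0, 1, 2, 3}` is multiplicative. -/
theorem nonempty_compatibleAction {ρ : Representation ℤ C4 L} {n : ℕ}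
    (b : Module.Basis (Fin n) ℤ L)
    (h : HasPeriodicLift (groupRingAct R ρ c4Gen) (koszulForm R b)) :
    Nonempty (CompatibleAction ρ (latticeKoszul R b) (latticeKoszulAug R b)) := by
  obtain ⟨T, hT, h4⟩ := h
  have hcomm : ∀ (p : ℕ) (f : ⋀[AddMonoidAlgebra R L]^(p + 1) (Fin n → AddMonoidAlgebra R L)),
      extPowMap T p (koszulD (koszulForm R b) p f) =
        koszulD (koszulForm R b) p (extPowMap T (p + 1) f) :=
    fun p f => Subtype.ext (extMap_koszulDiff T hT f.1)
  have hperiod : ∀ (p : ℕ) (f : ⋀[AddMonoidAlgebra R L]^p (Fin n → AddMonoidAlgebra R L)),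
      Function.IsPeriodicPt (extPowMap T p) 4 f :=
    fun p f => Subtype.ext (iterate_four_extMap (groupRingAct_c4Gen_iterate ρ) h4 f.1)
  have haug : ∀ (g : C4) (f : ⋀[AddMonoidAlgebra R L]^0 (Fin n → AddMonoidAlgebra R L)),
      aug R L (exteriorPower.zeroEquiv _ _ (powSemilinear ρ (extPowMap T 0) g f)) =
        aug R L (exteriorPower.zeroEquiv _ _ f) := by
    intro g f
    change aug R L (exteriorPower.zeroEquiv _ _
        ((extPowMap T 0)^[(Multiplicative.toAdd g).val] f)) =
      aug R L (exteriorPower.zeroEquiv _ _ f)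
    generalize (Multiplicative.toAdd g).val = k
    induction k with
    | zero => rfl
    | succ k ih => rw [Function.iterate_succ_apply', zeroEquiv_extPowMap, aug_groupRingAct, ih]
  refine ⟨{ τ := fun g p => powSemilinear ρ (extPowMap T p) g
            comm := fun g p f => ?_
            aug_comm := fun g f => ?_
            mul := fun g h p f => ?_
            one := fun p f => rfl }⟩
  · have hd : (latticeKoszul R b).d (p + 1) p = ModuleCat.ofHom (koszulD (koszulForm R b) p) :=
      koszulComplex_d _ p
    rw [hd]
    exact powSemilinear_semiconj ρ (fun f => (hcomm p f).symm) g f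
  · exact haug g f
  · exact powSemilinear_mul ρ _ (hperiod p f) g h

end CompatibleAction


/-! ### Projective resolutions and cohomology classes -/

section Homological

variable {k : Type} [CommRing k]

theorem Rep.exact_of_function_exact {G : Type} [Group G] {S : ShortComplex (Rep.{0} k G)}
    (h : Function.Exact S.f.hom S.g.hom) : S.Exact := by
  rw [← S.exact_map_iff_of_faithful (forget₂ (Rep.{0} k G) (ModuleCat k)),
    ShortComplex.ShortExact.moduleCat_exact_iff_function_exact]
  exact h

/-- An exact augmented complex of projective representations is a projective resolution. -/
noncomputable def resolutionOfExact {G : Type} [Group G] {A : Rep.{0} k G}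
    (C : ChainComplex (Rep.{0} k G) ℕ) (hC : ∀ n, Projective (C.X n)) (ε : C.X 0 ⟶ A)
    (hε : Function.Surjective ε.hom) (h₀ : Function.Exact (C.d 1 0).hom ε.hom)
    (h : ∀ n, Function.Exact (C.d (n + 2) (n + 1)).hom (C.d (n + 1) n).hom) :
    ProjectiveResolution A where
  complex := C
  projective := hC
  π := (ChainComplex.toSingle₀Equiv _ _).symm ⟨ε, Rep.hom_injective (DFunLike.ext _ _ fun x =>
    h₀.apply_apply_eq_zero x)⟩
  quasiIso := ⟨fun n => by
    cases n with
    | zero =>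
      rw [ChainComplex.quasiIsoAt₀_iff, ShortComplex.quasiIso_iff_of_zeros']
      · have hw : C.d 1 0 ≫ ε = 0 :=
            Rep.hom_injective (DFunLike.ext _ _ fun x => h₀.apply_apply_eq_zero x)
        refine (ShortComplex.exact_and_epi_g_iff_of_iso
          (S₂ := ShortComplex.mk (C.d 1 0) ε hw) ?_).2
          ⟨Rep.exact_of_function_exact h₀, (Rep.epi_iff_surjective ε).2 hε⟩
        exact ShortComplex.isoMk (Iso.refl _) (Iso.refl _) (Iso.refl _)
          ((Category.id_comp _).trans (Category.comp_id _).symm)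
          ((Category.id_comp _).trans (Category.comp_id _).symm)
      · exact C.shape _ _ (by simp)
      all_goals rfl
    | succ n =>
      rw [quasiIsoAt_iff_exactAt']
      · rw [HomologicalComplex.exactAt_iff' _ (n + 1 + 1) (n + 1) n (by simp) (by simp)]
        exact Rep.exact_of_function_exact (h n)
      · apply ChainComplex.exactAt_succ_single_obj⟩

/-- The cohomology class of a cocycle. -/
noncomputable def cohomologyClass (K : CochainComplex (ModuleCat k) ℕ) (n : ℕ) :
    LinearMap.ker (K.d n (n + 1)).hom →ₗ[k] K.homology n :=
  (K.homologyπ n).hom ∘ₗ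
    (K.liftCycles (ModuleCat.ofHom (LinearMap.ker (K.d n (n + 1)).hom).subtype) (n + 1) (by simp)
      (ModuleCat.hom_ext (LinearMap.ext fun x => x.2))).hom

theorem iCycles_liftCycles_apply (K : CochainComplex (ModuleCat k) ℕ) (n : ℕ)
    (z : LinearMap.ker (K.d n (n + 1)).hom) :
    (K.iCycles n).hom ((K.liftCycles
      (ModuleCat.ofHom (LinearMap.ker (K.d n (n + 1)).hom).subtype) (n + 1) (by simp)
      (ModuleCat.hom_ext (LinearMap.ext fun x => x.2))).hom z) = z.1 := by
  have := K.liftCycles_i (ModuleCat.ofHom (LinearMap.ker (K.d n (n + 1)).hom).subtype) (n + 1)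
    (by simp) (ModuleCat.hom_ext (LinearMap.ext fun x => x.2))
  exact congr($(this).hom z)

theorem iCycles_injective (K : CochainComplex (ModuleCat k) ℕ) (n : ℕ) :
    Function.Injective (K.iCycles n).hom :=
  (ModuleCat.mono_iff_injective _).1 inferInstance

theorem cohomologyClass_surjective (K : CochainComplex (ModuleCat k) ℕ) (n : ℕ) :
    Function.Surjective (cohomologyClass K n) := by
  intro x
  obtain ⟨y, rfl⟩ := (ModuleCat.epi_iff_surjective (K.homologyπ n)).1 inferInstance x
  refine ⟨⟨(K.iCycles n).hom y, ?_⟩, ?_⟩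
  · exact congr($(K.iCycles_d n (n + 1)).hom y)
  · refine congrArg (K.homologyπ n).hom (iCycles_injective K n ?_)
    rw [iCycles_liftCycles_apply]

/-- The index `i` is left free so that degree zero needs no separate statement: if `i` does not
precede `n`, the differential from `i` to `n` is zero. -/
theorem cohomologyClass_eq_zero_iff (K : CochainComplex (ModuleCat k) ℕ) (n : ℕ)
    (z : LinearMap.ker (K.d n (n + 1)).hom) :
    cohomologyClass K n z = 0 ↔ ∃ i y, (K.d i n).hom y = z.1 := by
  have hex : Function.Exact (K.toCycles ((ComplexShape.up ℕ).prev n) n).hom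
      (K.homologyπ n).hom := by
    have := ShortComplex.exact_of_g_is_cokernel
      (ShortComplex.mk _ _ (K.toCycles_comp_homologyπ _ n))
      (K.homologyIsCokernel _ n rfl)
    rwa [ShortComplex.ShortExact.moduleCat_exact_iff_function_exact] at this
  constructor
  · intro h
    obtain ⟨y, hy⟩ := (hex _).1 h
    refine ⟨_, y, ?_⟩
    rw [← iCycles_liftCycles_apply, ← hy]
    exact congr($(K.toCycles_i _ n).hom y).symm
  · rintro ⟨i, y, hy⟩
    have h1 : (K.toCycles i n).hom y = (K.liftCycles
      (ModuleCat.ofHom (LinearMap.ker (K.d n (n + 1)).hom).subtype) (n + 1) (by simp)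
      (ModuleCat.hom_ext (LinearMap.ext fun x => x.2))).hom z := by
      apply iCycles_injective
      rw [iCycles_liftCycles_apply, ← hy]
      exact congr($(K.toCycles_i i n).hom y)
    change (K.homologyπ n).hom _ = 0
    rw [← h1]
    exact congr($(K.toCycles_comp_homologyπ i n).hom y)

/-- Two surjections with the same kernel have isomorphic targets. -/
noncomputable def equivOfKerEq {A M M' : Type} [AddCommGroup A] [AddCommGroup M] [AddCommGroup M']
    [Module k A] [Module k M] [Module k M'] (f : A →ₗ[k] M) (g : A →ₗ[k] M')
    (hf : Function.Surjective f) (hg : Function.Surjective g)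
    (h : ∀ a, f a = 0 ↔ g a = 0) : M ≃ₗ[k] M' :=
  (f.quotKerEquivOfSurjective hf).symm ≪≫ₗ
    Submodule.quotEquivOfEq (LinearMap.ker f) (LinearMap.ker g) (Submodule.ext h) ≪≫ₗ
    g.quotKerEquivOfSurjective hg

theorem equivOfKerEq_apply {A M M' : Type} [AddCommGroup A] [AddCommGroup M] [AddCommGroup M']
    [Module k A] [Module k M] [Module k M'] (f : A →ₗ[k] M) (g : A →ₗ[k] M')
    (hf : Function.Surjective f) (hg : Function.Surjective g)
    (h : ∀ a, f a = 0 ↔ g a = 0) (a : A) : equivOfKerEq f g hf hg h (f a) = g a := by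
  have : (f.quotKerEquivOfSurjective hf).symm (f a) = Submodule.Quotient.mk a := by
    rw [LinearEquiv.symm_apply_eq]
    rfl
  change g.quotKerEquivOfSurjective hg (Submodule.quotEquivOfEq (LinearMap.ker f) (LinearMap.ker g)
      (Submodule.ext h)
    ((f.quotKerEquivOfSurjective hf).symm (f a))) = g a
  rw [this]
  rfl

theorem homologyMap_cohomologyClass {K L : CochainComplex (ModuleCat k) ℕ} (f : K ⟶ L) (n : ℕ)
    (z : LinearMap.ker (K.d n (n + 1)).hom) (w : LinearMap.ker (L.d n (n + 1)).hom)
    (h : (f.f n).hom z.1 = w.1) :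
    (HomologicalComplex.homologyMap f n).hom (cohomologyClass K n z) = cohomologyClass L n w := by
  have h1 := congr($(HomologicalComplex.homologyπ_naturality f n).hom
    ((K.liftCycles (ModuleCat.ofHom (LinearMap.ker (K.d n (n + 1)).hom).subtype) (n + 1) (by simp)
      (ModuleCat.hom_ext (LinearMap.ext fun x => x.2))).hom z))
  refine h1.trans (congrArg (L.homologyπ n).hom (iCycles_injective L n ?_))
  rw [iCycles_liftCycles_apply, ← h, ← iCycles_liftCycles_apply K n z]
  exact congr($(HomologicalComplex.cyclesMap_i f n).hom _)

end Homological


/-! ### Total complexes -/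

section TotalComplex

open Finset.HasAntidiagonal (antidiagonal)

variable {k : Type} [CommRing k] {T : ℕ → ℕ → Type} [∀ i j, AddCommGroup (T i j)]
  [∀ i j, Module k (T i j)]

variable (T) in
/-- The terms of the total complex of a first quadrant double complex. -/
abbrev Tot (n : ℕ) : Type := ∀ p : antidiagonal n, T p.1.1 p.1.2

/-- The position next to `p` in the first direction. -/
abbrev stepLeft {n : ℕ} (p : antidiagonal n) : antidiagonal (n + 1) :=
  ⟨(p.1.1 + 1, p.1.2), by
    have := Finset.HasAntidiagonal.mem_antidiagonal.1 p.2
    rw [Finset.HasAntidiagonal.mem_antidiagonal]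
    dsimp only
    omega⟩

/-- The position next to `p` in the second direction. -/
abbrev stepRight {n : ℕ} (p : antidiagonal n) : antidiagonal (n + 1) :=
  ⟨(p.1.1, p.1.2 + 1), by
    have := Finset.HasAntidiagonal.mem_antidiagonal.1 p.2
    rw [Finset.HasAntidiagonal.mem_antidiagonal]
    dsimp only
    omega⟩

/-- The position `(0, n)`. -/
abbrev leftEnd (n : ℕ) : antidiagonal n := ⟨(0, n), by simp⟩

/-- The differential of the total complex. -/
def totD (d₁ : ∀ i j, T (i + 1) j →ₗ[k] T i j) (d₂ : ∀ i j, T i (j + 1) →ₗ[k] T i j) (n : ℕ) :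
    Tot T (n + 1) →ₗ[k] Tot T n :=
  LinearMap.pi fun p => d₁ p.1.1 p.1.2 ∘ₗ LinearMap.proj (stepLeft p) +
    ((-1) ^ p.1.1 : k) • d₂ p.1.1 p.1.2 ∘ₗ LinearMap.proj (stepRight p)

variable {d₁ : ∀ i j, T (i + 1) j →ₗ[k] T i j} {d₂ : ∀ i j, T i (j + 1) →ₗ[k] T i j}

theorem totD_apply (n : ℕ) (q : Tot T (n + 1)) (p : antidiagonal n) :
    totD d₁ d₂ n q p = d₁ p.1.1 p.1.2 (q (stepLeft p)) +
      ((-1) ^ p.1.1 : k) • d₂ p.1.1 p.1.2 (q (stepRight p)) :=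
  rfl

theorem totD_totD (h₁ : ∀ i j x, d₁ i j (d₁ (i + 1) j x) = 0)
    (h₂ : ∀ i j x, d₂ i j (d₂ i (j + 1) x) = 0)
    (h₁₂ : ∀ i j x, d₁ i j (d₂ (i + 1) j x) = d₂ i j (d₁ i (j + 1) x)) (n : ℕ)
    (q : Tot T (n + 2)) : totD d₁ d₂ n (totD d₁ d₂ (n + 1) q) = 0 := by
  funext p
  simp only [totD_apply, map_add, map_smul, h₁, h₂, h₁₂, smul_zero, add_zero, zero_add,
    pow_succ, Pi.zero_apply]
  rw [← add_smul]
  simp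

theorem totD_naturality {T' : ℕ → ℕ → Type} [∀ i j, AddCommGroup (T' i j)]
    [∀ i j, Module k (T' i j)] {d₁' : ∀ i j, T' (i + 1) j →ₗ[k] T' i j}
    {d₂' : ∀ i j, T' i (j + 1) →ₗ[k] T' i j} (f : ∀ i j, T i j →ₗ[k] T' i j)
    (h₁ : ∀ i j x, f i j (d₁ i j x) = d₁' i j (f (i + 1) j x))
    (h₂ : ∀ i j x, f i j (d₂ i j x) = d₂' i j (f i (j + 1) x)) (n : ℕ) (q : Tot T (n + 1)) :
    (fun p => f p.1.1 p.1.2 (totD d₁ d₂ n q p)) =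
      totD d₁' d₂' n fun p => f p.1.1 p.1.2 (q p) := by
  funext p
  simp only [totD_apply, map_add, map_smul, h₁, h₂]

theorem eq_leftEnd_or_stepLeft {n : ℕ} (p : antidiagonal (n + 1)) :
    p = leftEnd (n + 1) ∨ ∃ p', p = stepLeft p' := by
  obtain ⟨⟨i, j⟩, h⟩ := p
  rcases i with _ | i
  · obtain rfl : j = n + 1 := by simpa using h
    exact Or.inl rfl
  · refine Or.inr ⟨⟨(i, j), ?_⟩, rfl⟩
    rw [Finset.HasAntidiagonal.mem_antidiagonal] at h ⊢
    dsimp only at h ⊢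
    omega

theorem stepLeft_injective {n : ℕ} : Function.Injective (stepLeft (n := n)) := by
  rintro ⟨⟨i, j⟩, h⟩ ⟨⟨i', j'⟩, h'⟩ e
  simp only [Subtype.mk.injEq, Prod.mk.injEq, add_left_inj] at e
  simp [e.1, e.2]

/-- A map that vanishes on the image of the second differential only sees the first one. -/
theorem map_totD {M : Type} [AddCommGroup M] [Module k M] {n : ℕ} (F : Tot T n →ₗ[k] M)
    (hF : ∀ (p : antidiagonal n) (x : T p.1.1 (p.1.2 + 1)),
      F (Pi.single p (d₂ p.1.1 p.1.2 x)) = 0) (q : Tot T (n + 1)) :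
    F (totD d₁ d₂ n q) = ∑ p, F (Pi.single p (d₁ p.1.1 p.1.2 (q (stepLeft p)))) := by
  conv_lhs => rw [← Finset.univ_sum_single (totD d₁ d₂ n q)]
  rw [map_sum]
  refine Finset.sum_congr rfl fun p _ => ?_
  rw [totD_apply, Pi.single_add, map_add, Pi.single_smul, map_smul, hF, smul_zero, add_zero]

theorem map_totD_single_stepLeft {M : Type} [AddCommGroup M] [Module k M] {n : ℕ}
    (F : Tot T n →ₗ[k] M) (hF : ∀ (p : antidiagonal n) (x : T p.1.1 (p.1.2 + 1)),
      F (Pi.single p (d₂ p.1.1 p.1.2 x)) = 0) (p : antidiagonal n) (x : T (p.1.1 + 1) p.1.2) :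
    F (totD d₁ d₂ n (Pi.single (stepLeft p) x)) = F (Pi.single p (d₁ p.1.1 p.1.2 x)) := by
  rw [map_totD F hF, Finset.sum_eq_single p]
  · rw [Pi.single_eq_same]
  · intro p' _ h
    rw [Pi.single_eq_of_ne (stepLeft_injective.ne h), map_zero, Pi.single_zero, map_zero]
  · simp

/-- No first differential leaves the column with index zero, so the image of this summand under the
total differential comes from `d₂` alone. -/
theorem map_totD_single_leftEnd {M : Type} [AddCommGroup M] [Module k M] {n : ℕ}
    (F : Tot T n →ₗ[k] M) (hF : ∀ (p : antidiagonal n) (x : T p.1.1 (p.1.2 + 1)),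
      F (Pi.single p (d₂ p.1.1 p.1.2 x)) = 0) (x : T 0 (n + 1)) :
    F (totD d₁ d₂ n (Pi.single (leftEnd (n + 1)) x)) = 0 := by
  rw [map_totD F hF]
  refine Finset.sum_eq_zero fun p _ => ?_
  rw [Pi.single_eq_of_ne (by simp), map_zero, Pi.single_zero, map_zero]

/-- A double complex whose rows are contractible onto `K`: the data that makes the total complex
as exact as `K`. -/
structure RowContraction (d₁ : ∀ i j, T (i + 1) j →ₗ[k] T i j)
    (d₂ : ∀ i j, T i (j + 1) →ₗ[k] T i j) {K : ℕ → Type} [∀ j, AddCommGroup (K j)]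
    [∀ j, Module k (K j)] (d : ∀ j, K (j + 1) →ₗ[k] K j) where
  /-- The contraction. -/
  s : ∀ i j, T i j →ₗ[k] T (i + 1) j
  /-- The augmentation of the rows. -/
  e : ∀ j, T 0 j →ₗ[k] K j
  /-- A section of the augmentation. -/
  η : ∀ j, K j →ₗ[k] T 0 j
  s_d₂ : ∀ i j x, s i j (d₂ i j x) = d₂ (i + 1) j (s i (j + 1) x)
  e_d₁ : ∀ j x, e j (d₁ 0 j x) = 0
  e_d₂ : ∀ j x, e j (d₂ 0 j x) = d j (e (j + 1) x)
  η_d : ∀ j x, η j (d j x) = d₂ 0 j (η (j + 1) x)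
  e_η : ∀ j x, e j (η j x) = x
  s_zero : ∀ j x, d₁ 0 j (s 0 j x) + η j (e j x) = x
  s_succ : ∀ i j x, d₁ (i + 1) j (s (i + 1) j x) + s i j (d₁ i j x) = x

namespace RowContraction

variable {K : ℕ → Type} [∀ j, AddCommGroup (K j)] [∀ j, Module k (K j)]
  {d : ∀ j, K (j + 1) →ₗ[k] K j} (c : RowContraction d₁ d₂ d)

/-- The contraction of the total complex. -/
def tot (n : ℕ) (q : Tot T n) : Tot T (n + 1)
  | ⟨(0, _), _⟩ => 0
  | ⟨(i + 1, j), h⟩ => c.s i j (q ⟨(i, j), by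
      rw [Finset.HasAntidiagonal.mem_antidiagonal] at h ⊢
      dsimp only at h ⊢
      omega⟩)

/-- The preimage is `s q` plus `η y` at position `(0, n + 1)`. In the columns of positive index, `d₁
s + s d₁ = 1` and the cycle condition give back `q`. In the column of index zero, `d₁ s + η e = 1`
leaves the defect `η (e q)`, which `η y` supplies since `d y = e q`. Stating the cycle condition
entrywise lets the lemma serve in degree zero too, where it is vacuous. -/
theorem exists_totD_eq {n : ℕ} {q : Tot T n}
    (hq : ∀ (i j : ℕ) (h : (i + 1, j) ∈ antidiagonal n) (h' : (i, j + 1) ∈ antidiagonal n),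
      d₁ i j (q ⟨(i + 1, j), h⟩) + ((-1) ^ i : k) • d₂ i j (q ⟨(i, j + 1), h'⟩) = 0)
    {y : K (n + 1)} (hy : d n y = c.e n (q (leftEnd n))) :
    ∃ r, totD d₁ d₂ n r = q := by
  refine ⟨c.tot n q + Pi.single (leftEnd (n + 1)) (c.η (n + 1) y), ?_⟩
  rw [map_add]
  funext ⟨⟨i, j⟩, h⟩
  rw [Pi.add_apply, totD_apply, totD_apply]
  rcases i with _ | i
  · obtain rfl : j = n := by simpa using h
    have h1 : (Pi.single (leftEnd (j + 1)) (c.η (j + 1) y) : Tot T (j + 1))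
        (stepLeft ⟨(0, j), h⟩) = 0 := Pi.single_eq_of_ne (by simp) _
    have h2 : (Pi.single (leftEnd (j + 1)) (c.η (j + 1) y) : Tot T (j + 1))
        (stepRight ⟨(0, j), h⟩) = c.η (j + 1) y := Pi.single_eq_same _ _
    rw [h1, h2]
    dsimp only [tot]
    rw [← c.η_d, hy]
    simpa using c.s_zero j _
  · have h1 : (Pi.single (leftEnd (n + 1)) (c.η (n + 1) y) : Tot T (n + 1))
        (stepLeft ⟨(i + 1, j), h⟩) = 0 := Pi.single_eq_of_ne (by simp) _
    have h2 : (Pi.single (leftEnd (n + 1)) (c.η (n + 1) y) : Tot T (n + 1))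
        (stepRight ⟨(i + 1, j), h⟩) = 0 := Pi.single_eq_of_ne (by simp) _
    have h3 := congrArg (c.s i j) (hq i j h (by
      rw [Finset.HasAntidiagonal.mem_antidiagonal] at h ⊢
      dsimp only at h ⊢
      omega))
    rw [map_add, map_smul, c.s_d₂, map_zero, ← eq_neg_iff_add_eq_zero] at h3
    have h4 := c.s_succ i j (q ⟨(i + 1, j), h⟩)
    rw [h3] at h4
    rw [h1, h2]
    dsimp only [tot]
    rw [pow_succ, mul_neg_one, neg_smul]
    simpa using h4

theorem exact_succ (c : RowContraction d₁ d₂ d) {n : ℕ} (h₁ : ∀ i j x, d₁ i j (d₁ (i + 1) j x) = 0)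
    (h₂ : ∀ i j x, d₂ i j (d₂ i (j + 1) x) = 0)
    (h₁₂ : ∀ i j x, d₁ i j (d₂ (i + 1) j x) = d₂ i j (d₁ i (j + 1) x))
    (hd : Function.Exact (d (n + 1)) (d n)) :
    Function.Exact (totD d₁ d₂ (n + 1)) (totD d₁ d₂ n) := by
  intro q
  constructor
  · intro hq
    -- The augmentation of a cycle is a cycle of `K`, hence a boundary; this is the only use of the
    -- exactness of `K`.
    have hx : d n (c.e (n + 1) (q (leftEnd (n + 1)))) = 0 := by
      have := congrArg (c.e n) (congrFun hq (leftEnd n))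
      rw [totD_apply, map_add, map_smul, c.e_d₁, c.e_d₂] at this
      simpa using this
    obtain ⟨y, hy⟩ := (hd _).1 hx
    refine c.exists_totD_eq (fun i j h h' => ?_) hy
    exact congrFun hq ⟨(i, j), by
      rw [Finset.HasAntidiagonal.mem_antidiagonal] at h ⊢
      dsimp only at h ⊢
      omega⟩
  · rintro ⟨r, rfl⟩
    exact totD_totD h₁ h₂ h₁₂ n r

theorem exact_zero {A : Type} [AddCommGroup A] [Module k A] {ε : K 0 →ₗ[k] A}
    (hε : Function.Exact (d 0) ε) :
    Function.Exact (totD d₁ d₂ 0) (ε ∘ₗ c.e 0 ∘ₗ LinearMap.proj (leftEnd 0)) := by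
  intro q
  constructor
  · intro hq
    obtain ⟨y, hy⟩ := (hε _).1 hq
    exact c.exists_totD_eq (fun i j h h' => by simp at h) hy
  · rintro ⟨r, rfl⟩
    change ε (c.e 0 (totD d₁ d₂ 0 r (leftEnd 0))) = 0
    rw [totD_apply, map_add, map_smul, c.e_d₁, c.e_d₂, zero_add, map_smul,
      hε.apply_apply_eq_zero, smul_zero]

theorem surjective_aug {A : Type} [AddCommGroup A] [Module k A] {ε : K 0 →ₗ[k] A}
    (hε : Function.Surjective ε) :
    Function.Surjective (ε ∘ₗ c.e 0 ∘ₗ LinearMap.proj (leftEnd 0) : Tot T 0 →ₗ[k] A) := by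
  intro a
  obtain ⟨x, rfl⟩ := hε a
  refine ⟨Pi.single (leftEnd 0) (c.η 0 x), ?_⟩
  change ε (c.e 0 ((Pi.single (leftEnd 0) (c.η 0 x) : Tot T 0) (leftEnd 0))) = ε x
  rw [Pi.single_eq_same, c.e_η]

end RowContraction

end TotalComplex


/-! ### Linear contractions of complexes of representations -/

section LinearContraction

variable {k : Type} [CommRing k] {G : Type} [Group G]

/-- A contraction, by maps which need not be equivariant, of a complex of representations onto
its base ring. -/
structure LinearContraction (C : ChainComplex (Rep.{0} k G) ℕ) where
  /-- The contraction. -/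
  s : ∀ i, C.X i →ₗ[k] C.X (i + 1)
  /-- The augmentation. -/
  e : C.X 0 ⟶ Rep.trivial k G k
  /-- An element of augmentation one. -/
  u : C.X 0
  e_d : ∀ x, e.hom ((C.d 1 0).hom x) = 0
  e_u : e.hom u = 1
  s_zero : ∀ x, (C.d 1 0).hom (s 0 x) + e.hom x • u = x
  s_succ : ∀ i x, (C.d (i + 2) (i + 1)).hom (s (i + 1) x) + s i ((C.d (i + 1) i).hom x) = x

open scoped MonoidAlgebra

variable (k G) in
/-- Prepending `1` to a simplex. -/
noncomputable def prependOne (i : ℕ) : k[Fin i → G] →ₗ[k] k[Fin (i + 1) → G] :=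
  Finsupp.lift k[Fin (i + 1) → G] k (Fin i → G)
      (fun c => MonoidAlgebra.single (Fin.cons 1 c : Fin (i + 1) → G) (1 : k)) ∘ₗ
    (MonoidAlgebra.coeffLinearEquiv k).toLinearMap

theorem prependOne_single (i : ℕ) (c : Fin i → G) (r : k) :
    prependOne k G i (.single c r) = .single (Fin.cons 1 c : Fin (i + 1) → G) r := by
  simp [prependOne]

/-- The zeroth face of `(1, c)` is `c`, and its other faces are `1` prepended to the faces of `c`,
with opposite signs. -/
theorem standard_d_prependOne (i : ℕ) (x : k[Fin (i + 1) → G]) :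
    Rep.standardComplex.d k G (i + 1) (prependOne k G (i + 1) x) +
      prependOne k G i (Rep.standardComplex.d k G i x) = x := by
  induction x using MonoidAlgebra.induction_linear with
  | zero => simp
  | add x y hx hy =>
    simp only [map_add]
    rw [add_add_add_comm, hx, hy]
  | single c r =>
    rw [prependOne_single, Rep.standardComplex.d_single, Rep.standardComplex.d_single, map_sum,
      Fin.sum_univ_succ]
    simp only [prependOne_single]
    have h2 : ∀ p : Fin (i + 1), ((Fin.cons 1 c : Fin (i + 2) → G) ∘ p.succ.succAbove) =
        Fin.cons 1 (c ∘ p.succAbove) := by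
      intro p
      ext j
      refine Fin.cases ?_ (fun j => ?_) j <;> simp
    simp [h2, pow_succ]

theorem standard_ε_apply (x : k[Fin 1 → G]) :
    (Rep.standardComplex.ε k G).hom x = Finsupp.linearCombination k (fun _ => (1 : k)) x.coeff :=
  rfl

/-- The differential with index `0` ends in chains on the empty tuple, a copy of `k`, and there it
is the augmentation. This turns `standard_d_prependOne` in the lowest degree into the identity
`s_zero`. -/
theorem prependOne_zero_d (x : k[Fin 1 → G]) :
    prependOne k G 0 (Rep.standardComplex.d k G 0 x) =
      ((Rep.standardComplex.ε k G).hom x : k) • MonoidAlgebra.single (1 : Fin 1 → G) (1 : k) := by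
  rw [standard_ε_apply]
  induction x using MonoidAlgebra.induction_linear with
  | zero => simp
  | add x y hx hy => simp [hx, hy, add_smul]
  | single c r =>
    rw [Rep.standardComplex.d_single]
    have : ∀ c : Fin 0 → G, (Fin.cons 1 c : Fin 1 → G) = 1 := by
      intro c
      ext j
      rw [Fin.fin_one_eq_zero j]
      simp
    simp [prependOne_single, this]

/-- The standard complex is contractible. -/
noncomputable def standardContraction : LinearContraction (Rep.standardComplex k G) where
  s i := prependOne k G (i + 1)
  e := Rep.standardComplex.ε k G
  u := MonoidAlgebra.single (1 : Fin 1 → G) (1 : k)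
  e_d x := congr($(Rep.standardComplex.d_comp_ε k G).hom x)
  e_u := by
    have h : (Rep.standardComplex.ε k G).hom (MonoidAlgebra.single (1 : Fin 1 → G) (1 : k)) =
        (1 : k) := by
      rw [standard_ε_apply, MonoidAlgebra.coeff_single]
      simp
    exact h
  s_zero x := by
    rw [Rep.standardComplex.d_apply]
    exact (congrArg _ (prependOne_zero_d x)).symm.trans (standard_d_prependOne 0 x)
  s_succ i x := by
    rw [Rep.standardComplex.d_apply, Rep.standardComplex.d_apply]
    exact standard_d_prependOne (i + 1) x

end LinearContraction


/-! ### Homomorphisms equivariant under a normal subgroup -/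

section NormalHom

open SemidirectProduct
open scoped TensorProduct

variable {k : Type} [CommRing k] {N G : Type} [Group N] [Group G] {φ : G →* MulAut N}

/-- The linear maps between two representations of `N ⋊ G` that commute with the action of `N`. -/
def normalEquivariant (X Y : Rep.{0} k (N ⋊[φ] G)) : Submodule k (X →ₗ[k] Y) where
  carrier := {f | ∀ l x, f (X.ρ (inl l) x) = Y.ρ (inl l) (f x)}
  add_mem' hf hg l x := by
    simp only [LinearMap.add_apply, map_add, hf l x, hg l x]
  zero_mem' l x := by simp
  smul_mem' r f hf l x := by
    simp only [LinearMap.smul_apply, map_smul, hf l x]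

theorem rep_inr_inl (X : Rep.{0} k (N ⋊[φ] G)) (g : G) (l : N) (x : X) :
    X.ρ (inr g) (X.ρ (inl l) x) = X.ρ (inl (φ g l)) (X.ρ (inr g) x) := by
  rw [← Module.End.mul_apply, ← map_mul, ← Module.End.mul_apply, ← map_mul, inl_aut]
  simp

/-- The representation of `G` on the maps between representations of `N ⋊ G` that commute with the
action of `N`. -/
noncomputable def normalHom (X Y : Rep.{0} k (N ⋊[φ] G)) : Rep.{0} k G :=
  Rep.of (X := normalEquivariant X Y)
    { toFun := fun g =>
        ((LinearMap.llcomp k X Y Y (Y.ρ (inr g))) ∘ₗ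
          (LinearMap.lcomp k Y (X.ρ (inr g⁻¹)))).restrict fun f hf l x => by
            change Y.ρ (inr g) (f (X.ρ (inr g⁻¹) (X.ρ (inl l) x))) =
              Y.ρ (inl l) (Y.ρ (inr g) (f (X.ρ (inr g⁻¹) x)))
            rw [rep_inr_inl, hf, rep_inr_inl]
            simp
      map_one' := by
        ext f x
        change Y.ρ (inr 1) (f.1 (X.ρ (inr 1⁻¹) x)) = f.1 x
        simp
      map_mul' := fun g h => by
        ext f x
        change Y.ρ (inr (g * h)) (f.1 (X.ρ (inr (g * h)⁻¹) x)) =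
          Y.ρ (inr g) (Y.ρ (inr h) (f.1 (X.ρ (inr h⁻¹) (X.ρ (inr g⁻¹) x))))
        simp }

theorem normalHom_ρ_apply (X Y : Rep.{0} k (N ⋊[φ] G)) (g : G) (f : normalEquivariant X Y)
    (x : X) :
    ((normalHom X Y).ρ g f : normalEquivariant X Y).1 x =
      Y.ρ (inr g) (f.1 (X.ρ (inr g⁻¹) x)) :=
  rfl

/-- Functoriality of `normalHom` in the second variable. -/
noncomputable def normalHomMap (X : Rep.{0} k (N ⋊[φ] G)) {Y Z : Rep.{0} k (N ⋊[φ] G)}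
    (e : Y ⟶ Z) : normalHom X Y ⟶ normalHom X Z :=
  Rep.ofHom
    { (LinearMap.llcomp k X Y Z e.hom.toLinearMap).restrict
        (p := normalEquivariant X Y) (q := normalEquivariant X Z) fun f hf l x => by
          change e.hom (f (X.ρ (inl l) x)) = Z.ρ (inl l) (e.hom (f x))
          rw [hf, Rep.hom_comm_apply] with
      isIntertwining' := fun g => by
        ext f x
        exact Rep.hom_comm_apply e (inr g) (f.1 (X.ρ (inr g⁻¹) x)) }

/-- An `N`-equivariant linear map is a morphism of the restricted representations, so projectivity
over `N` lifts it. No equivariance under `G` is asked of the lift. -/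
theorem normalHomMap_surjective (X : Rep.{0} k (N ⋊[φ] G)) [Projective (Rep.res inl X)]
    {Y Z : Rep.{0} k (N ⋊[φ] G)} (e : Y ⟶ Z) (he : Function.Surjective e.hom) :
    Function.Surjective (normalHomMap X e).hom := by
  intro (f : normalEquivariant X Z)
  let e' : Rep.res inl Y ⟶ Rep.res inl Z := (Rep.resFunctor inl).map e
  have : Epi e' := (Rep.epi_iff_surjective e').2 he
  let f' : Rep.res inl X ⟶ Rep.res inl Z :=
    Rep.ofHom ⟨f.1, fun l => LinearMap.ext fun x => f.2 l x⟩
  let h := Projective.factorThru f' e'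
  have hh : h ≫ e' = f' := Projective.factorThru_comp f' e'
  refine ⟨(⟨h.hom.toLinearMap, fun l x => Rep.hom_comm_apply h l x⟩ : normalEquivariant X Y), ?_⟩
  refine Subtype.ext (LinearMap.ext fun x => ?_)
  exact congr($(hh).hom x)

/-- The tensor product of a representation of `G` and a representation of `N ⋊ G`. -/
noncomputable def inflTensor (P : Rep.{0} k G) (K : Rep.{0} k (N ⋊[φ] G)) :
    Rep.{0} k (N ⋊[φ] G) :=
  Rep.of (X := P ⊗[k] K) (Representation.tprod (P.ρ.comp rightHom) K.ρ)

theorem inflTensor_ρ_tmul (P : Rep.{0} k G) (K : Rep.{0} k (N ⋊[φ] G)) (γ : N ⋊[φ] G) (p : P)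
    (x : K) : (inflTensor P K).ρ γ (p ⊗ₜ[k] x) = P.ρ γ.right p ⊗ₜ[k] K.ρ γ x :=
  rfl

/-- The linear equivalence between the morphisms `P ⊗ K ⟶ X` over `N ⋊ G` and the morphisms
`P ⟶ Hom_N(K, X)` over `G`. -/
noncomputable def curryEquiv (P : Rep.{0} k G) (K X : Rep.{0} k (N ⋊[φ] G)) :
    (inflTensor P K ⟶ X) ≃ₗ[k] (P ⟶ normalHom K X) where
  toFun F := Rep.ofHom
    { toFun := fun p => (⟨F.hom.toLinearMap ∘ₗ TensorProduct.mk k P K p, fun l x => by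
        have := Rep.hom_comm_apply F (inl l) (p ⊗ₜ[k] x : P ⊗[k] K)
        rw [inflTensor_ρ_tmul, right_inl, map_one, Module.End.one_apply] at this
        exact this⟩ : normalEquivariant K X)
      map_add' := fun p q => by
        refine Subtype.ext (LinearMap.ext fun x => ?_)
        change F.hom ((p + q) ⊗ₜ[k] x : P ⊗[k] K) =
          F.hom (p ⊗ₜ[k] x : P ⊗[k] K) + F.hom (q ⊗ₜ[k] x : P ⊗[k] K)
        rw [TensorProduct.add_tmul]
        exact map_add F.hom.toLinearMap _ _
      map_smul' := fun r p => by
        refine Subtype.ext (LinearMap.ext fun x => ?_)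
        exact map_smul F.hom.toLinearMap r (p ⊗ₜ[k] x : P ⊗[k] K)
      isIntertwining' := fun g => LinearMap.ext fun p => by
        refine Subtype.ext (LinearMap.ext fun x => ?_)
        have := Rep.hom_comm_apply F (inr g) (p ⊗ₜ[k] (K.ρ (inr g⁻¹) x) : P ⊗[k] K)
        rw [inflTensor_ρ_tmul] at this
        change F.hom (P.ρ g p ⊗ₜ[k] x : P ⊗[k] K) =
          X.ρ (inr g) (F.hom (p ⊗ₜ[k] (K.ρ (inr g⁻¹) x) : P ⊗[k] K))
        rw [← this]
        simp }
  invFun f := Rep.ofHom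
    { TensorProduct.lift ((normalEquivariant K X).subtype ∘ₗ f.hom.toLinearMap) with
      isIntertwining' := fun γ => by
        refine TensorProduct.ext' fun p x => ?_
        -- Equivariance is checked on the two factors: under `inr g` it is equivariance of `f`
        -- itself, under `inl l` it is the condition defining the values of `f`.
        obtain ⟨l, g, rfl⟩ : ∃ l g, γ = inl l * inr g :=
          ⟨γ.left, γ.right, (inl_left_mul_inr_right γ).symm⟩
        have h1 : f.hom (P.ρ g p) = (normalHom K X).ρ g (f.hom p) := Rep.hom_comm_apply f g p
        change (f.hom (P.ρ (inl l * inr g : N ⋊[φ] G).right p)).1 (K.ρ (inl l * inr g) x) =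
          X.ρ (inl l * inr g) ((f.hom p).1 x)
        rw [mul_right, right_inl, right_inr, one_mul, h1, map_mul, map_mul, Module.End.mul_apply,
          Module.End.mul_apply, ((normalHom K X).ρ g (f.hom p)).2]
        refine congrArg _ ((normalHom_ρ_apply K X g (f.hom p) (K.ρ (inr g) x)).trans ?_)
        simp }
  left_inv F := Rep.hom_injective <| DFunLike.ext _ _ fun t => by
    refine LinearMap.congr_fun (f := TensorProduct.lift _) (g := F.hom.toLinearMap)
      (TensorProduct.ext' fun p x => ?_) t
    rfl
  right_inv f := Rep.hom_injective <| DFunLike.ext _ _ fun p => by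
    refine Subtype.ext (LinearMap.ext fun x => ?_)
    rfl
  map_add' _ _ := rfl
  map_smul' _ _ := rfl

/-- By `curryEquiv`, `Hom(P ⊗ K, -)` is `Hom_G(P, Hom_N(K, -))`, a composite of two functors that
preserve surjections. -/
theorem projective_inflTensor (P : Rep.{0} k G) [Projective P] (K : Rep.{0} k (N ⋊[φ] G))
    [Projective (Rep.res inl K)] : Projective (inflTensor P K) where
  factors {X Y} f e _ := by
    have : Epi (normalHomMap K e) := (Rep.epi_iff_surjective _).2
      (normalHomMap_surjective K e ((Rep.epi_iff_surjective e).1 inferInstance))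
    refine ⟨(curryEquiv P K _).symm
      (Projective.factorThru (curryEquiv P K _ f) (normalHomMap K e)), ?_⟩
    apply (curryEquiv P K _).injective
    refine Eq.trans ?_ (Projective.factorThru_comp (curryEquiv P K _ f) (normalHomMap K e))
    rfl

end NormalHom


/-! ### The resolution of a semidirect product -/

section TotalResolution

open SemidirectProduct
open Finset.HasAntidiagonal (antidiagonal)
open scoped TensorProduct

variable {k : Type} [CommRing k] {N G : Type} [Group N] [Group G] {φ : G →* MulAut N}

variable (k φ) in
/-- A resolution of the trivial module by representations of `N ⋊ G` that are projective over
`N`. -/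
structure EquivariantResolution where
  /-- The underlying complex. -/
  complex : ChainComplex (Rep.{0} k (N ⋊[φ] G)) ℕ
  /-- The augmentation. -/
  ε : complex.X 0 ⟶ Rep.trivial k (N ⋊[φ] G) k
  projective : ∀ n, Projective (Rep.res inl (complex.X n))
  surjective : Function.Surjective ε.hom
  exact_zero : Function.Exact (complex.d 1 0).hom ε.hom
  exact : ∀ n, Function.Exact (complex.d (n + 2) (n + 1)).hom (complex.d (n + 1) n).hom

theorem Rep.d_d_apply {H : Type} [Group H] (C : ChainComplex (Rep.{0} k H) ℕ) (i j l : ℕ)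
    (x : C.X i) : (C.d j l).hom ((C.d i j).hom x) = 0 :=
  congr($(C.d_comp_d i j l).hom x)

/-- The family of the tensor products of the terms of two complexes. -/
abbrev TensorFamily (P : ChainComplex (Rep.{0} k G) ℕ)
    (C : ChainComplex (Rep.{0} k (N ⋊[φ] G)) ℕ) (i j : ℕ) : Type :=
  P.X i ⊗[k] C.X j

variable (P : ChainComplex (Rep.{0} k G) ℕ) (C : ChainComplex (Rep.{0} k (N ⋊[φ] G)) ℕ)

/-- The first differential of the tensor product. -/
noncomputable abbrev tensorD₁ (i j : ℕ) : TensorFamily P C (i + 1) j →ₗ[k] TensorFamily P C i j :=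
  (P.d (i + 1) i).hom.toLinearMap.rTensor (C.X j)

/-- The second differential of the tensor product. -/
noncomputable abbrev tensorD₂ (i j : ℕ) : TensorFamily P C i (j + 1) →ₗ[k] TensorFamily P C i j :=
  (C.d (j + 1) j).hom.toLinearMap.lTensor (P.X i)

theorem tensorD₁_tensorD₁ (i j : ℕ) (x : TensorFamily P C (i + 2) j) :
    tensorD₁ P C i j (tensorD₁ P C (i + 1) j x) = 0 := by
  rw [tensorD₁, tensorD₁, ← LinearMap.comp_apply, ← LinearMap.rTensor_comp]
  have : (P.d (i + 1) i).hom.toLinearMap ∘ₗ (P.d (i + 1 + 1) (i + 1)).hom.toLinearMap = 0 :=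
    LinearMap.ext fun x => Rep.d_d_apply P _ _ _ x
  rw [this, LinearMap.rTensor_zero, LinearMap.zero_apply]

theorem tensorD₂_tensorD₂ (i j : ℕ) (x : TensorFamily P C i (j + 2)) :
    tensorD₂ P C i j (tensorD₂ P C i (j + 1) x) = 0 := by
  rw [tensorD₂, tensorD₂, ← LinearMap.comp_apply, ← LinearMap.lTensor_comp]
  have : (C.d (j + 1) j).hom.toLinearMap ∘ₗ (C.d (j + 1 + 1) (j + 1)).hom.toLinearMap = 0 :=
    LinearMap.ext fun x => Rep.d_d_apply C _ _ _ x
  rw [this, LinearMap.lTensor_zero, LinearMap.zero_apply]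

theorem tensorD₁_tensorD₂ (i j : ℕ) (x : TensorFamily P C (i + 1) (j + 1)) :
    tensorD₁ P C i j (tensorD₂ P C (i + 1) j x) = tensorD₂ P C i j (tensorD₁ P C i (j + 1) x) := by
  rw [tensorD₁, tensorD₂, tensorD₁, tensorD₂, ← LinearMap.comp_apply, ← LinearMap.comp_apply,
    LinearMap.rTensor_comp_lTensor, LinearMap.lTensor_comp_rTensor]

/-- The terms of the total complex of the tensor product, as representations of `N ⋊ G`. -/
noncomputable def totalRep (n : ℕ) : Rep.{0} k (N ⋊[φ] G) :=
  Rep.of (X := Tot (TensorFamily P C) n)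
    { toFun := fun γ => LinearMap.pi fun p =>
        (inflTensor (P.X p.1.1) (C.X p.1.2)).ρ γ ∘ₗ LinearMap.proj p
      map_one' := by
        refine LinearMap.ext fun q => funext fun p => ?_
        exact LinearMap.congr_fun (map_one (inflTensor (P.X p.1.1) (C.X p.1.2)).ρ) (q p)
      map_mul' := fun γ γ' => by
        refine LinearMap.ext fun q => funext fun p => ?_
        exact LinearMap.congr_fun (map_mul (inflTensor (P.X p.1.1) (C.X p.1.2)).ρ γ γ') (q p) }

/-- The projection of the total complex to a summand. -/
noncomputable def totalProj {n : ℕ} (p : antidiagonal n) :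
    totalRep P C n ⟶ inflTensor (P.X p.1.1) (C.X p.1.2) :=
  Rep.ofHom
    { (LinearMap.proj p : Tot (TensorFamily P C) n →ₗ[k] TensorFamily P C p.1.1 p.1.2) with
      isIntertwining' := fun _ => rfl }

/-- The inclusion of a summand of the total complex. -/
noncomputable def totalIncl {n : ℕ} (p : antidiagonal n) :
    inflTensor (P.X p.1.1) (C.X p.1.2) ⟶ totalRep P C n :=
  Rep.ofHom
    { (LinearMap.single k (fun p : antidiagonal n => TensorFamily P C p.1.1 p.1.2) p) with
      isIntertwining' := fun γ => LinearMap.ext fun x => funext fun p' =>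
        (Pi.apply_single (M := fun p : antidiagonal n => TensorFamily P C p.1.1 p.1.2)
          (N := fun p : antidiagonal n => TensorFamily P C p.1.1 p.1.2)
          (fun p => (inflTensor (P.X p.1.1) (C.X p.1.2)).ρ γ) (fun _ => map_zero _) p x p').symm }

theorem total_hom_ext {n : ℕ} {X : Rep.{0} k (N ⋊[φ] G)} {f g : totalRep P C n ⟶ X}
    (h : ∀ p, totalIncl P C p ≫ f = totalIncl P C p ≫ g) : f = g := by
  apply Rep.hom_injective
  refine DFunLike.ext _ _ fun q => ?_
  refine LinearMap.congr_fun (f := f.hom.toLinearMap) (g := g.hom.toLinearMap) ?_ q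
  refine LinearMap.pi_ext fun p x => ?_
  exact congr($(h p).hom x)

/-- The morphism out of the total complex given by morphisms out of the summands. -/
noncomputable def totalDesc {n : ℕ} {X : Rep.{0} k (N ⋊[φ] G)}
    (f : ∀ p : antidiagonal n, inflTensor (P.X p.1.1) (C.X p.1.2) ⟶ X) : totalRep P C n ⟶ X :=
  ∑ p, totalProj P C p ≫ f p

theorem totalIncl_totalProj_same {n : ℕ} (p : antidiagonal n) :
    totalIncl P C p ≫ totalProj P C p = 𝟙 _ := by
  apply Rep.hom_injective
  refine DFunLike.ext _ _ fun x => ?_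
  exact Pi.single_eq_same (M := fun p : antidiagonal n => TensorFamily P C p.1.1 p.1.2) p x

theorem totalIncl_totalProj_ne {n : ℕ} {p p' : antidiagonal n} (h : p' ≠ p) :
    totalIncl P C p ≫ totalProj P C p' = 0 := by
  apply Rep.hom_injective
  refine DFunLike.ext _ _ fun x => ?_
  exact Pi.single_eq_of_ne (M := fun p : antidiagonal n => TensorFamily P C p.1.1 p.1.2) h x

theorem totalIncl_totalDesc {n : ℕ} {X : Rep.{0} k (N ⋊[φ] G)}
    (f : ∀ p : antidiagonal n, inflTensor (P.X p.1.1) (C.X p.1.2) ⟶ X) (p : antidiagonal n) :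
    totalIncl P C p ≫ totalDesc P C f = f p := by
  rw [totalDesc, Preadditive.comp_sum, Finset.sum_eq_single p]
  · rw [← Category.assoc, totalIncl_totalProj_same, Category.id_comp]
  · intro p' _ h
    rw [← Category.assoc, totalIncl_totalProj_ne P C h, Limits.zero_comp]
  · simp

theorem projective_totalRep [∀ i, Projective (P.X i)]
    (hC : ∀ j, Projective (Rep.res inl (C.X j))) (n : ℕ) : Projective (totalRep P C n) where
  factors {X Y} f e _ := by
    have := fun i j => projective_inflTensor (P.X i) (C.X j)
    refine ⟨totalDesc P C fun p => Projective.factorThru (totalIncl P C p ≫ f) e, ?_⟩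
    refine total_hom_ext P C fun p => ?_
    rw [← Category.assoc, totalIncl_totalDesc, Projective.factorThru_comp]

/-- The differential of the total complex of the tensor product. -/
noncomputable def totalRepD (n : ℕ) : totalRep P C (n + 1) ⟶ totalRep P C n :=
  Rep.ofHom
      { totD (tensorD₁ P C) (tensorD₂ P C) n with
        isIntertwining' := fun γ => LinearMap.ext fun q =>
          (totD_naturality (fun i j => (inflTensor (P.X i) (C.X j)).ρ γ)
            (fun i j x => by
              refine LinearMap.congr_fun (f := (inflTensor (P.X i) (C.X j)).ρ γ ∘ₗ tensorD₁ P C i j)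
                (g := tensorD₁ P C i j ∘ₗ (inflTensor (P.X (i + 1)) (C.X j)).ρ γ)
                (TensorProduct.ext' fun p x => ?_) x
              exact congrArg (· ⊗ₜ[k] _) (Rep.hom_comm_apply (P.d (i + 1) i) γ.right p).symm)
            (fun i j x => by
              refine LinearMap.congr_fun (f := (inflTensor (P.X i) (C.X j)).ρ γ ∘ₗ tensorD₂ P C i j)
                (g := tensorD₂ P C i j ∘ₗ (inflTensor (P.X i) (C.X (j + 1))).ρ γ)
                (TensorProduct.ext' fun p x => ?_) x
              exact congrArg (_ ⊗ₜ[k] ·) (Rep.hom_comm_apply (C.d (j + 1) j) γ x).symm)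
            n q).symm }

/-- The total complex of the tensor product. -/
noncomputable def totalComplex : ChainComplex (Rep.{0} k (N ⋊[φ] G)) ℕ :=
  ChainComplex.of (totalRep P C) (totalRepD P C)
    (fun n => by
      apply Rep.hom_injective
      refine DFunLike.ext _ _ fun q => ?_
      exact totD_totD (tensorD₁_tensorD₁ P C) (tensorD₂_tensorD₂ P C) (tensorD₁_tensorD₂ P C) n q)

theorem totalComplex_d (n : ℕ) : (totalComplex P C).d (n + 1) n = totalRepD P C n :=
  ChainComplex.of_d (totalRep P C) (totalRepD P C) n

theorem totalComplex_d_apply (n : ℕ) (q : Tot (TensorFamily P C) (n + 1)) :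
    ((totalComplex P C).d (n + 1) n).hom q = totD (tensorD₁ P C) (tensorD₂ P C) n q := by
  rw [totalComplex_d]
  rfl

variable {P} in
/-- The augmentation of the rows of the tensor product. -/
noncomputable def LinearContraction.rowAug (c : LinearContraction P) (j : ℕ) :
    TensorFamily P C 0 j →ₗ[k] C.X j :=
  (TensorProduct.lid k (C.X j)).toLinearMap ∘ₗ
    (c.e.hom.toLinearMap : P.X 0 →ₗ[k] k).rTensor (C.X j)

variable {P} in
/-- A contraction of the first factor contracts the rows of the tensor product. -/
noncomputable def LinearContraction.rows (c : LinearContraction P) :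
    RowContraction (tensorD₁ P C) (tensorD₂ P C) (K := fun j => C.X j)
      (fun j => (C.d (j + 1) j).hom.toLinearMap) where
  s i j := (c.s i).rTensor (C.X j)
  e := c.rowAug C
  η j := TensorProduct.mk k (P.X 0) (C.X j) c.u
  s_d₂ i j x := LinearMap.congr_fun
    (f := (c.s i).rTensor (C.X j) ∘ₗ tensorD₂ P C i j)
    (g := tensorD₂ P C (i + 1) j ∘ₗ (c.s i).rTensor (C.X (j + 1)))
    (TensorProduct.ext' fun _ _ => rfl) x
  e_d₁ j x := LinearMap.congr_fun
    (f := c.rowAug C j ∘ₗ tensorD₁ P C 0 j)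
    (g := 0)
    (TensorProduct.ext' fun p x => by
      change (c.e.hom ((P.d 1 0).hom p) : k) • x = 0
      rw [c.e_d]
      exact zero_smul k x) x
  e_d₂ j x := LinearMap.congr_fun
    (f := c.rowAug C j ∘ₗ tensorD₂ P C 0 j)
    (g := (C.d (j + 1) j).hom.toLinearMap ∘ₗ c.rowAug C (j + 1))
    (TensorProduct.ext' fun p x => (map_smul (C.d (j + 1) j).hom.toLinearMap (c.e.hom p) x).symm) x
  η_d j x := rfl
  e_η j x := by
    change (c.e.hom c.u : k) • x = x
    rw [c.e_u]
    exact one_smul k x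
  s_zero j x := LinearMap.congr_fun
    (f := tensorD₁ P C 0 j ∘ₗ (c.s 0).rTensor (C.X j) + TensorProduct.mk k (P.X 0) (C.X j) c.u ∘ₗ
      c.rowAug C j)
    (g := LinearMap.id)
    (TensorProduct.ext' fun p x => by
      change (P.d 1 0).hom (c.s 0 p) ⊗ₜ[k] x + c.u ⊗ₜ[k] ((c.e.hom p : k) • x) = p ⊗ₜ[k] x
      rw [TensorProduct.tmul_smul]
      change _ + ((c.e.hom p : k) • c.u) ⊗ₜ[k] x = _
      rw [← TensorProduct.add_tmul, c.s_zero]) x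
  s_succ i j x := LinearMap.congr_fun
    (f := tensorD₁ P C (i + 1) j ∘ₗ (c.s (i + 1)).rTensor (C.X j) +
      (c.s i).rTensor (C.X j) ∘ₗ tensorD₁ P C i j)
    (g := LinearMap.id)
    (TensorProduct.ext' fun p x => by
      change (P.d (i + 2) (i + 1)).hom (c.s (i + 1) p) ⊗ₜ[k] x +
        c.s i ((P.d (i + 1) i).hom p) ⊗ₜ[k] x = p ⊗ₜ[k] x
      rw [← TensorProduct.add_tmul, c.s_succ]) x

variable {P} in
/-- The resolution of the trivial module over `N ⋊ G` that is the tensor product of a resolution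
over `G` and an equivariant resolution over `N`. -/
noncomputable def totalResolution (hP : ∀ i, Projective (P.X i)) (c : LinearContraction P)
    (K : EquivariantResolution k φ) : ProjectiveResolution (Rep.trivial k (N ⋊[φ] G) k) :=
  resolutionOfExact (totalComplex P K.complex)
    (fun n => projective_totalRep P K.complex K.projective n)
    (Rep.ofHom (σ := Representation.trivial k (N ⋊[φ] G) k)
      { K.ε.hom.toLinearMap ∘ₗ (c.rows K.complex).e 0 ∘ₗ
          (LinearMap.proj (leftEnd 0) : Tot (TensorFamily P K.complex) 0 →ₗ[k] _) with
        isIntertwining' := fun γ => by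
          have : ∀ x : TensorFamily P K.complex 0 0, K.ε.hom ((c.rows K.complex).e 0
              ((inflTensor (P.X 0) (K.complex.X 0)).ρ γ x)) =
              K.ε.hom ((c.rows K.complex).e 0 x) := fun x =>
            LinearMap.congr_fun (f := K.ε.hom.toLinearMap ∘ₗ (c.rows K.complex).e 0 ∘ₗ
              (inflTensor (P.X 0) (K.complex.X 0)).ρ γ)
              (g := K.ε.hom.toLinearMap ∘ₗ (c.rows K.complex).e 0)
              (TensorProduct.ext' fun p x => by
                change K.ε.hom ((c.e.hom (P.X 0 |>.ρ γ.right p) : k) • (K.complex.X 0).ρ γ x) =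
                  K.ε.hom ((c.e.hom p : k) • x)
                rw [Rep.hom_comm_apply, map_smul, map_smul, Rep.hom_comm_apply]
                rfl) x
          exact LinearMap.ext fun q => this (q (leftEnd 0)) })
    ((c.rows K.complex).surjective_aug (ε := K.ε.hom.toLinearMap) K.surjective)
    (by
      have h : ⇑((totalComplex P K.complex).d 1 0).hom =
        totD (tensorD₁ P K.complex) (tensorD₂ P K.complex) 0 :=
          funext (totalComplex_d_apply P K.complex 0)
      rw [h]
      exact (c.rows K.complex).exact_zero (ε := K.ε.hom.toLinearMap) K.exact_zero)
    (fun n => by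
      have h : ∀ n, ⇑((totalComplex P K.complex).d (n + 1) n).hom =
        totD (tensorD₁ P K.complex) (tensorD₂ P K.complex) n :=
          fun n => funext (totalComplex_d_apply P K.complex n)
      rw [h, h]
      exact (c.rows K.complex).exact_succ (n := n) (tensorD₁_tensorD₁ P K.complex)
        (tensorD₂_tensorD₂ P K.complex) (tensorD₁_tensorD₂ P K.complex) (K.exact n))

end TotalResolution


/-! ### The cohomology of a semidirect product -/

section Cohomology

open SemidirectProduct
open Finset.HasAntidiagonal (antidiagonal)
open scoped TensorProduct

variable {k : Type} [CommRing k] {N G : Type} [Group N] [Group G] {φ : G →* MulAut N}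

/-- The differential of the resolution is killed by all functionals that are invariant under
`N`. -/
def EquivariantResolution.IsMinimal (K : EquivariantResolution k φ) : Prop :=
  ∀ (n : ℕ) (f : normalEquivariant (K.complex.X n) (Rep.trivial k (N ⋊[φ] G) k))
    (y : K.complex.X (n + 1)), f.1 ((K.complex.d (n + 1) n).hom y) = 0

theorem exists_linearYonedaObj_d_succ {H : Type} [Group H] {C : ChainComplex (Rep.{0} k H) ℕ}
    {A : Rep.{0} k H} {n : ℕ} {z : C.X (n + 1) ⟶ A} :
    (∃ i y, ((C.linearYonedaObj k A).d i (n + 1)).hom y = z) ↔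
      ∃ y : C.X n ⟶ A, C.d (n + 1) n ≫ y = z := by
  constructor
  · rintro ⟨i, y, rfl⟩
    by_cases h : i = n
    · subst h
      exact ⟨y, rfl⟩
    · refine ⟨0, ?_⟩
      rw [Limits.comp_zero, (C.linearYonedaObj k A).shape _ _ (by simpa using h)]
      rfl
  · rintro ⟨y, rfl⟩
    exact ⟨n, y, rfl⟩

theorem exists_linearYonedaObj_d_zero {H : Type} [Group H] {C : ChainComplex (Rep.{0} k H) ℕ}
    {A : Rep.{0} k H} {z : C.X 0 ⟶ A} :
    (∃ i y, ((C.linearYonedaObj k A).d i 0).hom y = z) ↔ z = 0 := by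
  constructor
  · rintro ⟨i, y, rfl⟩
    rw [(C.linearYonedaObj k A).shape _ _ (by simp)]
    rfl
  · rintro rfl
    exact ⟨0, 0, map_zero _⟩

variable (P : ChainComplex (Rep.{0} k G) ℕ) (C : ChainComplex (Rep.{0} k (N ⋊[φ] G)) ℕ)
  {X : Rep.{0} k (N ⋊[φ] G)}

/-- The components of a morphism out of the total complex. -/
noncomputable def component {n : ℕ} (p : antidiagonal n) :
    (totalRep P C n ⟶ X) →ₗ[k] (P.X p.1.1 ⟶ normalHom (C.X p.1.2) X) :=
  (curryEquiv (P.X p.1.1) (C.X p.1.2) X).toLinearMap ∘ₗ Linear.leftComp k X (totalIncl P C p)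

theorem component_ext {n : ℕ} {F F' : totalRep P C n ⟶ X}
    (h : ∀ p, component P C p F = component P C p F') : F = F' :=
  total_hom_ext P C fun p => (curryEquiv (P.X p.1.1) (C.X p.1.2) X).injective (h p)

/-- The morphism out of the total complex with given components. -/
noncomputable def ofComponents {n : ℕ}
    (f : ∀ p : antidiagonal n, P.X p.1.1 ⟶ normalHom (C.X p.1.2) X) : totalRep P C n ⟶ X :=
  totalDesc P C fun p => (curryEquiv (P.X p.1.1) (C.X p.1.2) X).symm (f p)

theorem component_ofComponents {n : ℕ}
    (f : ∀ p : antidiagonal n, P.X p.1.1 ⟶ normalHom (C.X p.1.2) X) (p : antidiagonal n) :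
    component P C p (ofComponents P C f) = f p := by
  change curryEquiv _ _ _ (totalIncl P C p ≫ totalDesc P C _) = f p
  rw [totalIncl_totalDesc, LinearEquiv.apply_symm_apply]

variable (K : EquivariantResolution k φ)

/-- Fixing the factor from `P` turns `F` into an `N`-invariant functional on a term of `K`, which
vanishes on boundaries by minimality. -/
theorem EquivariantResolution.IsMinimal.map_single {K : EquivariantResolution k φ}
    (hK : K.IsMinimal) {n : ℕ}
    (F : totalRep P K.complex n ⟶ Rep.trivial k (N ⋊[φ] G) k) (p : antidiagonal n)
    (x : TensorFamily P K.complex p.1.1 (p.1.2 + 1)) :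
    F.hom.toLinearMap (Pi.single p (tensorD₂ P K.complex p.1.1 p.1.2 x) :
      Tot (TensorFamily P K.complex) n) = 0 := by
  refine LinearMap.congr_fun (f := F.hom.toLinearMap ∘ₗ
    LinearMap.single k (fun p : antidiagonal n => TensorFamily P K.complex p.1.1 p.1.2) p ∘ₗ
      tensorD₂ P K.complex p.1.1 p.1.2) (g := 0) (TensorProduct.ext' fun x y => ?_) x
  exact hK p.1.2 ((component P K.complex p F).hom x) y

/-- Together with `component_d_leftEnd` this says that, componentwise, the cochain complex of the
total complex has only the differential of `P`: it is the product over `j` of the complexes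
`Hom_G(P, Hom_N(K_j, k))`, shifted by `j`. -/
theorem component_d_stepLeft {K : EquivariantResolution k φ} (hK : K.IsMinimal) {n : ℕ}
    (F : totalRep P K.complex n ⟶ Rep.trivial k (N ⋊[φ] G) k) (p : antidiagonal n) :
    component P K.complex (stepLeft p) (totalRepD P K.complex n ≫ F) =
      P.d (p.1.1 + 1) p.1.1 ≫ component P K.complex p F := by
  apply Rep.hom_injective
  refine DFunLike.ext _ _ fun x => Subtype.ext (LinearMap.ext fun y => ?_)
  exact map_totD_single_stepLeft F.hom.toLinearMap (hK.map_single P F) p (x ⊗ₜ[k] y)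

theorem component_d_leftEnd {K : EquivariantResolution k φ} (hK : K.IsMinimal) {n : ℕ}
    (F : totalRep P K.complex n ⟶ Rep.trivial k (N ⋊[φ] G) k) :
    component P K.complex (leftEnd (n + 1)) (totalRepD P K.complex n ≫ F) = 0 := by
  apply Rep.hom_injective
  refine DFunLike.ext _ _ fun x => Subtype.ext (LinearMap.ext fun y => ?_)
  exact map_totD_single_leftEnd F.hom.toLinearMap (hK.map_single P F) (x ⊗ₜ[k] y)

/-- The class of a component of a cocycle on the total complex. -/
noncomputable def componentClass {K : EquivariantResolution k φ} (hK : K.IsMinimal) {n : ℕ}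
    (p : antidiagonal n) :
    LinearMap.ker (((totalComplex P K.complex).linearYonedaObj k
      (Rep.trivial k (N ⋊[φ] G) k)).d n (n + 1)).hom →ₗ[k]
      (P.linearYonedaObj k
        (normalHom (K.complex.X p.1.2) (Rep.trivial k (N ⋊[φ] G) k))).homology p.1.1 :=
  cohomologyClass _ p.1.1 ∘ₗ (component P K.complex p).restrict fun F hF => by
    have : totalRepD P K.complex n ≫ F = 0 := by
      rw [← totalComplex_d]
      exact hF
    change P.d (p.1.1 + 1) p.1.1 ≫ component P K.complex p F = 0
    rw [← component_d_stepLeft P hK, this, map_zero]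

/-- A coboundary has components that are coboundaries. Conversely, primitives of the components can
be chosen independently and assembled. The component at `(0, n)` has no room for a primitive, and
being a boundary there means being zero. -/
theorem component_boundary_iff {K : EquivariantResolution k φ} (hK : K.IsMinimal) {n : ℕ}
    (F : totalRep P K.complex n ⟶ Rep.trivial k (N ⋊[φ] G) k) :
    (∀ p : antidiagonal n, ∃ i y, ((P.linearYonedaObj k
        (normalHom (K.complex.X p.1.2) (Rep.trivial k (N ⋊[φ] G) k))).d i p.1.1).hom y =
        component P K.complex p F) ↔
      ∃ i y, (((totalComplex P K.complex).linearYonedaObj k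
        (Rep.trivial k (N ⋊[φ] G) k)).d i n).hom y = F := by
  rcases n with _ | n
  · refine Iff.trans ?_ (exists_linearYonedaObj_d_zero (C := totalComplex P K.complex)).symm
    constructor
    · intro h
      refine component_ext P K.complex fun p => ?_
      obtain ⟨⟨i, j⟩, hp⟩ := p
      obtain ⟨rfl, rfl⟩ : i = 0 ∧ j = 0 := by simpa using hp
      exact (exists_linearYonedaObj_d_zero.1 (h ⟨(0, 0), hp⟩)).trans (map_zero _).symm
    · rintro rfl p
      exact ⟨0, 0, (map_zero _).trans (map_zero _).symm⟩
  · refine Iff.trans ?_ (exists_linearYonedaObj_d_succ (C := totalComplex P K.complex)).symm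
    rw [totalComplex_d]
    constructor
    · intro h
      have h' : ∀ p : antidiagonal n, ∃ y, P.d (p.1.1 + 1) p.1.1 ≫ y =
          component P K.complex (stepLeft p) F := fun p =>
        exists_linearYonedaObj_d_succ.1 (h (stepLeft p))
      choose y hy using h'
      refine ⟨ofComponents P K.complex y, component_ext P K.complex fun p => ?_⟩
      obtain rfl | ⟨p, rfl⟩ := eq_leftEnd_or_stepLeft p
      · exact (component_d_leftEnd P hK _).trans
          (exists_linearYonedaObj_d_zero.1 (h (leftEnd (n + 1)))).symm
      · exact (component_d_stepLeft P hK _ p).trans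
          ((congrArg _ (component_ofComponents P K.complex y p)).trans (hy p))
    · rintro ⟨E, rfl⟩ p
      obtain rfl | ⟨p, rfl⟩ := eq_leftEnd_or_stepLeft p
      · exact ⟨0, 0, (map_zero _).trans (component_d_leftEnd P hK _).symm⟩
      · exact ⟨_, component P K.complex p E, (component_d_stepLeft P hK _ p).symm⟩

theorem componentClass_eq_zero_iff {K : EquivariantResolution k φ} (hK : K.IsMinimal) {n : ℕ}
    (F : LinearMap.ker (((totalComplex P K.complex).linearYonedaObj k
      (Rep.trivial k (N ⋊[φ] G) k)).d n (n + 1)).hom) :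
    (∀ p : antidiagonal n, componentClass P hK p F = 0) ↔ cohomologyClass _ n F = 0 :=
  (forall_congr' fun _ => cohomologyClass_eq_zero_iff _ _ _).trans
    ((component_boundary_iff P hK F.1).trans (cohomologyClass_eq_zero_iff _ n F).symm)

theorem ofComponents_cocycle {K : EquivariantResolution k φ} (hK : K.IsMinimal) {n : ℕ}
    (f : ∀ p : antidiagonal n, P.X p.1.1 ⟶
      normalHom (K.complex.X p.1.2) (Rep.trivial k (N ⋊[φ] G) k))
    (hf : ∀ p, P.d (p.1.1 + 1) p.1.1 ≫ f p = 0) :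
    (totalComplex P K.complex).d (n + 1) n ≫ ofComponents P K.complex f = 0 := by
  rw [totalComplex_d]
  refine component_ext P K.complex fun p => ?_
  obtain rfl | ⟨p, rfl⟩ := eq_leftEnd_or_stepLeft p
  · exact (component_d_leftEnd P hK _).trans (map_zero _).symm
  · exact (component_d_stepLeft P hK _ p).trans
      (((congrArg _ (component_ofComponents P K.complex f p)).trans (hf p)).trans
        (map_zero _).symm)

theorem componentClass_surjective {K : EquivariantResolution k φ} (hK : K.IsMinimal) {n : ℕ} :
    Function.Surjective (LinearMap.pi fun p : antidiagonal n => componentClass P hK p) := by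
  intro c
  choose f hf using fun p => cohomologyClass_surjective _ _ (c p)
  refine ⟨⟨ofComponents P K.complex fun p => (f p).1,
    ofComponents_cocycle P hK _ fun p => (f p).2⟩, funext fun p => ?_⟩
  refine Eq.trans ?_ (hf p)
  exact congrArg (cohomologyClass _ p.1.1)
    (Subtype.ext (component_ofComponents P K.complex (fun p => (f p).1) p))

/-- The cohomology of the total complex splits. -/
noncomputable def totalHomologyEquiv {K : EquivariantResolution k φ} (hK : K.IsMinimal) (n : ℕ) :
    ((totalComplex P K.complex).linearYonedaObj k (Rep.trivial k (N ⋊[φ] G) k)).homology n ≃ₗ[k]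
      ∀ p : antidiagonal n, (P.linearYonedaObj k
        (normalHom (K.complex.X p.1.2) (Rep.trivial k (N ⋊[φ] G) k))).homology p.1.1 :=
  equivOfKerEq (cohomologyClass _ n) (LinearMap.pi fun p => componentClass P hK p)
    (cohomologyClass_surjective _ n) (componentClass_surjective P hK) fun F =>
      (componentClass_eq_zero_iff P hK F).symm.trans funext_iff.symm

/-- The cohomology of a semidirect product `N ⋊ G`, in terms of a minimal equivariant resolution
over `N`. -/
theorem nonempty_groupCohomology_equiv {K : EquivariantResolution k φ} (hK : K.IsMinimal)
    (n : ℕ) : Nonempty (groupCohomology (Rep.trivial k (N ⋊[φ] G) k) n ≃ₗ[k]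
      ∀ p : antidiagonal n, groupCohomology
        (normalHom (K.complex.X p.1.2) (Rep.trivial k (N ⋊[φ] G) k)) p.1.1) :=
  ⟨(groupCohomologyIso _ n (totalResolution (Rep.standardComplex.x_projective k G)
      standardContraction K)).toLinearEquiv ≪≫ₗ
    totalHomologyEquiv (Rep.standardComplex k G) hK n ≪≫ₗ
    LinearEquiv.piCongrRight fun p =>
      (groupCohomologyIso _ p.1.1 (Rep.standardResolution k G)).toLinearEquiv.symm⟩

end Cohomology


/-! ### The cohomology of the normal subgroup -/

section NormalCohomology

open SemidirectProduct

variable {k : Type} [CommRing k] {N G : Type} [Group N] [Group G] {φ : G →* MulAut N}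

/-- Of the two terms of the homotopy formula for `f - g`, the one that ends with the differential of
`D` is annihilated by the cocycle `c`; the other is the coboundary. -/
theorem homotopy_comp_boundary {H : Type} [Group H] {C D : ChainComplex (Rep.{0} k H) ℕ}
    {f g : C ⟶ D} (h : Homotopy f g) {A : Rep.{0} k H} (j : ℕ) (c : D.X j ⟶ A)
    (hc : D.d (j + 1) j ≫ c = 0) :
    ∃ i y, ((C.linearYonedaObj k A).d i j).hom y = f.f j ≫ c - g.f j ≫ c := by
  rcases j with _ | j
  · refine exists_linearYonedaObj_d_zero.2 ?_
    rw [h.comm, Homotopy.dNext_zero_chainComplex, Homotopy.prevD_chainComplex, zero_add,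
      Preadditive.add_comp, Category.assoc, hc, Limits.comp_zero, zero_add, sub_self]
  · refine exists_linearYonedaObj_d_succ.2 ⟨h.hom j (j + 1) ≫ c, ?_⟩
    rw [h.comm, Homotopy.dNext_succ_chainComplex, Homotopy.prevD_chainComplex,
      Preadditive.add_comp, Preadditive.add_comp, Category.assoc, Category.assoc, hc,
      Limits.comp_zero, add_zero, add_sub_cancel_right]

namespace EquivariantResolution

variable (K : EquivariantResolution k φ)

/-- The resolution over the normal subgroup. -/
noncomputable def resolution : ProjectiveResolution (Rep.trivial k N k) :=
  resolutionOfExact (((Rep.resFunctor (inl : N →* N ⋊[φ] G)).mapHomologicalComplex _).obj K.complex)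
    K.projective ((Rep.resFunctor (inl : N →* N ⋊[φ] G)).map K.ε) K.surjective K.exact_zero K.exact

/-- The functionals that are invariant under the normal subgroup, as morphisms of
representations. -/
noncomputable def functionalEquiv (j : ℕ) :
    (K.resolution.complex.X j ⟶ Rep.trivial k N k) ≃ₗ[k]
      normalEquivariant (K.complex.X j) (Rep.trivial k (N ⋊[φ] G) k) where
  toFun f := ⟨f.hom.toLinearMap, fun l x => Rep.hom_comm_apply f l x⟩
  invFun f := Rep.ofHom (ρ := (Rep.res (inl : N →* N ⋊[φ] G) (K.complex.X j)).ρ)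
    (σ := Representation.trivial k N k) ⟨f.1, fun l => LinearMap.ext fun x => f.2 l x⟩
  left_inv _ := rfl
  right_inv _ := rfl
  map_add' _ _ := rfl
  map_smul' _ _ := rfl

variable {K}

theorem IsMinimal.d_comp (hK : K.IsMinimal) {j : ℕ}
    (f : K.resolution.complex.X j ⟶ Rep.trivial k N k) :
    K.resolution.complex.d (j + 1) j ≫ f = 0 :=
  Rep.hom_injective (DFunLike.ext _ _ fun y => hK j (K.functionalEquiv j f) y)

/-- All coboundaries on a minimal resolution vanish, so cohomologous cocycles on it are equal. This
converts the homotopies below into equalities of functionals. -/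
theorem IsMinimal.eq_zero_of_boundary (hK : K.IsMinimal) {j : ℕ}
    {z : K.resolution.complex.X j ⟶ Rep.trivial k N k}
    (hz : ∃ i y, ((K.resolution.complex.linearYonedaObj k (Rep.trivial k N k)).d i j).hom y = z) :
    z = 0 := by
  rcases j with _ | j
  · exact exists_linearYonedaObj_d_zero.1 hz
  · obtain ⟨y, rfl⟩ := exists_linearYonedaObj_d_succ.1 hz
    exact hK.d_comp y

variable (K) in
/-- The comparison map from the resolution to the bar resolution. -/
noncomputable def toBar : K.resolution.complex ⟶ Rep.barComplex k N :=
  ProjectiveResolution.lift (𝟙 _) K.resolution (Rep.barResolution k N)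

variable (K) in
/-- The morphism on the bar resolution given by a cochain. -/
noncomputable def ofCochain (j : ℕ) :
    ((groupCohomology.inhomogeneousCochains (Rep.trivial k N k)).X j) ≃ₗ[k]
      ((Rep.barComplex k N).X j ⟶ Rep.trivial k N k) :=
  (Rep.freeLiftLEquiv k N (Fin j → N) (Rep.trivial k N k)).symm

theorem ofCochain_d (i j : ℕ)
    (c : (groupCohomology.inhomogeneousCochains (Rep.trivial k N k)).X i) :
    ofCochain j (((groupCohomology.inhomogeneousCochains (Rep.trivial k N k)).d i j).hom c) =
      (Rep.barComplex k N).d j i ≫ ofCochain i c :=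
  congr($((groupCohomology.inhomogeneousCochainsIso (Rep.trivial k N k)).hom.comm i j).hom c).symm

theorem ofCochain_single (j : ℕ) (c : (Fin j → N) → k) (x : Fin j → N) (y : N) (r : k) :
    (ofCochain j c).hom (Finsupp.single x (MonoidAlgebra.single y r)) = r * c x :=
  Representation.freeLift_single_single (Representation.trivial k N k) x y r c

variable (K) in
/-- The functional on the resolution given by a cochain. -/
noncomputable def functionalOfCochain (j : ℕ) :
    ((groupCohomology.inhomogeneousCochains (Rep.trivial k N k)).X j) →ₗ[k]
      normalEquivariant (K.complex.X j) (Rep.trivial k (N ⋊[φ] G) k) :=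
  (K.functionalEquiv j).toLinearMap ∘ₗ
    Linear.leftComp k (Rep.trivial k N k) (K.toBar.f j) ∘ₗ (ofCochain j).toLinearMap

variable (K) in
/-- The comparison map from the bar resolution to the resolution. -/
noncomputable def ofBar : Rep.barComplex k N ⟶ K.resolution.complex :=
  ProjectiveResolution.lift (𝟙 _) (Rep.barResolution k N) K.resolution

variable (K) in
/-- The comparison maps are inverse to each other up to homotopy. -/
noncomputable def toBarOfBar : Homotopy (K.toBar ≫ K.ofBar) (𝟙 _) :=
  (ProjectiveResolution.homotopyEquiv K.resolution (Rep.barResolution k N)).homotopyHomInvId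

variable (K) in
/-- The comparison maps are inverse to each other up to homotopy. -/
noncomputable def ofBarToBar : Homotopy (K.ofBar ≫ K.toBar) (𝟙 _) :=
  (ProjectiveResolution.homotopyEquiv K.resolution (Rep.barResolution k N)).homotopyInvHomId

/-- A functional on `K` is automatically a cocycle; pull it back to the bar resolution. Going to the
bar resolution and back is homotopic to the identity of `K`, hence recovers the functional exactly.
-/
theorem IsMinimal.functionalOfCochain_surjective (hK : K.IsMinimal) (j : ℕ) :
    Function.Surjective (K.functionalOfCochain j ∘ₗ
      (LinearMap.ker ((groupCohomology.inhomogeneousCochains (Rep.trivial k N k)).d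
        j (j + 1)).hom).subtype) := by
  intro f
  obtain ⟨f, rfl⟩ := (K.functionalEquiv j).surjective f
  obtain ⟨c, hc⟩ := (ofCochain j).surjective (K.ofBar.f j ≫ f)
  refine ⟨⟨c, ?_⟩, ?_⟩
  · rw [LinearMap.mem_ker]
    apply (ofCochain (j + 1)).injective
    rw [ofCochain_d, hc, map_zero, ← Category.assoc, ← K.ofBar.comm, Category.assoc, hK.d_comp,
      Limits.comp_zero]
  · change K.functionalEquiv j (K.toBar.f j ≫ ofCochain j c) = _
    rw [hc]
    refine congrArg _ ?_
    have := hK.eq_zero_of_boundary (homotopy_comp_boundary K.toBarOfBar j f (hK.d_comp f))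
    rw [HomologicalComplex.comp_f, HomologicalComplex.id_f, Category.id_comp, Category.assoc,
      sub_eq_zero] at this
    exact this

/-- A coboundary pulls back to a coboundary on `K`, which is zero. If a cocycle pulls back to zero
on `K`, the homotopy between the round trip and the identity of the bar resolution exhibits it as a
coboundary. -/
theorem IsMinimal.functionalOfCochain_eq_zero_iff (hK : K.IsMinimal) (j : ℕ)
    (c : LinearMap.ker ((groupCohomology.inhomogeneousCochains (Rep.trivial k N k)).d
        j (j + 1)).hom) :
    cohomologyClass _ j c = 0 ↔ K.functionalOfCochain j c.1 = 0 := by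
  rw [cohomologyClass_eq_zero_iff]
  have hc : (Rep.barComplex k N).d (j + 1) j ≫ ofCochain j c.1 = 0 := by
    rw [← ofCochain_d, LinearMap.mem_ker.1 c.2, map_zero]
  constructor
  · rintro ⟨i, y, hy⟩
    rw [← hy]
    refine (congrArg (K.functionalEquiv j) ?_).trans (map_zero _)
    change K.toBar.f j ≫ ofCochain j _ = 0
    rw [ofCochain_d, ← Category.assoc, K.toBar.comm, Category.assoc]
    exact hK.eq_zero_of_boundary ⟨i, _, rfl⟩
  · intro h
    have h0 : K.toBar.f j ≫ ofCochain j c.1 = 0 := (K.functionalEquiv j).injective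
      (h.trans (map_zero _).symm)
    obtain ⟨i, y, hy⟩ := homotopy_comp_boundary K.ofBarToBar j (ofCochain j c.1) hc
    rw [HomologicalComplex.comp_f, HomologicalComplex.id_f, Category.id_comp, Category.assoc, h0,
      Limits.comp_zero, zero_sub] at hy
    obtain ⟨z, rfl⟩ := (ofCochain i).surjective y
    refine ⟨i, -z, (ofCochain j).injective ?_⟩
    rw [ofCochain_d, map_neg, Preadditive.comp_neg]
    exact neg_eq_iff_eq_neg.2 hy

/-- The cohomology of the normal subgroup, in terms of a minimal resolution. -/
noncomputable def IsMinimal.cohomologyEquiv (hK : K.IsMinimal) (j : ℕ) :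
    groupCohomology (Rep.trivial k N k) j ≃ₗ[k]
      normalEquivariant (K.complex.X j) (Rep.trivial k (N ⋊[φ] G) k) :=
  equivOfKerEq (cohomologyClass _ j) (K.functionalOfCochain j ∘ₗ Submodule.subtype _)
    (cohomologyClass_surjective _ j) (hK.functionalOfCochain_surjective j)
    (hK.functionalOfCochain_eq_zero_iff j)

theorem IsMinimal.cohomologyEquiv_class (hK : K.IsMinimal) (j : ℕ)
    (c : LinearMap.ker ((groupCohomology.inhomogeneousCochains (Rep.trivial k N k)).d
        j (j + 1)).hom) :
    hK.cohomologyEquiv j (cohomologyClass _ j c) = K.functionalOfCochain j c.1 :=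
  equivOfKerEq_apply _ _ _ _ _ c

/-- The map induced by an automorphism on the terms of the bar resolution. -/
noncomputable def barTwist (β : MulAut N) (j : ℕ) :
    Rep.free k N (Fin j → N) ⟶ Rep.res β.toMonoidHom (Rep.free k N (Fin j → N)) :=
  Rep.freeLift k N (Rep.res β.toMonoidHom (Rep.free k N (Fin j → N))) fun x : Fin j → N =>
    Finsupp.single (fun i => β (x i)) (MonoidAlgebra.single (1 : N) (1 : k))

theorem barTwist_single (β : MulAut N) (j : ℕ) (x : Fin j → N) (y : N) (r : k) :
    ((barTwist β j).hom (Finsupp.single x (MonoidAlgebra.single y r)) :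
        (Fin j → N) →₀ MonoidAlgebra k N) =
      Finsupp.single (fun i => β (x i)) (MonoidAlgebra.single (β y) r) := by
  have h := Representation.freeLift_single_single
    ((Representation.free k N (Fin j → N)).comp β.toMonoidHom) x y r
    fun x : Fin j → N => Finsupp.single (fun i => β (x i)) (MonoidAlgebra.single (1 : N) (1 : k))
  have h' : r • ((Representation.free k N (Fin j → N)).comp β.toMonoidHom) y
      (Finsupp.single (fun i => β (x i)) (MonoidAlgebra.single (1 : N) (1 : k))) =
      Finsupp.single (fun i => β (x i)) (MonoidAlgebra.single (β y) r) := by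
    change r • (Representation.free k N (Fin j → N)) (β y) _ = _
    simp
  exact h.trans h'

theorem barTwist_d (β : MulAut N) (j : ℕ) :
    barTwist β (j + 1) ≫ (Rep.resFunctor β.toMonoidHom).map (Rep.barComplex.d k N j) =
      Rep.barComplex.d k N j ≫ barTwist β j := by
  refine Rep.free_ext k N _ _ _ fun x => ?_
  change (Rep.barComplex.d k N j).hom ((barTwist β (j + 1)).hom
    (Finsupp.single x (MonoidAlgebra.single 1 1))) = (barTwist β j).hom
      ((Rep.barComplex.d k N j).hom (Finsupp.single x (MonoidAlgebra.single 1 1)))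
  rw [barTwist_single, map_one, Rep.barComplex.d_single, Rep.barComplex.d_single]
  refine Eq.trans ?_ (map_add (barTwist β j).hom.toLinearMap _ _).symm
  refine congrArg₂ _ (barTwist_single β j _ _ _).symm ?_
  refine Eq.trans ?_ (map_sum (barTwist β j).hom.toLinearMap _ _).symm
  refine Finset.sum_congr rfl fun i _ => ?_
  refine Eq.trans ?_ (barTwist_single β j _ _ _).symm
  rw [map_one]
  congr 1
  exact (Fin.comp_contractNth (· * ·) (· * ·) (map_mul β) i x).symm

theorem barTwist_ofCochain (β : MulAut N) (j : ℕ) (c : (Fin j → N) → k)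
    (x : Rep.free k N (Fin j → N)) :
    (ofCochain j c).hom ((barTwist β j).hom x) =
      (ofCochain j fun x => c fun i => β (x i)).hom x := by
  have : barTwist β j ≫ (Rep.resFunctor β.toMonoidHom).map (ofCochain j c) =
      ofCochain j fun x => c fun i => β (x i) := by
    refine Rep.free_ext k N _ _ _ fun x => ?_
    change (ofCochain j c).hom ((barTwist β j).hom
      (Finsupp.single x (MonoidAlgebra.single 1 1))) = (ofCochain j fun x => c fun i => β (x i)).hom
      (Finsupp.single x (MonoidAlgebra.single 1 1))
    rw [barTwist_single, ofCochain_single, ofCochain_single]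
  exact congr($(this).hom x)

variable (K) in
/-- The conjugate by an element of `G` of the comparison map to the bar resolution, in a given
degree. -/
noncomputable def conjToBarApp (g : G) (j : ℕ) :
    K.resolution.complex.X j ⟶ (Rep.barComplex k N).X j :=
  Rep.ofHom (ρ := (Rep.res (inl : N →* N ⋊[φ] G) (K.complex.X j)).ρ)
    (σ := Representation.free k N (Fin j → N))
    { ((barTwist (φ g⁻¹) j).hom.toLinearMap ∘ₗ
        ((K.toBar.f j).hom.toLinearMap : K.complex.X j →ₗ[k] Rep.free k N (Fin j → N)) ∘ₗ
          (K.complex.X j).ρ (inr g)) with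
      isIntertwining' := fun l => LinearMap.ext fun x => by
        have h1 :
            (K.toBar.f j).hom ((K.complex.X j).ρ (inl (φ g l)) ((K.complex.X j).ρ (inr g) x)) =
            (Rep.free k N (Fin j → N)).ρ (φ g l)
              ((K.toBar.f j).hom ((K.complex.X j).ρ (inr g) x)) :=
          Rep.hom_comm_apply (K.toBar.f j) (φ g l) _
        have h2 := Rep.hom_comm_apply (barTwist (k := k) (φ g⁻¹) j) (φ g l)
          ((K.toBar.f j).hom ((K.complex.X j).ρ (inr g) x))
        -- Moving `inr g` past `inl l` replaces `l` by `φ g l`, and the twist by `φ g⁻¹` undoes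
        -- this; so the composite is `N`-linear.
        have h3 : φ g⁻¹ (φ g l) = l := by simp
        change (barTwist (φ g⁻¹) j).hom ((K.toBar.f j).hom
          ((K.complex.X j).ρ (inr g) ((K.complex.X j).ρ (inl l) x))) = _
        rw [rep_inr_inl]
        refine (congrArg (barTwist (φ g⁻¹) j).hom h1).trans (h2.trans ?_)
        change (Rep.free k N (Fin j → N)).ρ (φ g⁻¹ (φ g l)) _ = _
        rw [h3]
        rfl }

theorem conjToBarApp_apply (g : G) (j : ℕ) (x : K.complex.X j) :
    (K.conjToBarApp g j).hom x =
      (barTwist (k := k) (φ g⁻¹) j).hom ((K.toBar.f j).hom ((K.complex.X j).ρ (inr g) x)) :=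
  rfl

variable (K) in
/-- The conjugate by an element of `G` of the comparison map to the bar resolution. -/
noncomputable def conjToBar (g : G) : K.resolution.complex ⟶ Rep.barComplex k N where
  f := K.conjToBarApp g
  comm' i j h := by
    obtain rfl : j + 1 = i := h
    rw [Rep.barComplex.d_def]
    apply Rep.hom_injective
    refine DFunLike.ext _ _ fun x => ?_
    have h1 := congr($(barTwist_d (k := k) (φ g⁻¹) j).hom
      ((K.toBar.f (j + 1)).hom ((K.complex.X (j + 1)).ρ (inr g) x)))
    have h2 := congr($(K.toBar.comm (j + 1) j).hom ((K.complex.X (j + 1)).ρ (inr g) x))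
    rw [Rep.barComplex.d_def] at h2
    refine h1.trans (congrArg (barTwist (k := k) (φ g⁻¹) j).hom (h2.trans ?_))
    exact congrArg (K.toBar.f j).hom (Rep.hom_comm_apply (K.complex.d (j + 1) j) (inr g) x)

/-- The augmentation corresponds to a cochain of degree zero, and twisting does not change such a
cochain because there is only one empty tuple. -/
theorem bar_π_barTwist (β : MulAut N) (x : Rep.free k N (Fin 0 → N)) :
    ((Rep.barResolution k N).π.f 0).hom ((barTwist β 0).hom x) =
      ((Rep.barResolution k N).π.f 0).hom x := by
  obtain ⟨c, hc⟩ := (ofCochain 0).surjective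
    ((Rep.barResolution k N).π.f 0 : (Rep.barComplex k N).X 0 ⟶ Rep.trivial k N k)
  have h : (fun x : Fin 0 → N => (c : (Fin 0 → N) → k) fun i => β (x i)) = c :=
    funext fun x => congrArg (c : (Fin 0 → N) → k) (Subsingleton.elim _ _)
  have := barTwist_ofCochain β 0 c x
  rw [h, hc] at this
  exact this

theorem toBar_π (x : K.complex.X 0) :
    ((Rep.barResolution k N).π.f 0).hom ((K.toBar.f 0).hom x) = K.ε.hom x := by
  have h := congr($(ProjectiveResolution.lift_commutes_zero (𝟙 _) K.resolution
    (Rep.barResolution k N)).hom x)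
  refine h.trans ?_
  have h' : (K.resolution.π.f 0 : K.resolution.complex.X 0 ⟶ Rep.trivial k N k) =
      (Rep.resFunctor (inl : N →* N ⋊[φ] G)).map K.ε :=
    ChainComplex.toSingle₀Equiv_symm_apply_f_zero _ _
  change (K.resolution.π.f 0 : K.resolution.complex.X 0 ⟶ Rep.trivial k N k).hom x = _
  rw [h']
  rfl

variable (K) in
/-- The comparison map to the bar resolution is equivariant up to homotopy. -/
noncomputable def conjToBarHomotopy (g : G) : Homotopy (K.conjToBar g) K.toBar :=
  ProjectiveResolution.liftHomotopy (𝟙 _) (P := K.resolution) (Q := Rep.barResolution k N) _ _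
    (by
      ext : 1
      apply Rep.hom_injective
      refine DFunLike.ext _ _ fun x => ?_
      have h1 := bar_π_barTwist (k := k) (φ g⁻¹)
        ((K.toBar.f 0).hom ((K.complex.X 0).ρ (inr g) x))
      refine h1.trans ((toBar_π _).trans ((Rep.hom_comm_apply K.ε (inr g) x).trans ?_))
      refine (toBar_π (K := K) x).symm.trans ?_
      exact congr($(ProjectiveResolution.lift_commutes (𝟙 _) K.resolution
        (Rep.barResolution k N)).f 0 |>.hom x))
    (ProjectiveResolution.lift_commutes _ _ _)

/-- The comparison map and its conjugate by `g` both lift the identity, so they pull a cocycle back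
to cohomologous, hence equal, functionals. Evaluating the equality at `inr g⁻¹` applied to `x` gives
the claim. -/
theorem IsMinimal.functionalOfCochain_twist (hK : K.IsMinimal) (g : G) (j : ℕ)
    (c : (Fin j → N) → k)
    (hc : (groupCohomology.inhomogeneousCochains (Rep.trivial k N k)).d j (j + 1) c = 0) :
    K.functionalOfCochain j (fun x => c fun i => φ g⁻¹ (x i)) =
      (normalHom (K.complex.X j) (Rep.trivial k (N ⋊[φ] G) k)).ρ g
        (K.functionalOfCochain j c) := by
  have h := hK.eq_zero_of_boundary
    (homotopy_comp_boundary (K.conjToBarHomotopy g) j (ofCochain j c) (by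
      rw [← ofCochain_d]
      exact (congrArg _ hc).trans (map_zero _)))
  refine Subtype.ext (LinearMap.ext fun x => ?_)
  have h' := congr($(sub_eq_zero.1 h).hom ((K.complex.X j).ρ (inr g⁻¹) x))
  refine Eq.trans ?_ h'
  refine (barTwist_ofCochain (φ g⁻¹) j c ((K.toBar.f j).hom x)).symm.trans ?_
  change (ofCochain j c).hom _ = (ofCochain j c).hom ((K.conjToBarApp g j).hom _)
  rw [conjToBarApp_apply]
  simp

/-- This makes the comparison an isomorphism of `G`-modules for the action on `latticeCohomology`,
which also uses `g⁻¹`. -/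
theorem IsMinimal.cohomologyEquiv_map (hK : K.IsMinimal) (g : G) (j : ℕ)
    (x : groupCohomology (Rep.trivial k N k) j) :
    hK.cohomologyEquiv j ((groupCohomology.map (A := Rep.trivial k N k) (B := Rep.trivial k N k)
      (φ g⁻¹).toMonoidHom (Rep.ofHom ⟨LinearMap.id, fun _ => rfl⟩) j).hom x) =
    (normalHom (K.complex.X j) (Rep.trivial k (N ⋊[φ] G) k)).ρ g (hK.cohomologyEquiv j x) := by
  obtain ⟨c, rfl⟩ := cohomologyClass_surjective
    (groupCohomology.inhomogeneousCochains (Rep.trivial k N k)) j x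
  let f := groupCohomology.cochainsMap (A := Rep.trivial k N k) (B := Rep.trivial k N k)
    (φ g⁻¹).toMonoidHom (Rep.ofHom ⟨LinearMap.id, fun _ => rfl⟩)
  have hf : ((groupCohomology.inhomogeneousCochains (Rep.trivial k N k)).d j (j + 1)).hom
      ((f.f j).hom c.1) = 0 := by
    refine congr($(f.comm j (j + 1)).hom c.1).trans ?_
    exact (congrArg (f.f (j + 1)).hom c.2).trans (map_zero _)
  have h1 := homologyMap_cohomologyClass f j c ⟨(f.f j).hom c.1, hf⟩ rfl
  refine (congrArg (hK.cohomologyEquiv j) h1).trans ?_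
  refine (hK.cohomologyEquiv_class j _).trans ?_
  refine (hK.functionalOfCochain_twist g j c.1 c.2).trans ?_
  exact congrArg _ (hK.cohomologyEquiv_class j c).symm

end EquivariantResolution

end NormalCohomology


/-! ### Free resolutions over the group ring of a lattice as equivariant resolutions -/

section GroupRingModule

variable {k : Type} [CommRing k] {L : Type} [AddCommGroup L]

theorem single_eq_algebraMap_mul (l : L) (r : k) :
    AddMonoidAlgebra.single l r =
      algebraMap k (AddMonoidAlgebra k L) r * AddMonoidAlgebra.single l 1 := by
  rw [← Algebra.smul_def]
  simp

theorem map_smul_of_map_single_smul {M M' : Type} [AddCommGroup M] [AddCommGroup M']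
    [Module k M] [Module k M'] [Module (AddMonoidAlgebra k L) M] [Module (AddMonoidAlgebra k L) M']
    [IsScalarTower k (AddMonoidAlgebra k L) M] [IsScalarTower k (AddMonoidAlgebra k L) M']
    (f : M →ₗ[k] M') (hf : ∀ (l : L) x, f (AddMonoidAlgebra.single l (1 : k) • x) =
      AddMonoidAlgebra.single l (1 : k) • f x) (a : AddMonoidAlgebra k L) (x : M) :
    f (a • x) = a • f x := by
  induction a using AddMonoidAlgebra.induction_linear with
  | zero => simp
  | add a b ha hb => rw [add_smul, map_add, ha, hb, add_smul]
  | single l r =>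
    rw [single_eq_algebraMap_mul, mul_smul, mul_smul, algebraMap_smul, algebraMap_smul, map_smul,
      hf]

/-- A representation of a lattice as a module over the group ring. -/
noncomputable abbrev groupRingModule (Z : Rep.{0} k (Multiplicative L)) :
    Module (AddMonoidAlgebra k L) Z :=
  Module.compHom Z (AddMonoidAlgebra.lift k (Module.End k Z) L Z.ρ).toRingHom

theorem groupRingModule_single_smul (Z : Rep.{0} k (Multiplicative L)) (l : L) (z : Z) :
    (groupRingModule Z).toSMul.smul (AddMonoidAlgebra.single l (1 : k)) z =
      Z.ρ (Multiplicative.ofAdd l) z := by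
  change (AddMonoidAlgebra.lift k (Module.End k Z) L Z.ρ (AddMonoidAlgebra.single l 1)) z = _
  simp

theorem groupRingModule_isScalarTower (Z : Rep.{0} k (Multiplicative L)) :
    letI := groupRingModule Z
    IsScalarTower k (AddMonoidAlgebra k L) Z :=
  letI := groupRingModule Z
  ⟨fun r a z => by
    change (AddMonoidAlgebra.lift k (Module.End k Z) L Z.ρ (r • a)) z =
      r • (AddMonoidAlgebra.lift k (Module.End k Z) L Z.ρ a) z
    rw [map_smul]
    rfl⟩

/-- A representation of a lattice that is a free module over the group ring is projective. -/
theorem projective_of_free_groupRing (X : Rep.{0} k (Multiplicative L))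
    [Module (AddMonoidAlgebra k L) X] [Module.Free (AddMonoidAlgebra k L) X]
    [IsScalarTower k (AddMonoidAlgebra k L) X]
    (hX : ∀ (l : L) (x : X), X.ρ (Multiplicative.ofAdd l) x =
      AddMonoidAlgebra.single l (1 : k) • x) : Projective X where
  factors {Y Z} f e _ := by
    let := groupRingModule Y
    let := groupRingModule Z
    have := groupRingModule_isScalarTower Y
    have := groupRingModule_isScalarTower Z
    -- Morphisms of representations are linear over the group ring, so the lift can be built on a
    -- basis of `X` over the group ring.
    have hlin : ∀ {W W' : Rep.{0} k (Multiplicative L)} [Module (AddMonoidAlgebra k L) W]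
        [Module (AddMonoidAlgebra k L) W'] [IsScalarTower k (AddMonoidAlgebra k L) W]
        [IsScalarTower k (AddMonoidAlgebra k L) W'] (u : W ⟶ W')
        (_ : ∀ (l : L) (x : W), AddMonoidAlgebra.single l (1 : k) • x =
          W.ρ (Multiplicative.ofAdd l) x)
        (_ : ∀ (l : L) (x : W'), AddMonoidAlgebra.single l (1 : k) • x =
          W'.ρ (Multiplicative.ofAdd l) x) (a : AddMonoidAlgebra k L) (x : W),
        u.hom (a • x) = a • u.hom x := by
      intro W W' _ _ _ _ u h h' a x
      refine map_smul_of_map_single_smul u.hom.toLinearMap (fun l x => ?_) a x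
      rw [h, h']
      exact Rep.hom_comm_apply u _ x
    have he := (Rep.epi_iff_surjective e).1 inferInstance
    let B := Module.Free.chooseBasis (AddMonoidAlgebra k L) X
    choose z hz using fun i => he (f.hom (B i))
    let h : X →ₗ[AddMonoidAlgebra k L] Y := B.constr ℕ z
    let h' : X →ₗ[k] Y :=
      { h with
        map_smul' := fun r x => by
          rw [← algebraMap_smul (AddMonoidAlgebra k L) r x]
          change h _ = r • h x
          rw [map_smul, algebraMap_smul] }
    refine ⟨Rep.ofHom ⟨h', fun l => LinearMap.ext fun x => ?_⟩, ?_⟩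
    · change h (X.ρ l x) = Y.ρ l (h x)
      rw [← ofAdd_toAdd l, hX, map_smul]
      exact groupRingModule_single_smul Y _ _
    · let fl : X →ₗ[AddMonoidAlgebra k L] Z :=
        { f.hom.toLinearMap with
          map_smul' := hlin f (fun l x => (hX l x).symm) (groupRingModule_single_smul Z) }
      let el : Y →ₗ[AddMonoidAlgebra k L] Z :=
        { e.hom.toLinearMap with
          map_smul' := hlin e (groupRingModule_single_smul Y) (groupRingModule_single_smul Z) }
      have : el ∘ₗ h = fl := B.ext fun i => by
        change e.hom (h (B i)) = f.hom (B i)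
        rw [B.constr_basis, hz]
      apply Rep.hom_injective
      exact DFunLike.ext _ _ fun x => LinearMap.congr_fun this x

end GroupRingModule

/-! ### From compatible actions to representations of the semidirect product. -/

section OfCompatibleAction

open SemidirectProduct

variable {k : Type} [CommRing k] {G L : Type} [Group G] [AddCommGroup L]
  {ρ : Representation ℤ G L} {F : ChainComplex (ModuleCat (AddMonoidAlgebra k L)) ℕ}
  {ε : F.X 0 →ₛₗ[aug k L] k} (A : CompatibleAction ρ F ε)

/-- A module over the group ring as a module over the base ring. -/
noncomputable abbrev baseModule (M : ModuleCat (AddMonoidAlgebra k L)) : Module k M :=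
  Module.compHom M (algebraMap k (AddMonoidAlgebra k L))

namespace CompatibleAction

/-- The representation of `L ⋊ G` on a term of a complex with a compatible action. -/
noncomputable def rep (n : ℕ) : Rep.{0} k (SemiProd ρ) :=
  letI := baseModule (F.X n)
  Rep.of (X := F.X n)
    { toFun := fun γ =>
        { toFun := fun f => AddMonoidAlgebra.single (Multiplicative.toAdd γ.left) (1 : k) •
            A.τ γ.right n f
          map_add' := fun x y => by rw [map_add, smul_add]
          map_smul' := fun r x => by
            change AddMonoidAlgebra.single (Multiplicative.toAdd γ.left) (1 : k) •
                A.τ γ.right n (AddMonoidAlgebra.single (0 : L) r • x) =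
              AddMonoidAlgebra.single (0 : L) r •
                AddMonoidAlgebra.single (Multiplicative.toAdd γ.left) (1 : k) • A.τ γ.right n x
            -- The semilinear map is linear over `k` because scalars are multiples of the group
            -- element `0`, which `ρ` fixes.
            rw [map_smulₛₗ, smul_comm, groupRingAct_single, map_zero] }
      map_one' := LinearMap.ext fun f => by
        change AddMonoidAlgebra.single (0 : L) (1 : k) • A.τ 1 n f = f
        rw [A.one]
        exact one_smul _ f
      map_mul' := fun γ γ' => LinearMap.ext fun f => by
        change AddMonoidAlgebra.single (Multiplicative.toAdd γ.left +
          ρ γ.right (Multiplicative.toAdd γ'.left)) (1 : k) • A.τ (γ.right * γ'.right) n f =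
          AddMonoidAlgebra.single (Multiplicative.toAdd γ.left) (1 : k) • A.τ γ.right n
            (AddMonoidAlgebra.single (Multiplicative.toAdd γ'.left) (1 : k) • A.τ γ'.right n f)
        rw [map_smulₛₗ, A.mul, groupRingAct_single, smul_smul, AddMonoidAlgebra.single_mul_single,
          one_mul] }

theorem rep_ρ_apply (n : ℕ) (γ : SemiProd ρ) (f : F.X n) :
    (A.rep n).ρ γ f = AddMonoidAlgebra.single (Multiplicative.toAdd γ.left) (1 : k) •
      A.τ γ.right n f :=
  rfl

theorem rep_ρ_inl (n : ℕ) (l : Multiplicative L) (f : F.X n) :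
    (A.rep n).ρ (inl l) f = AddMonoidAlgebra.single (Multiplicative.toAdd l) (1 : k) • f := by
  rw [rep_ρ_apply, right_inl, left_inl, A.one]

/-- The differential as a morphism of representations. -/
noncomputable def repD (n : ℕ) : A.rep (n + 1) ⟶ A.rep n :=
  letI := baseModule (F.X n)
  letI := baseModule (F.X (n + 1))
  Rep.ofHom
    { toFun := (F.d (n + 1) n).hom
      map_add' := map_add _
      map_smul' := fun r x => map_smul (F.d (n + 1) n).hom (algebraMap k _ r) x
      isIntertwining' := fun γ => LinearMap.ext fun x => by
        change (F.d (n + 1) n).hom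
          (AddMonoidAlgebra.single (Multiplicative.toAdd γ.left) (1 : k) • A.τ γ.right (n + 1) x) =
          AddMonoidAlgebra.single (Multiplicative.toAdd γ.left) (1 : k) •
            A.τ γ.right n ((F.d (n + 1) n).hom x)
        rw [map_smul, A.comm] }

/-- The augmentation as a morphism of representations. -/
noncomputable def repε : A.rep 0 ⟶ Rep.trivial k (SemiProd ρ) k :=
  letI := baseModule (F.X 0)
  Rep.ofHom (σ := Representation.trivial k (SemiProd ρ) k)
    { toFun := ε
      map_add' := map_add _
      map_smul' := fun r x => by
        change ε (algebraMap k (AddMonoidAlgebra k L) r • x) = r • ε x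
        rw [map_smulₛₗ]
        congr 1
        exact aug_single k 0 r
      isIntertwining' := fun γ => LinearMap.ext fun x => by
        change ε (AddMonoidAlgebra.single (Multiplicative.toAdd γ.left) (1 : k) •
          A.τ γ.right 0 x) = ε x
        rw [map_smulₛₗ, A.aug_comm, aug_single, one_smul] }

/-- The complex of representations of `L ⋊ G` given by a compatible action. -/
noncomputable def repComplex : ChainComplex (Rep.{0} k (SemiProd ρ)) ℕ :=
  ChainComplex.of A.rep A.repD fun n => by
    apply Rep.hom_injective
    refine DFunLike.ext _ _ fun x => ?_
    exact congr($(F.d_comp_d (n + 2) (n + 1) n).hom x)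

theorem repComplex_d (n : ℕ) : A.repComplex.d (n + 1) n = A.repD n :=
  ChainComplex.of_d A.rep A.repD n

/-- A free resolution with a compatible action as an equivariant resolution. -/
noncomputable def equivariantResolution (hF : IsFreeResolution F ε) :
    EquivariantResolution k (latticeAut ρ) where
  complex := A.repComplex
  ε := A.repε
  projective n := by
    let : Module (AddMonoidAlgebra k L) (Rep.res inl (A.rep n)) :=
      inferInstanceAs (Module (AddMonoidAlgebra k L) (F.X n))
    have : Module.Free (AddMonoidAlgebra k L) (Rep.res inl (A.rep n)) := hF.free n
    have : IsScalarTower k (AddMonoidAlgebra k L) (Rep.res inl (A.rep n)) :=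
      ⟨fun r a x => by
        rw [Algebra.smul_def]
        exact mul_smul (α := AddMonoidAlgebra k L) (β := F.X n) _ _ _⟩
    exact projective_of_free_groupRing (Rep.res inl (A.rep n)) fun l x => A.rep_ρ_inl n _ x
  surjective := hF.surjective
  exact_zero := by
    rw [repComplex_d]
    exact hF.exact_zero
  exact n := by
    rw [repComplex_d, repComplex_d]
    exact hF.exact n

end CompatibleAction

end OfCompatibleAction


/-! ### Minimality of the Koszul complex -/

section Minimal

theorem koszulD_ιMulti {A M : Type*} [CommRing A] [AddCommGroup M] [Module A M]
    (φ : Module.Dual A M) (p : ℕ) (v : Fin (p + 1) → M) :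
    koszulD φ p (exteriorPower.ιMulti A (p + 1) v) =
      ∑ j : Fin (p + 1), ((-1) ^ (j : ℕ) * φ (v j)) •
        exteriorPower.ιMulti A p (fun i => v (j.succAbove i)) := by
  apply Subtype.ext
  change koszulDiff φ (exteriorPower.ιMulti A (p + 1) v).1 = _
  rw [exteriorPower.ιMulti_apply_coe, koszulDiff_ιMulti]
  simp

/-- The coefficients of the Koszul differential are values of `φ`, all of which `σ` sends to zero.
-/
theorem map_koszulD_eq_zero {A B M : Type*} [CommRing A] [CommRing B] [AddCommGroup M] [Module A M]
    {σ : A →+* B} {φ : Module.Dual A M} (hφ : ∀ m, σ (φ m) = 0) (p : ℕ)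
    (f : ⋀[A]^p M →ₛₗ[σ] B) (y : ⋀[A]^(p + 1) M) : f (koszulD φ p y) = 0 := by
  have hy : y ∈ Submodule.span A (Set.range (exteriorPower.ιMulti A (p + 1) (M := M))) := by
    rw [exteriorPower.ιMulti_span]
    trivial
  induction hy using Submodule.span_induction with
  | mem x h =>
    obtain ⟨v, rfl⟩ := h
    rw [koszulD_ιMulti, map_sum]
    refine Finset.sum_eq_zero fun j _ => ?_
    rw [map_smulₛₗ, map_mul, hφ, mul_zero, zero_smul]
  | zero => rw [map_zero, map_zero]
  | add x y _ _ hx hy => rw [map_add, map_add, hx, hy, add_zero]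
  | smul a x _ hx => rw [map_smul, map_smulₛₗ, hx, smul_zero]

theorem aug_koszulForm {k L : Type*} [CommRing k] [AddCommGroup L] {n : ℕ} (v : Fin n → L)
    (m : Fin n → AddMonoidAlgebra k L) : aug k L (koszulForm k v m) = 0 := by
  rw [koszulForm_apply, map_sum]
  refine Finset.sum_eq_zero fun i _ => ?_
  rw [map_mul, map_sub, aug_single, map_one, sub_self, mul_zero]

variable {k : Type} [CommRing k] {G L : Type} [Group G] [AddCommGroup L]
  {ρ : Representation ℤ G L}

open SemidirectProduct

/-- A functional invariant under `L` is semilinear along the augmentation, and the coefficients `x_i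
- 1` of the Koszul differential have augmentation zero. -/
theorem isMinimal_latticeKoszul {n : ℕ} (b : Module.Basis (Fin n) ℤ L)
    (A : CompatibleAction ρ (latticeKoszul k b) (latticeKoszulAug k b))
    (hF : IsFreeResolution (latticeKoszul k b) (latticeKoszulAug k b)) :
    (A.equivariantResolution hF).IsMinimal := by
  intro p f y
  have hf : ∀ (l : L) (x : (latticeKoszul k b).X p),
      f.1 (AddMonoidAlgebra.single l (1 : k) • x) = f.1 x := fun l x =>
    (congrArg f.1 (A.rep_ρ_inl p (Multiplicative.ofAdd l) x).symm).trans
      (f.2 (Multiplicative.ofAdd l) x)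
  have hsmul : ∀ (a : AddMonoidAlgebra k L) (x : (latticeKoszul k b).X p),
      f.1 (a • x) = aug k L a * f.1 x := by
    intro a x
    induction a using AddMonoidAlgebra.induction_linear with
    | zero => rw [zero_smul, map_zero, zero_mul]; exact map_zero f.1
    | add a c ha hc => rw [add_smul, map_add, add_mul, ← ha, ← hc]; exact map_add f.1 _ _
    | single l r =>
      rw [single_eq_algebraMap_mul, mul_smul, map_mul, aug_single, mul_one, ← hf l x]
      refine (map_smul f.1 r _).trans ?_
      congr 1
      exact (aug_single k 0 r).symm
  let f' : ⋀[AddMonoidAlgebra k L]^p (Fin n → AddMonoidAlgebra k L) →ₛₗ[aug k L] k :=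
    { toFun := f.1
      map_add' := map_add f.1
      map_smul' := hsmul }
  have h : (latticeKoszul k b).d (p + 1) p = ModuleCat.ofHom (koszulD (koszulForm k b) p) :=
    koszulComplex_d _ p
  have h' := map_koszulD_eq_zero (aug_koszulForm (k := k) b) p f' y
  have hd : (A.equivariantResolution hF).complex.d (p + 1) p = A.repD p := A.repComplex_d p
  rw [hd]
  change f.1 (((latticeKoszul k b).d (p + 1) p).hom y) = 0
  rw [h]
  exact h'

/-- The additive isomorphism onto a finite direct sum given by a linear one onto the product. -/
def addEquivDirectSum {R ι M : Type*} {N : ι → Type*} [Semiring R] [Fintype ι] [DecidableEq ι]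
    [AddCommMonoid M] [∀ i, AddCommMonoid (N i)] {_ : Module R M} {_ : ∀ i, Module R (N i)}
    (e : M ≃ₗ[R] ∀ i, N i) : M ≃+ DirectSum ι N :=
  e.toAddEquiv.trans (DirectSum.linearEquivFunOnFintype R ι N).symm.toAddEquiv

/-- The two `ℤ`-module structures are arbitrary arguments: every additive map is linear for any of
them, which removes all questions about which structure a cohomology group or a direct sum carries.
-/
theorem nonempty_intLinearEquiv {M N : Type*} [AddCommGroup M] [AddCommGroup N]
    {_ : Module ℤ M} {_ : Module ℤ N} (e : M ≃+ N) : Nonempty (M ≃ₗ[ℤ] N) :=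
  ⟨{ e with
    map_smul' := fun c x => ((congrArg e (int_smul_eq_zsmul _ c x)).trans (map_zsmul e c x)).trans
      (int_smul_eq_zsmul _ c (e x)).symm }⟩

/-- The cohomology of `L ⋊ G`, when a Koszul complex of `L` has a compatible action of `G`. -/
theorem nonempty_intCohomology_equiv {n : ℕ} (b : Module.Basis (Fin n) ℤ L)
    (A : CompatibleAction ρ (latticeKoszul ℤ b) (latticeKoszulAug ℤ b)) (m : ℕ) :
    Nonempty (intCohomology (SemiProd ρ) m ≃ₗ[ℤ]
      DirectSum (Finset.HasAntidiagonal.antidiagonal m) fun p =>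
        groupCohomology (latticeCohomology ρ p.1.2) p.1.1) := by
  have hF := isFreeResolution_latticeKoszul ℤ b
  have hK := isMinimal_latticeKoszul b A hF
  obtain ⟨e⟩ := nonempty_groupCohomology_equiv hK m
  have i : ∀ j, latticeCohomology ρ j ≅ normalHom ((A.equivariantResolution hF).complex.X j)
      (Rep.trivial ℤ (SemiProd ρ) ℤ) := fun j =>
    Rep.mkIso (Representation.Equiv.mk (hK.cohomologyEquiv j) fun g => LinearMap.ext fun x =>
      hK.cohomologyEquiv_map g j x)
  -- The coefficients `Hom_L(K_j, ℤ)` are replaced by the `G`-module `H^j(L, ℤ)` in each summand.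
  let e' := e ≪≫ₗ LinearEquiv.piCongrRight fun p =>
    ((groupCohomology.functor ℤ G p.1.1).mapIso (i p.1.2)).toLinearEquiv.symm
  exact nonempty_intLinearEquiv (addEquivDirectSum e')

end Minimal

end LatticeExt

theorem theorem5p1 {L : Type} [AddCommGroup L] [Module.Free ℤ L] [Module.Finite ℤ L]
    (ρ : Representation ℤ LatticeExt.C4 L) (hρ : LatticeExt.IsSumOfRho ρ) :
    (∀ (R : Type) [CommRing R] (n : ℕ) (b : Module.Basis (Fin n) ℤ L),
      LatticeExt.IsFreeResolution (LatticeExt.latticeKoszul R b)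
          (LatticeExt.latticeKoszulAug R b) ∧
        Nonempty (LatticeExt.CompatibleAction ρ (LatticeExt.latticeKoszul R b)
          (LatticeExt.latticeKoszulAug R b))) ∧
    ∀ k : ℕ, Nonempty
      (LatticeExt.intCohomology (LatticeExt.SemiProd ρ) k ≃ₗ[ℤ]
        DirectSum (Finset.HasAntidiagonal.antidiagonal k) fun p =>
          groupCohomology (LatticeExt.latticeCohomology ρ p.1.2) p.1.1) := by
  refine ⟨fun R _ n b => ⟨LatticeExt.isFreeResolution_latticeKoszul R b,
    LatticeExt.nonempty_compatibleAction b (LatticeExt.hasPeriodicLift_of_isSumOfRho R hρ b)⟩,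
    fun k => ?_⟩
  -- The cohomological statement mentions no basis, so any basis serves, with `R = ℤ`.
  have b := Module.finBasis ℤ L
  obtain ⟨A⟩ := LatticeExt.nonempty_compatibleAction b
    (LatticeExt.hasPeriodicLift_of_isSumOfRho ℤ hρ b)
  exact LatticeExt.nonempty_intCohomology_equiv b A k
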